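/- **Setting.** Let $\mathfrak g\subset\mathfrak{gl}(V)$ be a complex semi-simple Lie algebra acting irreducibly on the finite-dimensional complex vector space $V$, let $G\subset \mathrm{GL}(V)$ be the connected group generated by $\exp\mathfrak g$, and fix a Cartan and a Borel subalgebra $\mathfrak h\subset\mathfrak b\subset\mathfrak g$. Let $\pi,\pi^*$ be the highest weights of $V,V^*$, let $\mathsf v_0$ be a highest weight vector of $V$, and $Z=G\cdot[\mathsf v_0]\simeq G/P\subset\mathbb PV$, $m=\dim Z$. Let $\mathtt E\in\mathfrak h$ be the grading element: a simple root $\alpha_i$ has $\alpha_i(\mathtt E)=1$ if the fundamental weight $\pi_i$ occurs in $\pi$, and $\alpha_i(\mathtt E)=0$ otherwise. Put $\mathtt q=\pi(\mathtt E)+\pi^*(\mathtt E)\in\mathbb Z$. A subscript $d$ denotes the eigenspace of $\mathtt E$ of eigenvalue $d$; $\mathfrak g_-=\bigoplus_{d<0}\mathfrak g_d$, $\mathfrak g_{\ge0}=\bigoplus_{d\ge0}\mathfrak g_d$. Fix a frame (basis) $\mathsf v=(\mathsf v_0,\dots,\mathsf v_n)$ of $V$ consisting of $\mathtt E$-eigenvectors,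 starting with $\mathsf v_0$, such that $\mathsf v_0,\dots,\mathsf v_m$ span $\mathbb C\mathsf v_0+\mathfrak g.\mathsf v_0$; use it to identify $\mathrm{GL}(V)$ with the set of frames $v=g\cdot\mathsf v$, and put $\mathcal G=G\cdot\mathsf v$. The indices $\alpha,\beta$ run over $1,\dots,m$ and $\mu,\nu$ over $m+1,\dots,n$. Let $w_\alpha$ be the integer such that $\mathsf v_\alpha$ has $\mathtt E$-eigenvalue $\pi(\mathtt E)-w_\alpha$. Let $\mathfrak k$ be the set of $\zeta\in\mathfrak{gl}(V)$ with $(\mathbf u.\zeta)(\mathsf v_0)\in\mathbb C\mathsf v_0+\mathfrak g.\mathsf v_0$ for all $\mathbf u\in U(\mathfrak g_-)$ (adjoint action); assume that $\mathfrak g$ is maximal among the semi-simple subalgebras of $\mathfrak{gl}(V)$ contained in $\mathfrak k$. Fix a decomposition of $\mathfrak g$-modules $\mathfrak{gl}(V)=\mathfrak g\oplus\mathfrak g^\perp$. **Fubini forms.** For an irreducible projective variety $X\subset\mathbb PV$, $\mathcal F_X\subset\mathrm{GL}(V)$ is the bundle of first-order adapted frames: the frames $v$ such that $X$ is smooth of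 dimension $m$ at $[v_0]$ with affine tangent space $\mathrm{span}\{v_0,\dots,v_m\}$. Let $\omega=(\omega^i_j)$ be the Maurer–Cartan form, $\mathrm dv_j=\omega^i_jv_i$. The coefficients $r^\mu_{\alpha_1\cdots\alpha_k}:\mathcal F_X\to\mathbb C$ of the Fubini forms, symmetric in the lower indices, are defined by $r^\mu_\alpha=0$, $\omega^\mu_\alpha=r^\mu_{\alpha\beta}\omega^\beta_0$ and, for $k>1$, $$\begin{aligned} r^\mu_{\alpha_1\cdots\alpha_k\beta}\,\omega^\beta_0={}&-\mathrm dr^\mu_{\alpha_1\cdots\alpha_k}-(k-1)r^\mu_{\alpha_1\cdots\alpha_k}\omega^0_0-r^\nu_{\alpha_1\cdots\alpha_k}\omega^\mu_\nu+k\big\{(k-2)r^\mu_{(\alpha_1\cdots\alpha_{k-1}}\omega^0_{\alpha_k)}+r^\mu_{\beta(\alpha_1\cdots\alpha_{k-1}}\omega^\beta_{\alpha_k)}\big\}\\&-\sum_{j=1}^{k-2}\tbinom kj\big\{r^\mu_{\beta(\alpha_1\cdots\alpha_j}r^\nu_{\alpha_{j+1}\cdots\alpha_k)}\omega^\beta_\nu+(j-1)r^\mu_{(\alpha_1\cdots\alpha_j}r^\nu_{\alpha_{j+1}\cdots\alpha_k)}\omega^0_\nu\big\}\end{aligned}$$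 on $\mathcal F_X$, where parentheses denote symmetrization. A *sub-bundle of $\mathcal F_X$ over the general points of $X$* is an injectively immersed complex submanifold $\widetilde{\mathcal F}_X\subset\mathcal F_X$ mapping, by $v\mapsto[v_0]$, submersively onto a nonempty Zariski-open subset of $X$. The variety $X$ *agrees with $G/P\hookrightarrow\mathbb PV$ to graded-order $d$* if there is such a sub-bundle $\widetilde{\mathcal F}_X$ on which, for all $k\ge2$, all $\mu$ and all $\alpha_1,\dots,\alpha_k$ with $w_{\alpha_1}+\dots+w_{\alpha_k}\le d$, the coefficient $r^\mu_{\alpha_1\cdots\alpha_k}$ of $X$ is constant, equal to the coefficient $r^\mu_{\alpha_1\cdots\alpha_k}$ of $Z$ at the frame $\mathsf v$. We say that $G/P\hookrightarrow\mathbb PV$ is *graded-FGH rigid at graded-order $d$* if every irreducible projective variety $X\subset\mathbb PV$ that agrees with it to graded-order $d$ is $A\cdot Z$ for some $A\in\mathrm{GL}(V)$. **Filtered systems.** Give $T^*\mathrm{GL}(V)$ the left-invariant filtration with $T^*_{c,\mathrm{Id}}=\mathrm{Ann}\big(\bigoplus_{d>c}\mathfrak{gl}(V)_d\big)$. For $p\in\mathbb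 Z$ let $I\subset J\subset T^*\mathrm{GL}(V)$ be the left-invariant sub-bundles with $$I_{\mathrm{Id}}=\mathrm{Ann}\big(\mathfrak g\oplus\mathfrak g^\perp_{>p}+\mathbb C\,\mathrm{Id}\big),\qquad J_{\mathrm{Id}}=\mathrm{Ann}\big(\mathfrak g_{\ge0}\oplus\mathfrak g^\perp_{>p}+\mathbb C\,\mathrm{Id}\big),$$ that is, framed by the trace-free part of $\omega_{\mathfrak g^\perp_{\le p}}$, respectively by this together with $\omega_{\mathfrak g_-}$. For $r>0$, an integral manifold of $\mathrm{Filt}_r(\mathfrak g_-,\mathfrak g^\perp_{\le p})$ is an immersed complex submanifold $i:M\to\mathrm{GL}(V)$ such that $i^*(I\cap T^*_c)\equiv0\bmod i^*(J\cap T^*_{c-r})$ for all $c\in\mathbb Z$, and such that $i^*(J)$ has at each point rank equal to $\mathrm{rank}\,J-\mathrm{rank}\,I$ (so that $i^*(J)=T^*M$ when $\dim M=\mathrm{rank}\,J-\mathrm{rank}\,I$). The system is *rigid* if for every connected integral manifold $M$ there is $A\in\mathrm{GL}(V)$ with $A\cdot M\subset\mathbb C^*\cdot\mathcal G$; it is *rigid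 on the level of points* if for every connected integral manifold $M$ there is $A\in\mathrm{GL}(V)$ such that $A[v_0]\in Z$ for all frames $v$ in $M$ (this is implied by rigidity). **Proposition.** Let $p\ge-\mathtt q$ be an integer with $p+2>0$, and set $d=\mathtt q+p+1$. If an irreducible projective variety $X\subset\mathbb PV$ agrees with $G/P\hookrightarrow\mathbb PV$ to graded-order $d$, and $\widetilde{\mathcal F}_X\subset\mathcal F_X$ is a sub-bundle as in the definition of agreement, then $\widetilde{\mathcal F}_X$ is an integral manifold of $\mathrm{Filt}_{p+2}(\mathfrak g_-,\mathfrak g^\perp_{\le p})$. Consequently, if this filtered system is rigid, or only rigid on the level of points, then $G/P\hookrightarrow\mathbb PV$ is graded-FGH rigid at graded-order $\mathtt q+p+1$. -/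

import Mathlib

open scoped Manifold ContDiff Topology LinearAlgebra.Projectivization

attribute [local instance 100] LieRing.ofAssociativeRing

noncomputable section

namespace FubiniRigidity

/-! ### Coordinates, frames, points

The vector space `V` of dimension `n + 1 = 1 + m + e` is written in coordinates with respect to a
fixed reference frame `𝗏 = (𝗏_0, 𝗏_α, 𝗏_μ)`. -/

/-- The index set `{0} ⊔ {α} ⊔ {μ}`, with `m` tangential and `e` normal indices. -/
abbrev Idx (m e : ℕ) : Type := Unit ⊕ (Fin m ⊕ Fin e)

section Indices
variable {m e : ℕ}

/-- The index `0`. -/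
abbrev i0 : Idx m e := Sum.inl ()

/-- The tangential index `α`. -/
abbrev iT (α : Fin m) : Idx m e := Sum.inr (Sum.inl α)

/-- The normal index `μ`. -/
abbrev iN (μ : Fin e) : Idx m e := Sum.inr (Sum.inr μ)

end Indices

/-- The vector space `V`, in the coordinates given by the reference frame. -/
abbrev Vec (m e : ℕ) : Type := Idx m e → ℂ

/-- The Lie algebra `gl(V)`. -/
abbrev Mat (m e : ℕ) : Type := Matrix (Idx m e) (Idx m e) ℂ

/-- The group `GL(V)`.  It is identified with the set of all frames of `V`: the group element `v`
is the frame `v_j = v • 𝗏_j`, that is, the columns of the matrix `v`; the reference frame is `1`. -/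
abbrev Frm (m e : ℕ) : Type := Matrix.GeneralLinearGroup (Idx m e) ℂ

/-- The vectors `𝗏_j` of the reference frame. -/
def refVec {m e : ℕ} (j : Idx m e) : Vec m e := Pi.single j 1

theorem refVec_ne_zero {m e : ℕ} (j : Idx m e) : refVec j ≠ 0 := by
  simp [refVec]

/-- The point `o = [𝗏_0]` of `ℙ V`.  The frame `v` lies over the point `[v_0] = v • o`. -/
def refPt (m e : ℕ) : ℙ ℂ (Vec m e) := Projectivization.mk ℂ (refVec i0) (refVec_ne_zero i0)

/-! ### Projective varieties and first order adapted frames -/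

section Varieties
variable {m e : ℕ}

/-- `X ⊆ ℙ V` is the zero locus of a set of homogeneous polynomials. -/
def IsZariskiClosed (X : Set (ℙ ℂ (Vec m e))) : Prop :=
  ∃ S : Set (MvPolynomial (Idx m e) ℂ), (∀ f ∈ S, ∃ d : ℕ, f.IsHomogeneous d) ∧
    ∀ (y : Vec m e) (hy : y ≠ 0),
      Projectivization.mk ℂ y hy ∈ X ↔ ∀ f ∈ S, MvPolynomial.eval y f = 0

/-- Projective varieties: irreducible Zariski closed subsets of `ℙ V`. -/
def IsProjectiveVariety (X : Set (ℙ ℂ (Vec m e))) : Prop :=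
  IsZariskiClosed X ∧ X.Nonempty ∧
    ∀ Y₁ Y₂ : Set (ℙ ℂ (Vec m e)), IsZariskiClosed Y₁ → IsZariskiClosed Y₂ →
      X ⊆ Y₁ ∪ Y₂ → X ⊆ Y₁ ∨ X ⊆ Y₂

/-- The cone over `X` in `V \ {0}`. -/
def cone (X : Set (ℙ ℂ (Vec m e))) : Set (Vec m e) :=
  {y | ∃ hy : y ≠ 0, Projectivization.mk ℂ y hy ∈ X}

/-- Near its point `y` the set `S` is a complex submanifold of `V`, with tangent space `T`:
it is the zero locus of a holomorphic submersion whose derivative at `y` has kernel `T`. -/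
def HasTangentSpace (S : Set (Vec m e)) (y : Vec m e) (T : Submodule ℂ (Vec m e)) : Prop :=
  ∃ (c : ℕ) (φ : Vec m e → (Fin c → ℂ)), AnalyticAt ℂ φ y ∧
    Function.Surjective (fderiv ℂ φ y) ∧ (fderiv ℂ φ y).ker = T ∧ y ∈ S ∧
    ∀ᶠ z in 𝓝 y, z ∈ S ↔ φ z = 0

/-- The bundle `ℱ_X` of first order adapted frames over the smooth points of `X` at which `X` has
dimension `m`: frames `v` with `[v_0] ∈ X` and `T̂_{[v_0]} X = span {v_0, v_1, …, v_m}`. -/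
def frameBundle (X : Set (ℙ ℂ (Vec m e))) : Set (Frm m e) :=
  {v | HasTangentSpace (cone X) (v • refVec i0)
    (Submodule.span ℂ (insert (v • refVec i0) (Set.range fun α : Fin m => v • refVec (iT α))))}

end Varieties

/-! ### Fubini forms in frames -/

section Fubini
variable {m e : ℕ}

/-- The velocity at `0` of a curve of frames. -/
def velocity (γ : ℂ → Frm m e) : Mat m e :=
  Matrix.of fun i j => deriv (fun t : ℂ => (γ t : Mat m e) i j) 0

/-- The value `(ω^i_j)` of the Maurer-Cartan form `v⁻¹ dv` on the velocity at `0` of a curve of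
frames; equivalently `dv_j = ∑ i, ω^i_j v_i`. -/
def mcCurve (γ : ℂ → Frm m e) : Mat m e :=
  ((γ 0)⁻¹ : Frm m e).val * velocity γ

/-- Holomorphic curves, defined near `0 ∈ ℂ`, in the frame bundle of `X`. -/
def IsCurveIn (X : Set (ℙ ℂ (Vec m e))) (γ : ℂ → Frm m e) : Prop :=
  (∀ i j, AnalyticAt ℂ (fun t : ℂ => (γ t : Mat m e) i j) 0) ∧ ∀ᶠ t in 𝓝 (0 : ℂ), γ t ∈ frameBundle X

/-- The functions `r s μ : ℱ_X → ℂ`, for `s = {α₁, …, α_k}`, are the coefficients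
`r^μ_{α₁⋯α_k}` of the Fubini forms of `X` in frames.  The coefficients are fully symmetric in the
lower indices, so these are recorded as a multiset.  The defining equations between 1-forms on
`ℱ_X`, namely `r^μ_α = 0`, `ω^μ_α = r^μ_{αβ} ω^β_0` and, for `k > 1`,

`r^μ_{α₁…α_kβ} ω^β_0 = - d r^μ_{α₁…α_k} - (k-1) r^μ_{α₁…α_k} ω^0_0 - r^ν_{α₁…α_k} ω^μ_ν`
`  + k { (k-2) r^μ_{(α₁…α_{k-1}} ω^0_{α_k)} + r^μ_{β(α₁…α_{k-1}} ω^β_{α_k)} }`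
`  - ∑_{j=1}^{k-2} (k choose j) { r^μ_{β(α₁…α_j} r^ν_{α_{j+1}…α_k)} ω^β_ν`
`                                + (j-1) r^μ_{(α₁…α_j} r^ν_{α_{j+1}…α_k)} ω^0_ν }`,

are imposed on every tangent vector of `ℱ_X` (every velocity of a holomorphic curve in `ℱ_X`).
Here `k` times a symmetrization `T_{(α₁…α_{k-1}} U_{α_k)}` is the sum of `T_{s - a} U_a` over the
elements `a` of `s`, and `k choose j` times `T_{(α₁…α_j} U_{α_{j+1}…α_k)}` is the sum of `T_t U_u`
over all splittings `s = t + u` (counted with multiplicity) with `t` of cardinality `j`. -/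
def IsFubiniCoeff (X : Set (ℙ ℂ (Vec m e)))
    (r : Multiset (Fin m) → Fin e → Frm m e → ℂ) : Prop :=
  (∀ (a : Fin m) (μ : Fin e), ∀ v ∈ frameBundle X, r {a} μ v = 0) ∧
  ∀ γ : ℂ → Frm m e, IsCurveIn X γ →
    (∀ (a : Fin m) (μ : Fin e), mcCurve γ (iN μ) (iT a) =
      ∑ b : Fin m, r {a, b} μ (γ 0) * mcCurve γ (iT b) i0) ∧
    ∀ s : Multiset (Fin m), 2 ≤ s.card → ∀ μ : Fin e,
      ∃ dr : ℂ, HasDerivAt (fun t : ℂ => r s μ (γ t)) dr 0 ∧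
        ∑ b : Fin m, r (b ::ₘ s) μ (γ 0) * mcCurve γ (iT b) i0 =
          - dr - ((s.card : ℂ) - 1) * r s μ (γ 0) * mcCurve γ i0 i0
          - ∑ ν : Fin e, r s ν (γ 0) * mcCurve γ (iN μ) (iN ν)
          + (s.map fun a =>
              ((s.card : ℂ) - 2) * r (s.erase a) μ (γ 0) * mcCurve γ i0 (iT a)
              + ∑ b : Fin m, r (b ::ₘ s.erase a) μ (γ 0) * mcCurve γ (iT b) (iT a)).sum
          - ((s.antidiagonal.filter fun tu => 1 ≤ tu.1.card ∧ 2 ≤ tu.2.card).map fun tu =>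
              ∑ b : Fin m, ∑ ν : Fin e,
                  r (b ::ₘ tu.1) μ (γ 0) * r tu.2 ν (γ 0) * mcCurve γ (iT b) (iN ν)
              + ((tu.1.card : ℂ) - 1) * ∑ ν : Fin e,
                  r tu.1 μ (γ 0) * r tu.2 ν (γ 0) * mcCurve γ i0 (iN ν)).sum

end Fubini

/-! ### Homogeneous embeddings -/

section Highest
open LieAlgebra.IsKilling

variable {L : Type*} [LieRing L] [LieAlgebra ℂ L] [FiniteDimensional ℂ L]
  [LieAlgebra.HasTrivialRadical ℂ L]

/-- The vector `w` of the `L`-module `W` is a highest weight vector of weight `χ`, for the Cartan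
subalgebra `H` and the Borel subalgebra given by the base `b` of the root system. -/
def IsHighestWeightVector (H : LieSubalgebra ℂ L) [H.IsCartanSubalgebra]
    (b : (rootSystem H).Base) {W : Type*} [AddCommGroup W] [Module ℂ W] [LieRingModule L W]
    (χ : Module.Dual ℂ H) (w : W) : Prop :=
  w ≠ 0 ∧ (∀ h : H, ⁅(h : L), w⁆ = χ h • w) ∧
    ∀ i : H.root, b.IsPos i → ∀ x ∈ LieAlgebra.rootSpace H i.1, ⁅x, w⁆ = 0

end Highest

/-- A homogeneous embedding `G/P ↪ ℙ V`, together with the choices made to study it: the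
semi-simple Lie algebra `𝔤 ⊆ gl(V)` acting irreducibly on `V`, a Cartan and a Borel subalgebra
(the latter through a base of the root system), the highest weight vector `𝗏_0`, the highest weight
`π*` of the dual module, the grading element `E`, and a reference frame `𝗏` of `V` consisting of
eigenvectors of `E` and adapted to the filtration `L_o ⊆ T̂_o Z ⊆ V`. -/
structure HomogeneousEmbedding (m e : ℕ) where
  /-- the Lie algebra `𝔤` -/
  g : LieSubalgebra ℂ (Mat m e)
  [semisimple : LieAlgebra.HasTrivialRadical ℂ g]
  irreducible : LieModule.IsIrreducible ℂ g (Vec m e)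
  /-- the Cartan subalgebra `𝔥` -/
  H : LieSubalgebra ℂ g
  [cartan : H.IsCartanSubalgebra]
  /-- the simple roots, which determine the Borel subalgebra `𝔟 ⊇ 𝔥` -/
  base : (LieAlgebra.IsKilling.rootSystem H).Base
  /-- the highest weight `π` of `V` -/
  wt : Module.Dual ℂ H
  highest : IsHighestWeightVector H base wt (refVec i0 : Vec m e)
  /-- the highest weight `π*` of the dual of `V` -/
  dualWt : Module.Dual ℂ H
  dualHighest : ∃ f : Module.Dual ℂ (Vec m e), IsHighestWeightVector H base dualWt f
  /-- the grading element `E`: it is dual to the sum of the simple roots indexed by `J`, where `J`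
  is the set of the simple roots whose fundamental weight occurs in `π` -/
  E : H
  grading : ∀ i ∈ base.support, (LieAlgebra.IsKilling.rootSystem H).root i E =
    open Classical in if wt ((LieAlgebra.IsKilling.rootSystem H).coroot i) = 0 then 0 else 1
  /-- `𝗏_j` is an eigenvector of `E`, of eigenvalue `π(E) - deg j` -/
  deg : Idx m e → ℕ
  homogeneous : ∀ j : Idx m e, ⁅(E : g), (refVec j : Vec m e)⁆ = (wt E - (deg j : ℂ)) • refVec j
  /-- `span {𝗏_0, …, 𝗏_m}` is the affine tangent space `T̂_o Z = L_o + 𝔤.𝗏_0` -/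
  adapted : Submodule.span ℂ
      (insert (refVec i0 : Vec m e) (Set.range fun α : Fin m => refVec (iT α))) =
    Submodule.span ℂ (insert (refVec i0) (Set.range fun ζ : g => ⁅ζ, (refVec i0 : Vec m e)⁆))
  /-- the integer `𝗊 = π(E) + π*(E)` -/
  q : ℤ
  q_eq : (q : ℂ) = wt E + dualWt E

namespace HomogeneousEmbedding
variable {m e : ℕ} (𝓗 : HomogeneousEmbedding m e)

/-- The grading element as an element of `gl(V)`. -/
def Emat : Mat m e := ((𝓗.E : 𝓗.g) : Mat m e)

/-- The component `gl(V)_d` of the `E`-graded decomposition of `gl(V)`. -/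
def glDeg (d : ℤ) : Submodule ℂ (Mat m e) where
  carrier := {ζ | ⁅𝓗.Emat, ζ⁆ = (d : ℂ) • ζ}
  add_mem' := by
    intro a b ha hb
    simp only [Set.mem_ofPred_eq] at ha hb ⊢
    rw [lie_add, ha, hb, smul_add]
  zero_mem' := by simp
  smul_mem' := by
    intro c x hx
    simp only [Set.mem_ofPred_eq] at hx ⊢
    rw [lie_smul, hx, smul_comm]

/-- `𝔤_- = ⨁_{d < 0} 𝔤_d`. -/
def gNeg : Submodule ℂ (Mat m e) := ⨆ d : {d : ℤ // d < 0}, 𝓗.g.toSubmodule ⊓ 𝓗.glDeg d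

/-- `𝔤_{≥0} = ⨁_{d ≥ 0} 𝔤_d`, the parabolic subalgebra `𝔭`. -/
def gNonneg : Submodule ℂ (Mat m e) := ⨆ d : {d : ℤ // 0 ≤ d}, 𝓗.g.toSubmodule ⊓ 𝓗.glDeg d

/-- The image of the connected group `G` in `GL(V)`: the subgroup generated by `exp 𝔤`. -/
def G : Subgroup (Frm m e) :=
  Subgroup.closure {h | ∃ A ∈ 𝓗.g, (h : Mat m e) = NormedSpace.exp A}

/-- The variety `Z = G · [𝗏_0] ≃ G/P`. -/
def Z : Set (ℙ ℂ (Vec m e)) := {x | ∃ h ∈ 𝓗.G, x = h • refPt m e}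

/-- The space `𝔨` of all `ζ ∈ gl(V)` with `(𝐮.ζ)_{N ⊗ L*} = 0` for all `𝐮` in the enveloping algebra
of `𝔤_-`, which is spanned by the products `u₁ ⋯ u_l` of elements of `𝔤_-`. -/
def kernel : Set (Mat m e) :=
  {ζ | ∀ l : List (Mat m e), (∀ u ∈ l, u ∈ 𝓗.gNeg) →
    ∀ μ : Fin e, (l.foldr (fun u z => ⁅u, z⁆) ζ) (iN μ) i0 = 0}

/-- `𝔤` is maximal among the semi-simple subalgebras of `gl(V)` contained in `𝔨`, that is, `G` is a
maximal semi-simple subgroup of the connected subgroup of `GL(V)` with Lie algebra `𝔨`. -/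
def IsMaximal : Prop :=
  ∀ s : LieSubalgebra ℂ (Mat m e), LieAlgebra.HasTrivialRadical ℂ s →
    𝓗.g ≤ s → (∀ ζ ∈ s, ζ ∈ 𝓗.kernel) → s = 𝓗.g

/-- `gl(V) = 𝔤 ⊕ 𝔤^⊥` is a decomposition of `𝔤`-modules. -/
def IsModuleComplement (gperp : Submodule ℂ (Mat m e)) : Prop :=
  IsCompl 𝓗.g.toSubmodule gperp ∧ ∀ x ∈ 𝓗.g, ∀ y ∈ gperp, ⁅x, y⁆ ∈ gperp

/-! ### Agreement to graded order `d` -/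

/-- The degree of the monomial `α₁⋯α_k` in `Sym_• 𝔤_+ = Sym_• (𝔤_-)^*`. -/
def symDeg (s : Multiset (Fin m)) : ℕ := (s.map fun α => 𝓗.deg (iT α)).sum

end HomogeneousEmbedding

section Manifolds
variable {m e : ℕ} (N : ℕ) {M : Type} [TopologicalSpace M] [ChartedSpace (EuclideanSpace ℂ (Fin N)) M]

/-- `g : M → GL(V)` is holomorphic. -/
def IsHolomorphicFrame (g : M → Frm m e) : Prop :=
  ∀ i j, MDifferentiable 𝓘(ℂ, EuclideanSpace ℂ (Fin N)) 𝓘(ℂ, ℂ) fun x => (g x : Mat m e) i j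

/-- The differential of `g : M → GL(V)` at `x`. -/
def frameDeriv (g : M → Frm m e) (x : M) :
    TangentSpace 𝓘(ℂ, EuclideanSpace ℂ (Fin N)) x →ₗ[ℂ] Mat m e where
  toFun ξ := Matrix.of fun i j =>
    (mfderiv 𝓘(ℂ, EuclideanSpace ℂ (Fin N)) 𝓘(ℂ, ℂ) (fun y => (g y : Mat m e) i j) x ξ : ℂ)
  map_add' ξ η := by
    ext i j
    exact map_add (mfderiv 𝓘(ℂ, EuclideanSpace ℂ (Fin N)) 𝓘(ℂ, ℂ)
      (fun y => (g y : Mat m e) i j) x) ξ η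
  map_smul' c ξ := by
    ext i j
    exact map_smul (mfderiv 𝓘(ℂ, EuclideanSpace ℂ (Fin N)) 𝓘(ℂ, ℂ)
      (fun y => (g y : Mat m e) i j) x) c ξ

/-- The pull-back `g^*ω = g⁻¹ dg` of the left-invariant Maurer-Cartan form of `GL(V)`, at `x`. -/
def maurerCartan (g : M → Frm m e) (x : M) :
    TangentSpace 𝓘(ℂ, EuclideanSpace ℂ (Fin N)) x →ₗ[ℂ] Mat m e :=
  LinearMap.mulLeft ℂ ((g x)⁻¹ : Frm m e).val ∘ₗ frameDeriv N g x

/-- `g : M → GL(V)` is a holomorphic immersion. -/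
def IsImmersedFrame (g : M → Frm m e) : Prop :=
  IsHolomorphicFrame N g ∧ ∀ x, Function.Injective (frameDeriv N g x)

/-- `g : M → ℱ_X` is a sub-bundle of `ℱ_X` defined over the general points of `X`: an injectively
immersed complex submanifold, which maps onto a nonempty Zariski open subset of `X` by a
submersion.  (On `ℱ_X` the 1-forms `ω^α_0` are the components of the differential of the projection
to `X` in the basis `v_α ⊗ v^0` of the tangent space `T_{[v_0]} X`.) -/
def IsFrameSubbundle (X : Set (ℙ ℂ (Vec m e))) (g : M → Frm m e) : Prop :=
  IsImmersedFrame N g ∧ Function.Injective g ∧ (∀ x, g x ∈ frameBundle X) ∧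
  (∃ Y : Set (ℙ ℂ (Vec m e)), IsZariskiClosed Y ∧ (X \ Y).Nonempty ∧
    (Set.range fun x => g x • refPt m e) = X \ Y) ∧
  ∀ x, Function.Surjective fun ξ => fun α : Fin m => maurerCartan N g x ξ (iT α) i0

/-- `g : M → ℱ_X` is a sub-bundle, over the general points of `X`, on which the coefficients of the
Fubini forms of `X` equal those of the graded Fubini forms `F_c` of `G/P ↪ ℙ V` with `c ≤ d`.  The
graded Fubini form `F_c` is the restriction of the Fubini form of `Z` at the reference frame `𝗏` to
the component of `E`-degree `-c` of `Sym^• 𝔤_-`. -/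
def IsAgreementBundle (𝓗 : HomogeneousEmbedding m e) (X : Set (ℙ ℂ (Vec m e))) (d : ℤ)
    (g : M → Frm m e) : Prop :=
  IsFrameSubbundle N X g ∧
  ∃ rX rZ : Multiset (Fin m) → Fin e → Frm m e → ℂ, IsFubiniCoeff X rX ∧ IsFubiniCoeff 𝓗.Z rZ ∧
    ∀ s : Multiset (Fin m), 2 ≤ s.card → (𝓗.symDeg s : ℤ) ≤ d →
      ∀ (μ : Fin e) (x : M), rX s μ (g x) = rZ s μ 1

/-! ### Filtered Pfaffian systems -/

/-- Integral manifolds of the `r`-filtered Pfaffian system `Filt_r(I, J)` on `GL(V)`, for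
left-invariant sub-bundles `I ⊆ J` of `T^* GL(V)` and a left-invariant filtration `T^*_c` of
`T^* GL(V)`.  All of them are given by their fibres at the identity, subspaces of the dual of
`gl(V)`; a left-invariant form with value `λ` at the identity pulls back to `λ ∘ (g⁻¹ dg)`.  The
conditions are `g^*(I_c) ≡ 0 mod g^*(J_{c-r})` for all `c`, and the independence condition that the
rank of `g^*(J)` is `rank J - rank I`. -/
def IsIntegralManifold (T : ℤ → Submodule ℂ (Module.Dual ℂ (Mat m e)))
    (I J : Submodule ℂ (Module.Dual ℂ (Mat m e))) (r : ℤ) (g : M → Frm m e) : Prop :=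
  IsImmersedFrame N g ∧
  (∀ x : M, ∀ c : ℤ, (I ⊓ T c).map (maurerCartan N g x).dualMap ≤
    (J ⊓ T (c - r)).map (maurerCartan N g x).dualMap) ∧
  ∀ x : M, Module.finrank ℂ I + Module.finrank ℂ (J.map (maurerCartan N g x).dualMap) =
    Module.finrank ℂ J

end Manifolds

namespace HomogeneousEmbedding
variable {m e : ℕ} (𝓗 : HomogeneousEmbedding m e)

/-- The filtration `T^*_c = Ann (⨁_{d > c} gl(V)_d)` at the identity. -/
def cotFilt (c : ℤ) : Submodule ℂ (Module.Dual ℂ (Mat m e)) :=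
  (⨆ d : {d : ℤ // c < d}, 𝓗.glDeg d).dualAnnihilator

/-- `𝔤^⊥_{>p} = ⨁_{d > p} 𝔤^⊥_d`. -/
def perpGT (gperp : Submodule ℂ (Mat m e)) (p : ℤ) : Submodule ℂ (Mat m e) :=
  ⨆ d : {d : ℤ // p < d}, gperp ⊓ 𝓗.glDeg d

/-- The line of scalars in `gl(V)`. -/
def scalars (m e : ℕ) : Submodule ℂ (Mat m e) := Submodule.span ℂ {(1 : Mat m e)}

/-- The bundle `I`, framed by the trace-free part of `ω_{𝔤^⊥_{≤p}}`: the annihilator of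
`𝔤 ⊕ 𝔤^⊥_{>p}` and of the scalars. (The scalars lie in `𝔤^⊥_0`, so that they matter only for
`p ≥ 0`.) -/
def sysI (gperp : Submodule ℂ (Mat m e)) (p : ℤ) : Submodule ℂ (Module.Dual ℂ (Mat m e)) :=
  (𝓗.g.toSubmodule ⊔ 𝓗.perpGT gperp p ⊔ scalars m e).dualAnnihilator

/-- The bundle `J`, framed by the trace-free part of `ω_{𝔤^⊥_{≤p}}` and by `ω_{𝔤_-}`: the annihilator
of `𝔤_{≥0} ⊕ 𝔤^⊥_{>p}` and of the scalars. -/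
def sysJ (gperp : Submodule ℂ (Mat m e)) (p : ℤ) : Submodule ℂ (Module.Dual ℂ (Mat m e)) :=
  (𝓗.gNonneg ⊔ 𝓗.perpGT gperp p ⊔ scalars m e).dualAnnihilator

/-- `g : M → GL(V)` is an integral manifold of `Filt_r(𝔤_-, 𝔤^⊥_{≤p})`. -/
def IsIntegral (gperp : Submodule ℂ (Mat m e)) (p r : ℤ) (N : ℕ) {M : Type} [TopologicalSpace M]
    [ChartedSpace (EuclideanSpace ℂ (Fin N)) M] (g : M → Frm m e) : Prop :=
  IsIntegralManifold N 𝓗.cotFilt (𝓗.sysI gperp p) (𝓗.sysJ gperp p) r g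

/-- The system `Filt_r(𝔤_-, 𝔤^⊥_{≤p})` is rigid: every connected integral manifold is carried into
`𝒢 = G · 𝗏`, up to rescaling of the frames, by left translation by some `A ∈ GL(V)`. -/
def IsRigid (gperp : Submodule ℂ (Mat m e)) (p r : ℤ) : Prop :=
  ∀ (N : ℕ) (M : Type) [TopologicalSpace M] [T2Space M] [SecondCountableTopology M]
    [ConnectedSpace M] [ChartedSpace (EuclideanSpace ℂ (Fin N)) M]
    [IsManifold 𝓘(ℂ, EuclideanSpace ℂ (Fin N)) ω M] (g : M → Frm m e),
    𝓗.IsIntegral gperp p r N g →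
      ∃ A : Frm m e, ∀ x : M, ∃ c : ℂ, ∃ h ∈ 𝓗.G, ((A * g x : Frm m e) : Mat m e) = c • (h : Mat m e)

/-- The system `Filt_r(𝔤_-, 𝔤^⊥_{≤p})` is rigid on the level of points: for every connected integral
manifold the points `[v_0]`, for all frames `v` in the manifold, lie in a translate of `Z`. -/
def IsPointRigid (gperp : Submodule ℂ (Mat m e)) (p r : ℤ) : Prop :=
  ∀ (N : ℕ) (M : Type) [TopologicalSpace M] [T2Space M] [SecondCountableTopology M]
    [ConnectedSpace M] [ChartedSpace (EuclideanSpace ℂ (Fin N)) M]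
    [IsManifold 𝓘(ℂ, EuclideanSpace ℂ (Fin N)) ω M] (g : M → Frm m e),
    𝓗.IsIntegral gperp p r N g →
      ∃ A : Frm m e, ∀ x : M, A • g x • refPt m e ∈ 𝓗.Z

/-- `X` agrees with `G/P ↪ ℙ V` to graded-order `d`. -/
def Agrees (X : Set (ℙ ℂ (Vec m e))) (d : ℤ) : Prop :=
  ∃ (N : ℕ) (M : Type) (_ : TopologicalSpace M) (_ : T2Space M) (_ : SecondCountableTopology M)
    (_ : ChartedSpace (EuclideanSpace ℂ (Fin N)) M)
    (_ : IsManifold 𝓘(ℂ, EuclideanSpace ℂ (Fin N)) ω M) (g : M → Frm m e),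
    IsAgreementBundle N 𝓗 X d g

/-- `G/P ↪ ℙ V` is graded-Fubini-Griffiths-Harris rigid at graded-order `d`: every variety which
agrees with it to graded-order `d` is projectively equivalent to it. -/
def IsGradedFGHRigid (d : ℤ) : Prop :=
  ∀ X : Set (ℙ ℂ (Vec m e)), IsProjectiveVariety X → 𝓗.Agrees X d →
    ∃ A : Frm m e, X = (fun x => A • x) '' 𝓗.Z

end HomogeneousEmbedding

end FubiniRigidity

end

/-! Let ζ be the value of the Maurer–Cartan form on a tangent vector of the sub-bundle. Where the
coefficients r are constant, their recursion becomes a system of equations linear in ζ, `fubiniEq`.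
With F the coefficients of Z at the reference frame, the system says that the linear vector field ζ
is tangent to the formal cone (1, -x, F(x)) (`mem_tangentAlgebra_graphSeries_iff`), so its solutions
form a Lie algebra. This algebra contains 𝔤, because r is constant on 𝒢 (`coeff_const`), and it lies
in 𝔨, because the equation with empty index reads ζ^μ_0 = 0. Its trace-free part contains 𝔤, hence
acts irreducibly and is semi-simple; by maximality the solutions are exactly 𝔤 + ℂ Id
(`mem_g_sup_scalars`).

The forms of Z are homogeneous for E, so the equation with indices (s, μ) only sees the entries of ζ
of degree |s| - deg μ, where deg μ ≤ 𝗊. If all degrees of ζ are ≥ c - p - 1, the equations of degree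
≤ c for X involve only coefficients of degree ≤ 𝗊 + p + 1, where X agrees with Z. Hence the part of
ζ in degrees ≤ c lies in 𝔤 + ℂ Id (`IsAgreeing.trunc_mem`). Dualized, this is the filtered system.
For the rank condition, if the ω^α_0 vanish on ζ, the same statement removes the negative degrees of
ζ one at a time from the bottom (`IsAgreeing.mem_glSupp_of_tangentialPart`).

Rigidity places each of the countably many components of the sub-bundle over a translate of Z. These
translates are closed, as Z is cut out by quadrics derived from the Killing form (`mem_cone_Z_iff`).
Since ℂ is uncountable, an irreducible variety covered by countably many closed sets lies in one of
them (`IsProjectiveVariety.exists_subset`), and X, having the dimension of Z, fills that translate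
by analytic continuation (`eq_of_subset`). -/

noncomputable section

namespace FubiniRigidity

/-! ### Highest weight vectors -/

section HighestWeight
open LieAlgebra LieAlgebra.IsKilling LieModule

variable {L : Type*} [LieRing L] [LieAlgebra ℂ L] [FiniteDimensional ℂ L]
  [LieAlgebra.HasTrivialRadical ℂ L] {H : LieSubalgebra ℂ L} [H.IsCartanSubalgebra]
  {b : (rootSystem H).Base} {W : Type*} [AddCommGroup W] [Module ℂ W] [LieRingModule L W]
  [LieModule ℂ L W] [FiniteDimensional ℂ W] {χ : Module.Dual ℂ H} {w : W}

/-- The element of the Cartan subalgebra that represents a weight for the Killing form. -/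
def killingDual (H : LieSubalgebra ℂ L) [H.IsCartanSubalgebra] (χ : Module.Dual ℂ H) : H :=
  (cartanEquivDual H).symm χ

theorem traceForm_killingDual (χ : Module.Dual ℂ H) (h : H) :
    traceForm ℂ H L (killingDual H χ) h = χ h := by
  have := LinearEquiv.apply_symm_apply (cartanEquivDual H) χ
  conv_rhs => rw [← this]
  rfl

theorem apply_killingDual_comm (χ ψ : Module.Dual ℂ H) :
    χ (killingDual H ψ) = ψ (killingDual H χ) := by
  rw [← traceForm_killingDual χ, ← traceForm_killingDual ψ, traceForm_comm]

theorem coroot_eq_smul_killingDual (i : H.root) :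
    (rootSystem H).coroot i = (2 * ((rootSystem H).root i (killingDual H ((rootSystem H).root i)))⁻¹)
      • killingDual H ((rootSystem H).root i) := by
  rw [rootSystem_coroot_apply, coroot, ← Nat.cast_smul_eq_nsmul ℂ, smul_smul]
  rfl

/-- The Killing length of the coroot is 4 / (α, α), and it is also the sum of the squares of the
integers ⟨β, α^∨⟩ over all roots β. This sum is positive because of the term β = α. -/
theorem root_killingDual_pos (i : H.root) :
    ∃ r : ℝ, 0 < r ∧ (rootSystem H).root i (killingDual H ((rootSystem H).root i)) = r := by
  set α := (rootSystem H).root i with hα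
  set c := α (killingDual H α) with hc
  have h2 : α ((rootSystem H).coroot i) = 2 := (rootSystem H).root_coroot_two i
  have hcor := coroot_eq_smul_killingDual i
  rw [← hα, ← hc] at hcor
  have hc0 : c ≠ 0 := by
    intro h0
    rw [hcor, h0] at h2
    simp at h2
  have h1 : traceForm ℂ H L ((rootSystem H).coroot i) ((rootSystem H).coroot i) = 4 * c⁻¹ := by
    rw [hcor]
    simp only [map_smul, LinearMap.smul_apply, smul_eq_mul, traceForm_killingDual]
    rw [← hc]
    field_simp
    norm_num
  have h3 : traceForm ℂ H L ((rootSystem H).coroot i) ((rootSystem H).coroot i) =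
      ((∑ j : H.root, ((rootSystem H).pairingIn ℤ j i) ^ 2 : ℤ) : ℂ) := by
    rw [← restrict_killingForm, ← corootForm_rootSystem_eq_killing,
      RootPairing.corootForm_apply_apply]
    push_cast
    refine Finset.sum_congr rfl fun j _ => ?_
    have := (rootSystem H).algebraMap_pairingIn ℤ j i
    simp only [algebraMap_int_eq, eq_intCast] at this
    rw [this, sq]
    rfl
  set n : ℤ := ∑ j : H.root, ((rootSystem H).pairingIn ℤ j i) ^ 2 with hn
  have hnpos : 0 < n := by
    refine Finset.sum_pos' (fun j _ => sq_nonneg _) ⟨i, Finset.mem_univ _, ?_⟩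
    simp
  refine ⟨4 / n, by positivity, ?_⟩
  have hn0 : (n : ℂ) ≠ 0 := by exact_mod_cast hnpos.ne'
  rw [h1] at h3
  push_cast
  rw [← h3]
  field_simp

/-- This is sl₂-theory: `w` is a primitive vector for the triple of the root, of weight χ(α^∨), and
the opposite root space is a line spanned by f. So f kills `w` precisely when this weight is zero.
-/
theorem IsHighestWeightVector.lie_eq_zero_iff (hw : IsHighestWeightVector H b χ w) {i : H.root}
    (hi : b.IsPos i) :
    (∃ n : ℕ, χ ((rootSystem H).coroot i) = n) ∧
    (χ ((rootSystem H).coroot i) = 0 → ∀ x ∈ rootSpace H (-(i.1 : H → ℂ)), ⁅x, w⁆ = 0) ∧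
    (χ ((rootSystem H).coroot i) ≠ 0 → ∀ x ∈ rootSpace H (-(i.1 : H → ℂ)), ⁅x, w⁆ = 0 → x = 0) := by
  have hi0 := H.isNonZero_coe_root i
  obtain ⟨h, e, f, ht, he, hf⟩ := exists_isSl2Triple_of_weight_isNonZero hi0
  have hh := ht.h_eq_coroot hi0 he hf
  have P : ht.HasPrimitiveVectorWith w (χ ((rootSystem H).coroot i)) :=
    ⟨hw.1, by rw [hh]; exact hw.2.1 _, hw.2.2 i hi e he⟩
  have hf' : ∀ x ∈ rootSpace H (-(i.1 : H → ℂ)), ∃ c : ℂ, c • f = x := by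
    intro x hx
    have h1 := finrank_rootSpace_eq_one (-i.1) (by simpa using hi0)
    exact (finrank_eq_one_iff_of_nonzero' (⟨f, by simpa using hf⟩ : rootSpace H (-i.1 : Weight ℂ H L))
      (by simpa using ht.f_ne_zero)).1 h1 ⟨x, by simpa using hx⟩ |>.imp fun c hc => by
        simpa using congrArg Subtype.val hc
  refine ⟨P.exists_nat, fun h0 x hx => ?_, fun h0 x hx hxw => ?_⟩
  · obtain ⟨c, rfl⟩ := hf' x hx
    have := P.pow_toEnd_f_eq_zero_of_eq_nat (n := 0) (by simpa using h0)
    simp only [zero_add, pow_one, toEnd_apply_apply] at this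
    rw [smul_lie, this, smul_zero]
  · obtain ⟨c, rfl⟩ := hf' x hx
    by_contra hc
    have hc0 : c ≠ 0 := by rintro rfl; simp at hc
    rw [smul_lie, smul_eq_zero_iff_right hc0] at hxw
    -- If f kills `w`, then so does h = [e, f], which forces the weight to vanish.
    have h1 := P.lie_h
    rw [← ht.lie_e_f, lie_lie, hxw, P.lie_e] at h1
    simp only [lie_zero, sub_self] at h1
    exact (smul_ne_zero h0 hw.1) h1.symm

/-- The values on a positive root of the grading element and of the dual of the highest weight are
natural, respectively nonnegative, and vanish simultaneously. -/
theorem IsHighestWeightVector.posRoot_values (hw : IsHighestWeightVector H b χ w) {E : H}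
    (hE : ∀ i ∈ b.support, (rootSystem H).root i E =
      open Classical in if χ ((rootSystem H).coroot i) = 0 then 0 else 1)
    {i : H.root} (hi : b.IsPos i) :
    ∃ (k : ℕ) (r : ℝ), (rootSystem H).root i E = k ∧ 0 ≤ r ∧
      (rootSystem H).root i (killingDual H χ) = r ∧ (k = 0 ↔ r = 0) := by
  have simple : ∀ i ∈ b.support, ∃ (k : ℕ) (r : ℝ), (rootSystem H).root i E = k ∧ 0 ≤ r ∧
      (rootSystem H).root i (killingDual H χ) = r ∧ (k = 0 ↔ r = 0) := by
    intro i hi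
    obtain ⟨n, hn⟩ := (hw.lie_eq_zero_iff (RootPairing.Base.isPos_of_mem_support hi)).1
    obtain ⟨s, hs, hs'⟩ := root_killingDual_pos i
    -- Here (χ, α) = χ(α^∨) (α, α) / 2, with `n` = χ(α^∨) and `s` = (α, α).
    have h1 : (rootSystem H).root i (killingDual H χ) = ((n * s / 2 : ℝ) : ℂ) := by
      rw [apply_killingDual_comm]
      rw [coroot_eq_smul_killingDual, map_smul, hs', smul_eq_mul] at hn
      have hs0 : (s : ℂ) ≠ 0 := by exact_mod_cast hs.ne'
      push_cast
      rw [← hn]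
      field_simp
    rw [hE i hi, hn, h1]
    by_cases hn0 : n = 0
    · exact ⟨0, _, by simp [hn0], by positivity, rfl, by simp [hn0]⟩
    · exact ⟨1, _, by simp [hn0], by positivity, rfl, by simp [hn0, hs.ne']⟩
  -- A positive root is reached by adding simple roots; both values are additive, and a sum of
  -- nonnegative numbers vanishes only if every term does.
  refine hi.induction_on_add simple fun i j k hk ih hj => ?_
  obtain ⟨k₁, r₁, h1, h2, h3, h4⟩ := ih
  obtain ⟨k₂, r₂, g1, g2, g3, g4⟩ := simple j hj
  refine ⟨k₁ + k₂, r₁ + r₂, ?_, by positivity, ?_, ?_⟩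
  · rw [hk, LinearMap.add_apply, h1, g1]; push_cast; rfl
  · rw [hk, LinearMap.add_apply, h3, g3]; push_cast; rfl
  · rw [add_eq_zero_iff_of_nonneg h2 g2, ← h4, ← g4]; omega

end HighestWeight
end FubiniRigidity

/-! ### Generation of irreducible modules by lowering operators -/

namespace FubiniRigidity

/-- If `U₀` is stable under `L` modulo the action of `A`, then in an irreducible module it generates
everything under the action of `A` alone. -/
theorem eq_top_of_lie_mem_of_isIrreducible {L : Type*} [LieRing L] [LieAlgebra ℂ L]
    {W : Type*} [AddCommGroup W] [Module ℂ W] [LieRingModule L W] [LieModule ℂ L W]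
    [LieModule.IsIrreducible ℂ L W] (A : Set L)
    (U₀ U : Submodule ℂ W) (hne : U₀ ≠ ⊥) (h₀ : ∀ x : L, ∀ u ∈ U₀, ⁅x, u⁆ ∈ U₀ ⊔
      Submodule.span ℂ {y | ∃ a ∈ A, y = ⁅a, u⁆})
    (hU₀ : U₀ ≤ U) (hU : ∀ a ∈ A, ∀ u ∈ U, ⁅a, u⁆ ∈ U) : U = ⊤ := by
  set F : Set (Submodule ℂ W) := {U | U₀ ≤ U ∧ ∀ a ∈ A, ∀ u ∈ U, ⁅a, u⁆ ∈ U} with hF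
  set S := sInf F with hS
  have hSU₀ : U₀ ≤ S := le_sInf fun U hU => hU.1
  have hSA : ∀ a ∈ A, ∀ u ∈ S, ⁅a, u⁆ ∈ S := by
    intro a ha u hu
    rw [hS, Submodule.mem_sInf] at hu ⊢
    exact fun U hU => hU.2 a ha u (hu U hU)
  -- `S` is the least `A`-stable subspace containing `U₀`. By the Leibniz rule, the elements of `S`
  -- that all of `L` sends into `S` form another such subspace, so minimality makes `S` stable under
  -- `L`.
  let S' : Submodule ℂ W :=
    { carrier := {u | u ∈ S ∧ ∀ x : L, ⁅x, u⁆ ∈ S}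
      add_mem' := fun {u v} hu hv => ⟨S.add_mem hu.1 hv.1, fun x => by
        rw [lie_add]; exact S.add_mem (hu.2 x) (hv.2 x)⟩
      zero_mem' := ⟨S.zero_mem, fun x => by simp⟩
      smul_mem' := fun c u hu => ⟨S.smul_mem c hu.1, fun x => by
        rw [lie_smul]; exact S.smul_mem c (hu.2 x)⟩ }
  have hS'F : S' ∈ F := by
    refine ⟨fun u hu => ⟨hSU₀ hu, fun x => ?_⟩, fun a ha u hu => ⟨hu.2 a, fun x => ?_⟩⟩
    · refine (sup_le hSU₀ (Submodule.span_le.2 ?_)) (h₀ x u hu)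
      rintro y ⟨a, ha, rfl⟩
      exact hSA a ha u (hSU₀ hu)
    · rw [leibniz_lie x a u]
      exact S.add_mem (hu.2 _) (hSA a ha _ (hu.2 x))
  have hSS' : S ≤ S' := sInf_le hS'F
  let N : LieSubmodule ℂ L W := { S with lie_mem := fun {x u} hu => (hSS' hu).2 x }
  have hN : N = ⊤ := by
    refine (eq_bot_or_eq_top N).resolve_left fun h => hne ?_
    have : (N : Submodule ℂ W) = ⊥ := by rw [h]; rfl
    exact le_bot_iff.1 (hSU₀.trans this.le)
  have hST : S = ⊤ := by
    have : (N : Submodule ℂ W) = ⊤ := by rw [hN]; rfl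
    exact this
  exact top_le_iff.1 (hST.symm.le.trans (sInf_le ⟨hU₀, hU⟩))

section HighestWeight
open LieAlgebra LieAlgebra.IsKilling LieModule

variable {L : Type*} [LieRing L] [LieAlgebra ℂ L] [FiniteDimensional ℂ L]
  [LieAlgebra.HasTrivialRadical ℂ L] {H : LieSubalgebra ℂ L} [H.IsCartanSubalgebra]
  {b : (rootSystem H).Base} {W : Type*} [AddCommGroup W] [Module ℂ W] [LieRingModule L W]
  [LieModule ℂ L W] [FiniteDimensional ℂ W] {χ : Module.Dual ℂ H} {w : W}

/-- Carries the defining property of E from the simple roots to all positive roots: χ(α^∨) is a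
nonzero multiple of (χ, α), which vanishes together with α(E). -/
theorem IsHighestWeightVector.coroot_eq_zero_iff (hw : IsHighestWeightVector H b χ w) {E : H}
    (hE : ∀ i ∈ b.support, (rootSystem H).root i E =
      open Classical in if χ ((rootSystem H).coroot i) = 0 then 0 else 1)
    {i : H.root} (hi : b.IsPos i) :
    χ ((rootSystem H).coroot i) = 0 ↔ (rootSystem H).root i E = 0 := by
  obtain ⟨k, r, h1, h2, h3, h4⟩ := hw.posRoot_values hE hi
  obtain ⟨s, hs, hs'⟩ := root_killingDual_pos i
  have hs0 : (s : ℂ) ≠ 0 := by exact_mod_cast hs.ne'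
  rw [h1, coroot_eq_smul_killingDual, map_smul, apply_killingDual_comm χ, h3, hs', smul_eq_mul]
  simp [hs0, h4]

theorem isPos_or_eq_neg (b : (rootSystem H).Base) (i : H.root) :
    b.IsPos i ∨ ∃ j, b.IsPos j ∧ (i.1 : H → ℂ) = -(j.1 : H → ℂ) := by
  refine (RootPairing.Base.IsPos.or_neg b i).imp_right fun h => ⟨_, h, ?_⟩
  have h1 := ((rootSystem H).root_reflectionPerm i i).trans ((rootSystem H).reflection_apply_self i)
  funext y
  have h2 := LinearMap.congr_fun h1 y
  change ((((rootSystem H).reflectionPerm i) i).1 : H → ℂ) y = -(i.1 : H → ℂ) y at h2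
  change _ = -((((rootSystem H).reflectionPerm i) i).1 : H → ℂ) y
  rw [h2, neg_neg]

theorem isPos_induction (b : (rootSystem H).Base) {p : L → Prop} (zero : p 0)
    (add : ∀ x y, p x → p y → p (x + y)) (cartan : ∀ h : H, p h)
    (pos : ∀ i, b.IsPos i → ∀ x ∈ rootSpace H (i.1 : H → ℂ), p x)
    (neg : ∀ i, b.IsPos i → ∀ x ∈ rootSpace H (-(i.1 : H → ℂ)), p x) (x : L) : p x := by
  have hx : x ∈ ⨆ α : Weight ℂ H L, rootSpace H α := by
    simp [iSup_genWeightSpace_eq_top' ℂ H L]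
  induction hx using LieSubmodule.iSup_induction' with
  | zero => exact zero
  | add x y _ _ hx hy => exact add x y hx hy
  | mem α x hx =>
    by_cases hα : α.IsZero
    · rw [Weight.IsZero] at hα
      rw [hα] at hx
      have : x ∈ H := by simpa using hx
      exact cartan ⟨x, this⟩
    · let i : H.root := ⟨α, by simpa using hα⟩
      rcases isPos_or_eq_neg b i with h | ⟨j, hj, h⟩
      · exact pos i h x hx
      · exact neg j hj x (h ▸ hx)

/-- An irreducible module is generated by its highest weight vector under the root vectors of
negative `E`-degree. -/
theorem IsHighestWeightVector.eq_top_of_lie_mem [LieModule.IsIrreducible ℂ L W]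
    (hw : IsHighestWeightVector H b χ w) {E : H}
    (hE : ∀ i ∈ b.support, (rootSystem H).root i E =
      open Classical in if χ ((rootSystem H).coroot i) = 0 then 0 else 1)
    (U : Submodule ℂ W) (hwU : w ∈ U)
    (hU : ∀ i, b.IsPos i → (rootSystem H).root i E ≠ 0 → ∀ x ∈ rootSpace H (-(i.1 : H → ℂ)),
      ∀ u ∈ U, ⁅x, u⁆ ∈ U) : U = ⊤ := by
  refine eq_top_of_lie_mem_of_isIrreducible
    {x | ∃ i, b.IsPos i ∧ (rootSystem H).root i E ≠ 0 ∧ x ∈ rootSpace H (-(i.1 : H → ℂ))}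
    (Submodule.span ℂ {w}) U (by simpa using hw.1) ?_ (by simpa using hwU) ?_
  · intro x u hu
    obtain ⟨c, rfl⟩ := Submodule.mem_span_singleton.1 hu
    induction x using isPos_induction b with
    | zero => simp
    | add x y hx hy => rw [add_lie]; exact Submodule.add_mem _ hx hy
    | cartan h =>
      refine Submodule.mem_sup_left ?_
      rw [lie_smul, hw.2.1, smul_smul]
      exact Submodule.mem_span_singleton.2 ⟨_, rfl⟩
    | pos i hi x hx => simp [hw.2.2 i hi x hx]
    | neg i hi x hx =>
      by_cases h0 : (rootSystem H).root i E = 0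
      · rw [lie_smul, (hw.lie_eq_zero_iff hi).2.1 ((hw.coroot_eq_zero_iff hE hi).2 h0) x hx]
        simp
      · exact Submodule.mem_sup_right (Submodule.subset_span ⟨x, ⟨i, hi, h0, hx⟩, rfl⟩)
  · rintro a ⟨i, hi, h0, hx⟩ u hu
    exact hU i hi h0 a hx u hu

end HighestWeight

/-! ### Matrix entries and their degrees -/

namespace HomogeneousEmbedding
open LieAlgebra LieAlgebra.IsKilling LieModule
variable {m e : ℕ} (𝓗 : HomogeneousEmbedding m e)

attribute [instance] HomogeneousEmbedding.semisimple HomogeneousEmbedding.cartan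
  HomogeneousEmbedding.irreducible

theorem lie_vec (x : 𝓗.g) (v : Vec m e) : ⁅x, v⁆ = (x : Mat m e).mulVec v := rfl

theorem mulVec_refVec (A : Mat m e) (j i : Idx m e) : A.mulVec (refVec j) i = A i j := by
  simp [refVec]

/-- The degree of the matrix entry `(i, j)` for the grading of `gl(V)` by `E`. -/
def entryDeg (i j : Idx m e) : ℤ := (𝓗.deg j : ℤ) - 𝓗.deg i

theorem Emat_mulVec_refVec (j : Idx m e) :
    𝓗.Emat.mulVec (refVec j) = (𝓗.wt 𝓗.E - (𝓗.deg j : ℂ)) • refVec j := 𝓗.homogeneous j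

theorem Emat_eq : 𝓗.Emat = Matrix.diagonal fun j => 𝓗.wt 𝓗.E - (𝓗.deg j : ℂ) := by
  ext i j
  rw [← mulVec_refVec 𝓗.Emat, Emat_mulVec_refVec]
  by_cases h : i = j
  · subst h; simp [refVec]
  · simp [refVec, h]

theorem lie_Emat_apply (A : Mat m e) (i j : Idx m e) :
    ⁅𝓗.Emat, A⁆ i j = (𝓗.entryDeg i j : ℂ) * A i j := by
  rw [Ring.lie_def, Matrix.sub_apply, Emat_eq, Matrix.diagonal_mul, Matrix.mul_diagonal, entryDeg]
  push_cast
  ring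

theorem mem_glDeg {d : ℤ} {A : Mat m e} :
    A ∈ 𝓗.glDeg d ↔ ∀ i j, A i j ≠ 0 → 𝓗.entryDeg i j = d := by
  change ⁅𝓗.Emat, A⁆ = (d : ℂ) • A ↔ _
  rw [← Matrix.ext_iff]
  refine forall_congr' fun i => forall_congr' fun j => ?_
  rw [lie_Emat_apply, Matrix.smul_apply, smul_eq_mul, mul_eq_mul_right_iff, Int.cast_inj]
  tauto

/-- The matrices with entries in degrees belonging to `S`. -/
def glSupp (S : Set ℤ) : Submodule ℂ (Mat m e) where
  carrier := {A | ∀ i j, A i j ≠ 0 → 𝓗.entryDeg i j ∈ S}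
  add_mem' := by
    intro A B hA hB i j h
    by_cases h0 : A i j = 0
    · exact hB i j (by simpa [h0] using h)
    · exact hA i j h0
  zero_mem' := by intro i j h; simp at h
  smul_mem' := by
    intro c A hA i j h
    exact hA i j (by rw [Matrix.smul_apply, smul_eq_mul] at h; exact right_ne_zero_of_mul h)

theorem mem_glSupp {S : Set ℤ} {A : Mat m e} :
    A ∈ 𝓗.glSupp S ↔ ∀ i j, A i j ≠ 0 → 𝓗.entryDeg i j ∈ S := Iff.rfl

theorem glDeg_eq (d : ℤ) : 𝓗.glDeg d = 𝓗.glSupp {d} := by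
  ext A
  rw [mem_glDeg, mem_glSupp]
  rfl

theorem glSupp_mono {S T : Set ℤ} (h : S ⊆ T) : 𝓗.glSupp S ≤ 𝓗.glSupp T :=
  fun _ hA i j hij => h (hA i j hij)

theorem iSup_glDeg (P : ℤ → Prop) : ⨆ d : {d : ℤ // P d}, 𝓗.glDeg d = 𝓗.glSupp {d | P d} := by
  refine le_antisymm (iSup_le fun d => ?_) fun A hA => ?_
  · rw [glDeg_eq]
    exact 𝓗.glSupp_mono (Set.singleton_subset_iff.2 d.2)
  · rw [Matrix.matrix_eq_sum_single A]
    refine Submodule.sum_mem _ fun i _ => Submodule.sum_mem _ fun j _ => ?_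
    by_cases h : A i j = 0
    · simp [h]
    · refine Submodule.mem_iSup_of_mem ⟨𝓗.entryDeg i j, hA i j h⟩ ?_
      rw [mem_glDeg]
      intro i' j' h'
      by_cases hij : i = i' ∧ j = j'
      · obtain ⟨rfl, rfl⟩ := hij
        rfl
      · exact absurd (Matrix.single_apply_of_ne (c := A i j) (i := i) (j := j) i' j' hij) h'

theorem rootSpace_le_glDeg {α : 𝓗.H → ℂ} {x : 𝓗.g} (hx : x ∈ rootSpace 𝓗.H α) {d : ℤ}
    (hd : α 𝓗.E = d) : (x : Mat m e) ∈ 𝓗.glDeg d := by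
  have h := lie_eq_smul_of_mem_rootSpace hx 𝓗.E
  rw [hd] at h
  exact congrArg Subtype.val h

theorem cartan_mem_glDeg (h : 𝓗.H) : ((h : 𝓗.g) : Mat m e) ∈ 𝓗.glDeg 0 :=
  𝓗.rootSpace_le_glDeg (α := 0) (x := h) (by simp) (by simp)

theorem exists_root_E {i : 𝓗.H.root} (hi : 𝓗.base.IsPos i) :
    ∃ k : ℕ, (i.1 : 𝓗.H → ℂ) 𝓗.E = k := by
  obtain ⟨k, -, h, -⟩ := 𝓗.highest.posRoot_values 𝓗.grading hi
  exact ⟨k, h⟩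

theorem deg_zero : 𝓗.deg i0 = 0 := by
  have h1 := 𝓗.homogeneous i0
  have h2 : ⁅(𝓗.E : 𝓗.g), (refVec i0 : Vec m e)⁆ = 𝓗.wt 𝓗.E • refVec i0 := 𝓗.highest.2.1 𝓗.E
  rw [h2] at h1
  have h3 := smul_left_injective ℂ (refVec_ne_zero (m := m) (e := e) i0) h1
  have : (𝓗.deg i0 : ℂ) = 0 := by linear_combination h3
  exact_mod_cast this

/-- V is generated from 𝗏_0 by root vectors of strictly negative degree, and these strictly increase
`deg`. Hence the vectors whose degree-zero part is a multiple of 𝗏_0 already fill V. -/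
theorem deg_pos {j : Idx m e} (hj : j ≠ i0) : 0 < 𝓗.deg j := by
  let U : Submodule ℂ (Vec m e) :=
    { carrier := {y | ∀ j, j ≠ i0 → 𝓗.deg j = 0 → y j = 0}
      add_mem' := fun {y z} hy hz j h1 h2 => by simp [hy j h1 h2, hz j h1 h2]
      zero_mem' := fun j _ _ => rfl
      smul_mem' := fun c y hy j h1 h2 => by simp [hy j h1 h2] }
  have hU : U = ⊤ := by
    refine 𝓗.highest.eq_top_of_lie_mem 𝓗.grading U ?_ ?_
    · intro j hj _
      simp [refVec, hj]
    · intro i hi h0 x hx u _ j _ hj0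
      obtain ⟨k, hk⟩ := 𝓗.exists_root_E hi
      have hx' : (x : Mat m e) ∈ 𝓗.glDeg (-k) :=
        𝓗.rootSpace_le_glDeg hx (by simp [hk])
      rw [lie_vec, Matrix.mulVec, dotProduct]
      refine Finset.sum_eq_zero fun l _ => ?_
      by_cases h : (x : Mat m e) j l = 0
      · simp [h]
      · have := 𝓗.mem_glDeg.1 hx' j l h
        have hk0 : k ≠ 0 := by rintro rfl; exact h0 (by simpa using hk)
        rw [entryDeg, hj0] at this
        omega
  by_contra h
  have : refVec j ∈ U := hU ▸ Submodule.mem_top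
  exact one_ne_zero (α := ℂ) (by simpa [refVec] using this j hj (by omega))

/-- In fact 𝗊 is the maximal degree `D`. The highest weight vector `f` of the dual vanishes on the
images of positive root vectors. These images together with the part `U₀` of degree `D` span V, so
`f` is nonzero on some 𝗏_j of degree `D`, and the E-weights of `f` and 𝗏_j must cancel. -/
theorem deg_le_q (k : Idx m e) : (𝓗.deg k : ℤ) ≤ 𝓗.q := by
  obtain ⟨f, hf⟩ := 𝓗.dualHighest
  obtain ⟨j₀, -, hj₀⟩ := Finset.exists_max_image Finset.univ 𝓗.deg ⟨i0, Finset.mem_univ _⟩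
  set D := 𝓗.deg j₀ with hD
  let U₀ : Submodule ℂ (Vec m e) :=
    { carrier := {y | ∀ j, 𝓗.deg j ≠ D → y j = 0}
      add_mem' := fun {y z} hy hz j h => by simp [hy j h, hz j h]
      zero_mem' := fun j _ => rfl
      smul_mem' := fun c y hy j h => by simp [hy j h] }
  -- Elements of degree ≤ 0 cannot decrease `deg`, so they preserve the part of maximal degree.
  have hlow : ∀ (x : 𝓗.g) (d : ℤ), d ≤ 0 → (x : Mat m e) ∈ 𝓗.glDeg d → ∀ u ∈ U₀, ⁅x, u⁆ ∈ U₀ := by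
    intro x d hd hx u hu j hj
    rw [lie_vec, Matrix.mulVec, dotProduct]
    refine Finset.sum_eq_zero fun l _ => ?_
    by_cases h : (x : Mat m e) j l = 0
    · simp [h]
    · have := 𝓗.mem_glDeg.1 hx j l h
      rw [entryDeg] at this
      have h2 := hj₀ j (Finset.mem_univ _)
      rw [hu l (by omega), mul_zero]
  have hU : U₀ ⊔ LinearMap.ker f = ⊤ := by
    refine eq_top_of_lie_mem_of_isIrreducible (L := 𝓗.g)
      {x | ∃ i, 𝓗.base.IsPos i ∧ x ∈ rootSpace 𝓗.H (i.1 : 𝓗.H → ℂ)} U₀ _ ?_ ?_ le_sup_left ?_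
    · intro h
      have h1 : refVec j₀ ∈ U₀ := fun j hj => by
        have : j ≠ j₀ := by rintro rfl; exact hj rfl
        simp [refVec, this]
      rw [h, Submodule.mem_bot] at h1
      exact refVec_ne_zero _ h1
    · intro x u hu
      induction x using isPos_induction 𝓗.base with
      | zero => simp
      | add x y hx hy => rw [add_lie]; exact Submodule.add_mem _ hx hy
      | cartan h => exact Submodule.mem_sup_left (hlow _ 0 le_rfl (𝓗.cartan_mem_glDeg h) u hu)
      | pos i hi x hx =>
        exact Submodule.mem_sup_right (Submodule.subset_span ⟨x, ⟨i, hi, hx⟩, rfl⟩)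
      | neg i hi x hx =>
        obtain ⟨k, hk⟩ := 𝓗.exists_root_E hi
        exact Submodule.mem_sup_left (hlow _ (-k) (by omega)
          (𝓗.rootSpace_le_glDeg hx (by simp [hk])) u hu)
    · rintro a ⟨i, hi, hx⟩ u _
      refine Submodule.mem_sup_right ?_
      have := congrArg (fun f => f u) (hf.2.2 i hi a hx)
      simpa using this
  obtain ⟨j, hj, hfj⟩ : ∃ j, 𝓗.deg j = D ∧ f (refVec j) ≠ 0 := by
    by_contra! h
    have hle : U₀ ≤ LinearMap.ker f := by
      intro y hy
      rw [LinearMap.mem_ker, pi_eq_sum_univ' y, map_sum]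
      refine Finset.sum_eq_zero fun j _ => ?_
      by_cases hj : 𝓗.deg j = D
      · have := h j hj
        rw [refVec] at this
        simp only [map_smul, smul_eq_mul]
        rw [this, mul_zero]
      · simp [hy j hj]
    rw [sup_eq_right.2 hle, LinearMap.ker_eq_top] at hU
    exact hf.1 hU
  have h1 : ⁅(𝓗.E : 𝓗.g), f⁆ (refVec j) = 𝓗.dualWt 𝓗.E * f (refVec j) := by
    rw [hf.2.1 𝓗.E]; rfl
  rw [Module.Dual.lie_apply, 𝓗.homogeneous j, map_smul, smul_eq_mul] at h1
  have h2 : 𝓗.dualWt 𝓗.E = -(𝓗.wt 𝓗.E - 𝓗.deg j) := by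
    apply mul_right_cancel₀ hfj
    linear_combination -h1
  have h3 : (𝓗.q : ℂ) = (D : ℤ) := by
    rw [𝓗.q_eq, h2, ← hj]; push_cast; ring
  have h4 : 𝓗.q = D := by exact_mod_cast h3
  rw [h4]
  exact_mod_cast hj₀ k (Finset.mem_univ _)

end HomogeneousEmbedding
end FubiniRigidity

/-! ### The tangent space at the base point and the parabolic subalgebra -/

namespace FubiniRigidity
namespace HomogeneousEmbedding
open LieAlgebra LieAlgebra.IsKilling LieModule
variable {m e : ℕ} (𝓗 : HomogeneousEmbedding m e)

/-- The affine tangent space `T̂_o Z`. -/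
def tangent (m e : ℕ) : Submodule ℂ (Vec m e) where
  carrier := {y | ∀ μ, y (iN μ) = 0}
  add_mem' := fun {y z} hy hz μ => by simp [hy μ, hz μ]
  zero_mem' := fun _ => rfl
  smul_mem' := fun c y hy μ => by simp [hy μ]

theorem tangent_eq_span : tangent m e = Submodule.span ℂ
    (insert (refVec i0 : Vec m e) (Set.range fun α : Fin m => refVec (iT α))) := by
  refine le_antisymm (fun y hy => ?_) (Submodule.span_le.2 ?_)
  · have : y = y i0 • refVec i0 + ∑ α, y (iT α) • refVec (iT α) := by
      ext j
      rcases j with _ | j | j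
      · simp [refVec]
      · simp [refVec, Pi.single_apply]
      · simpa [refVec] using hy j
    rw [this]
    refine Submodule.add_mem _ (Submodule.smul_mem _ _ (Submodule.subset_span (by simp)))
      (Submodule.sum_mem _ fun α _ => Submodule.smul_mem _ _ (Submodule.subset_span (by simp)))
  · rintro y (rfl | ⟨α, rfl⟩) μ <;> simp [refVec]

theorem tangent_eq_span_lie : tangent m e = Submodule.span ℂ
    (insert (refVec i0) (Set.range fun ζ : 𝓗.g => ⁅ζ, (refVec i0 : Vec m e)⁆)) := by
  rw [tangent_eq_span, 𝓗.adapted]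

theorem refVec_zero_mem_tangent : (refVec i0 : Vec m e) ∈ tangent m e := fun μ => by simp [refVec]

theorem lie_refVec_zero_mem_tangent (x : 𝓗.g) : ⁅x, (refVec i0 : Vec m e)⁆ ∈ tangent m e := by
  rw [𝓗.tangent_eq_span_lie]
  exact Submodule.subset_span (Set.mem_insert_of_mem _ ⟨x, rfl⟩)

theorem exists_of_mem_tangent {y : Vec m e} (hy : y ∈ tangent m e) :
    ∃ (c : ℂ) (x : 𝓗.g), y = c • refVec i0 + ⁅x, (refVec i0 : Vec m e)⁆ := by
  rw [𝓗.tangent_eq_span_lie, Submodule.mem_span_insert] at hy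
  obtain ⟨c, z, hz, rfl⟩ := hy
  suffices ∃ x : 𝓗.g, z = ⁅x, (refVec i0 : Vec m e)⁆ by
    obtain ⟨x, rfl⟩ := this; exact ⟨c, x, rfl⟩
  induction hz using Submodule.span_induction with
  | mem z hz => obtain ⟨x, rfl⟩ := hz; exact ⟨x, rfl⟩
  | zero => exact ⟨0, by simp⟩
  | add y z _ _ hy hz =>
    obtain ⟨x, rfl⟩ := hy; obtain ⟨x', rfl⟩ := hz; exact ⟨x + x', by rw [add_lie]⟩
  | smul c y _ hy => obtain ⟨x, rfl⟩ := hy; exact ⟨c • x, by rw [smul_lie]⟩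

theorem apply_normal_zero {x : Mat m e} (hx : x ∈ 𝓗.g) (μ : Fin e) : x (iN μ) i0 = 0 := by
  rw [← mulVec_refVec x]
  exact 𝓗.lie_refVec_zero_mem_tangent ⟨x, hx⟩ μ

theorem exists_apply_tangent_zero (c : Fin m → ℂ) :
    ∃ x ∈ 𝓗.g, ∀ b, x (iT b) i0 = c b := by
  let y : Vec m e := fun j => Sum.elim (fun _ => 0) (Sum.elim c fun _ => 0) j
  obtain ⟨a, x, hx⟩ := 𝓗.exists_of_mem_tangent (y := y) fun μ => rfl
  refine ⟨x, x.2, fun b => ?_⟩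
  have := congrFun hx (iT b)
  rw [lie_vec] at this
  simp only [Pi.add_apply, mulVec_refVec, Pi.smul_apply] at this
  simpa [y, refVec] using this.symm

theorem gNonneg_le_g : 𝓗.gNonneg ≤ 𝓗.g.toSubmodule := iSup_le fun _ => inf_le_left

theorem gNonneg_le_glSupp : 𝓗.gNonneg ≤ 𝓗.glSupp (Set.Ici 0) := by
  refine iSup_le fun d => inf_le_right.trans ?_
  rw [glDeg_eq]
  exact 𝓗.glSupp_mono (Set.singleton_subset_iff.2 d.2)

theorem mem_gNonneg_of_mem_rootSpace {α : 𝓗.H → ℂ} {x : 𝓗.g} (hx : x ∈ rootSpace 𝓗.H α)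
    {k : ℕ} (hd : α 𝓗.E = k) : (x : Mat m e) ∈ 𝓗.gNonneg :=
  Submodule.mem_iSup_of_mem ⟨(k : ℤ), by omega⟩
    ⟨x.2, 𝓗.rootSpace_le_glDeg hx (by simpa using hd)⟩

theorem apply_tangent_zero_of_mem_glSupp {x : Mat m e} (hx : x ∈ 𝓗.glSupp (Set.Ici 0)) (b : Fin m) :
    x (iT b) i0 = 0 := by
  by_contra h
  have h1 := hx _ _ h
  have h2 := 𝓗.deg_pos (j := iT b) (by simp)
  simp only [entryDeg, 𝓗.deg_zero, Set.mem_Ici] at h1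
  omega

/-- The Lie algebra `𝔤_{≥0}` is the stabilizer in `𝔤` of the line through `𝗏_0`. -/
theorem mem_gNonneg_iff {x : Mat m e} (hx : x ∈ 𝓗.g) :
    x ∈ 𝓗.gNonneg ↔ ∀ b, x (iT b) i0 = 0 := by
  refine ⟨fun h => 𝓗.apply_tangent_zero_of_mem_glSupp (𝓗.gNonneg_le_glSupp h), fun h => ?_⟩
  -- The stabilizer of the line is stable under 𝔥, so it is the sum of its intersections with the
  -- weight spaces and only weight vectors have to be examined.
  let p : LieSubmodule ℂ 𝓗.H 𝓗.g :=
    { carrier := {x | ∃ c : ℂ, ⁅x, (refVec i0 : Vec m e)⁆ = c • refVec i0}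
      add_mem' := by
        rintro x y ⟨c, hc⟩ ⟨d, hd⟩
        exact ⟨c + d, by rw [add_lie, hc, hd, add_smul]⟩
      zero_mem' := ⟨0, by simp⟩
      smul_mem' := by
        rintro a x ⟨c, hc⟩
        exact ⟨a * c, by rw [smul_lie, hc, smul_smul]⟩
      lie_mem := by
        rintro h x ⟨c, hc⟩
        refine ⟨0, ?_⟩
        change ⁅⁅(h : 𝓗.g), x⁆, (refVec i0 : Vec m e)⁆ = _
        rw [lie_lie, hc, 𝓗.highest.2.1, lie_smul, lie_smul, hc, 𝓗.highest.2.1, smul_smul,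
          smul_smul, mul_comm, sub_self, zero_smul] }
  have hxp : (⟨x, hx⟩ : 𝓗.g) ∈ p := by
    refine ⟨x i0 i0, ?_⟩
    rw [lie_vec]
    ext j
    rw [mulVec_refVec]
    rcases j with _ | j | j
    · simp [refVec]
    · simpa [refVec] using h j
    · simpa [refVec] using 𝓗.apply_normal_zero hx j
  rw [LieModule.eq_iSup_inf_genWeightSpace ℂ 𝓗.H 𝓗.g p] at hxp
  suffices H : ∀ y : 𝓗.g, y ∈ ⨆ χ : Weight ℂ 𝓗.H 𝓗.g, p ⊓ genWeightSpace 𝓗.g χ →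
      (y : Mat m e) ∈ 𝓗.gNonneg from H _ hxp
  intro y hy
  induction hy using LieSubmodule.iSup_induction' with
  | zero => exact Submodule.zero_mem _
  | add y z _ _ hy hz => exact Submodule.add_mem _ hy hz
  | mem α y hy =>
    obtain ⟨⟨c, hc⟩, hy⟩ := hy
    replace hy : y ∈ rootSpace 𝓗.H α := hy
    by_cases hα : α.IsZero
    · rw [Weight.IsZero] at hα
      exact 𝓗.mem_gNonneg_of_mem_rootSpace hy (k := 0) (by simp [hα])
    · let i : 𝓗.H.root := ⟨α, by simpa using hα⟩
      rcases isPos_or_eq_neg 𝓗.base i with h | ⟨j, h, h2⟩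
      · obtain ⟨k, hk⟩ := 𝓗.exists_root_E h
        exact 𝓗.mem_gNonneg_of_mem_rootSpace hy hk
      · obtain ⟨k, hk⟩ := 𝓗.exists_root_E h
        replace h2 : (α : 𝓗.H → ℂ) = -(j.1 : 𝓗.H → ℂ) := h2
        rw [h2] at hy
        rcases eq_or_ne k 0 with rfl | hk0
        · exact 𝓗.mem_gNonneg_of_mem_rootSpace hy (k := 0) (by simpa using hk)
        · have hy' := 𝓗.rootSpace_le_glDeg hy (d := -k) (by simp [hk])
          -- A root vector of negative degree has no diagonal entries, so if it stabilizes the line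
          -- it kills 𝗏_0. As its degree is nonzero, π(α^∨) ≠ 0, and sl₂-theory then makes it zero.
          have hc0 : c = 0 := by
            have h3 := congrFun hc i0
            rw [lie_vec, mulVec_refVec] at h3
            have h4 : (y : Mat m e) i0 i0 = 0 := by
              by_contra h5
              have := 𝓗.mem_glDeg.1 hy' _ _ h5
              rw [entryDeg, sub_self] at this
              omega
            rw [h4] at h3
            simpa [refVec] using h3.symm
          have : y = 0 := by
            refine (𝓗.highest.lie_eq_zero_iff h).2.2 ?_ y hy (by rw [hc, hc0, zero_smul])
            rw [Ne, 𝓗.highest.coroot_eq_zero_iff 𝓗.grading h]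
            change ¬ (j.1 : 𝓗.H → ℂ) 𝓗.E = 0
            rw [hk]
            exact_mod_cast hk0
          rw [this]
          exact Submodule.zero_mem _

/-- The dual of the highest weight, as an element of `𝔤`. -/
def dualElt : 𝓗.g := (killingDual 𝓗.H 𝓗.wt : 𝓗.H)

/-- A negative root vector of nonzero E-degree lowers the eigenvalue by (π, α) > 0. Starting from
𝗏_0, the eigenvalue (π, π) is therefore never reached again outside the line of 𝗏_0. -/
theorem iSup_eigenspace_dualElt : Submodule.span ℂ {(refVec i0 : Vec m e)} ⊔
    ⨆ μ : {μ : ℂ // μ ≠ 𝓗.wt (killingDual 𝓗.H 𝓗.wt)},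
      (toEnd ℂ 𝓗.g (Vec m e) 𝓗.dualElt).eigenspace μ.1 = ⊤ := by
  set c := 𝓗.wt (killingDual 𝓗.H 𝓗.wt)
  set f := toEnd ℂ 𝓗.g (Vec m e) 𝓗.dualElt
  -- The induction is run with eigenvalues c - r, r > 0 real: this condition survives further
  -- lowering, whereas merely being different from c would not.
  have key : Submodule.span ℂ {(refVec i0 : Vec m e)} ⊔
      ⨆ μ : {μ : ℂ // ∃ r : ℝ, 0 < r ∧ μ = c - r}, f.eigenspace μ.1 = ⊤ := by
    refine 𝓗.highest.eq_top_of_lie_mem 𝓗.grading _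
      (Submodule.mem_sup_left (Submodule.mem_span_singleton_self _)) ?_
    intro i hi h0 x hx u hu
    obtain ⟨k, r, h1, h2, h3, h4⟩ := 𝓗.highest.posRoot_values 𝓗.grading hi
    have hr : 0 < r := by
      refine lt_of_le_of_ne h2 fun h => h0 ?_
      rw [h1, h4.2 h.symm, Nat.cast_zero]
    have hx' : ⁅𝓗.dualElt, x⁆ = (-(r : ℂ)) • x := by
      have := lie_eq_smul_of_mem_rootSpace hx (killingDual 𝓗.H 𝓗.wt)
      rw [← h3]
      exact this
    have hstep : ∀ (μ : ℂ) (v : Vec m e), f v = μ • v → f ⁅x, v⁆ = (μ - r) • ⁅x, v⁆ := by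
      intro μ v hv
      change ⁅𝓗.dualElt, ⁅x, v⁆⁆ = _
      change ⁅𝓗.dualElt, v⁆ = _ at hv
      rw [leibniz_lie, hx', hv, smul_lie, lie_smul, ← add_smul]
      congr 1; ring
    obtain ⟨y, hy, z, hz, rfl⟩ := Submodule.mem_sup.1 hu
    rw [lie_add]
    refine Submodule.add_mem _ ?_ ?_
    · obtain ⟨a, rfl⟩ := Submodule.mem_span_singleton.1 hy
      rw [lie_smul]
      refine Submodule.smul_mem _ _ (Submodule.mem_sup_right
        (Submodule.mem_iSup_of_mem ⟨c - r, r, hr, rfl⟩ ?_))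
      rw [Module.End.mem_eigenspace_iff]
      exact hstep c _ (𝓗.highest.2.1 _)
    · refine Submodule.mem_sup_right ?_
      clear hu
      induction hz using Submodule.iSup_induction' with
      | zero => simp
      | add y z _ _ hy hz =>
        rw [lie_add]
        exact Submodule.add_mem _ hy hz
      | mem μ y hy =>
        obtain ⟨μ, s, hs, rfl⟩ := μ
        refine Submodule.mem_iSup_of_mem ⟨c - s - r, s + r, by positivity, by push_cast; ring⟩ ?_
        rw [Module.End.mem_eigenspace_iff] at hy ⊢
        exact hstep _ y hy
  rw [eq_top_iff, ← key]
  refine sup_le_sup_left (iSup_le fun μ => ?_) _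
  obtain ⟨μ, r, hr, rfl⟩ := μ
  refine le_iSup_of_le ⟨c - r, ?_⟩ le_rfl
  have : (r : ℂ) ≠ 0 := by exact_mod_cast hr.ne'
  simpa using this

/-- The eigenvalue (π, π) occurs only on the line of 𝗏_0, which lies in the tangent space. So
`dualElt` minus this scalar is injective on the normal space V / T̂_o Z. -/
theorem mem_tangent_of_dualElt {w : Vec m e}
    (hw : ⁅𝓗.dualElt, w⁆ - 𝓗.wt (killingDual 𝓗.H 𝓗.wt) • w ∈ tangent m e) : w ∈ tangent m e := by
  set c := 𝓗.wt (killingDual 𝓗.H 𝓗.wt)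
  set f := toEnd ℂ 𝓗.g (Vec m e) 𝓗.dualElt
  have hT : tangent m e ≤ (tangent m e).comap f := by
    intro y hy
    obtain ⟨a, x, rfl⟩ := 𝓗.exists_of_mem_tangent hy
    have hv : ⁅𝓗.dualElt, (refVec i0 : Vec m e)⁆ = c • refVec i0 := 𝓗.highest.2.1 _
    change ⁅𝓗.dualElt, _⁆ ∈ tangent m e
    rw [lie_add, lie_smul, leibniz_lie, hv, lie_smul]
    exact Submodule.add_mem _ (Submodule.smul_mem _ _ (Submodule.smul_mem _ _ refVec_zero_mem_tangent))
      (Submodule.add_mem _ (𝓗.lie_refVec_zero_mem_tangent _)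
        (Submodule.smul_mem _ _ (𝓗.lie_refVec_zero_mem_tangent _)))
  let F : Module.End ℂ (Vec m e ⧸ tangent m e) := (tangent m e).mapQ (tangent m e) f hT
  have htop : ⨆ μ : {μ : ℂ // μ ≠ c}, F.eigenspace μ.1 = ⊤ := by
    rw [eq_top_iff, ← (LinearMap.range_eq_top.2 (tangent m e).mkQ_surjective),
      LinearMap.range_eq_map, ← 𝓗.iSup_eigenspace_dualElt, Submodule.map_sup]
    refine sup_le ?_ ?_
    · rw [Submodule.map_span, Set.image_singleton,
        (Submodule.mkQ_apply _ _).trans ((Submodule.Quotient.mk_eq_zero _).2 refVec_zero_mem_tangent)]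
      simp
    · rw [Submodule.map_iSup]
      refine iSup_mono fun μ => ?_
      rintro _ ⟨y, hy, rfl⟩
      rw [SetLike.mem_coe, Module.End.mem_eigenspace_iff] at hy
      rw [Module.End.mem_eigenspace_iff]
      change (tangent m e).mkQ (f y) = _
      rw [show f y = μ.1 • y from hy, map_smul]
  have hbot : F.eigenspace c = ⊥ := by
    have h1 := (Module.End.eigenspaces_iSupIndep F) c
    rw [iSup_subtype'] at h1
    change Disjoint _ (⨆ μ : {μ : ℂ // μ ≠ c}, F.eigenspace μ.1) at h1
    rwa [htop, disjoint_top] at h1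
  have h2 : (tangent m e).mkQ w ∈ F.eigenspace c := by
    rw [Module.End.mem_eigenspace_iff, ← sub_eq_zero]
    have : F ((tangent m e).mkQ w) - c • (tangent m e).mkQ w =
        (tangent m e).mkQ (⁅𝓗.dualElt, w⁆ - c • w) := by
      rw [map_sub, map_smul]
      rfl
    rw [this]
    exact (Submodule.Quotient.mk_eq_zero _).2 hw
  rw [hbot, Submodule.mem_bot] at h2
  exact (Submodule.Quotient.mk_eq_zero _).1 h2

end HomogeneousEmbedding
end FubiniRigidity

namespace FubiniRigidity

/-! ### Divided power series and tangent linear vector fields -/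

/-- Formal power series in `m` variables, recorded by their iterated partial derivatives at the
origin, which are indexed by multisets of variables. -/
def SymSeries (m : ℕ) : Type := Multiset (Fin m) → ℂ

namespace SymSeries
variable {m : ℕ}

instance : AddCommGroup (SymSeries m) := inferInstanceAs (AddCommGroup (Multiset (Fin m) → ℂ))
instance : Module ℂ (SymSeries m) := inferInstanceAs (Module ℂ (Multiset (Fin m) → ℂ))

/-- The product of power series; the iterated derivatives obey the Leibniz rule. -/
instance : Mul (SymSeries m) :=
  ⟨fun f g s => (s.antidiagonal.map fun tu => f tu.1 * g tu.2).sum⟩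

/-- The constant power series `1`. -/
instance : One (SymSeries m) := ⟨fun s => if s = 0 then 1 else 0⟩

/-- The coordinate functions. -/
def X (a : Fin m) : SymSeries m := fun s => if s = {a} then 1 else 0

/-- The partial derivatives. -/
def pderiv (b : Fin m) : SymSeries m →ₗ[ℂ] SymSeries m where
  toFun f s := f (b ::ₘ s)
  map_add' _ _ := rfl
  map_smul' _ _ := rfl

theorem pderiv_apply (b : Fin m) (f : SymSeries m) (s : Multiset (Fin m)) :
    pderiv b f s = f (b ::ₘ s) := rfl

theorem add_apply (f g : SymSeries m) (s : Multiset (Fin m)) : (f + g) s = f s + g s := rfl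
theorem sub_apply (f g : SymSeries m) (s : Multiset (Fin m)) : (f - g) s = f s - g s := rfl
theorem zero_apply (s : Multiset (Fin m)) : (0 : SymSeries m) s = 0 := rfl
theorem smul_apply (c : ℂ) (f : SymSeries m) (s : Multiset (Fin m)) : (c • f) s = c * f s := rfl
theorem one_apply (s : Multiset (Fin m)) : (1 : SymSeries m) s = if s = 0 then 1 else 0 := rfl
theorem mul_apply (f g : SymSeries m) (s : Multiset (Fin m)) :
    (f * g) s = (s.antidiagonal.map fun tu => f tu.1 * g tu.2).sum := rfl

theorem sum_apply {ι : Type*} (t : Finset ι) (f : ι → SymSeries m) (s : Multiset (Fin m)) :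
    (∑ i ∈ t, f i) s = ∑ i ∈ t, f i s := Finset.sum_apply s t f

theorem mul_apply_zero (f g : SymSeries m) : (f * g) 0 = f 0 * g 0 := by
  simp [mul_apply]

theorem pderiv_mul (b : Fin m) (f g : SymSeries m) :
    pderiv b (f * g) = pderiv b f * g + f * pderiv b g := by
  funext s
  rw [add_apply, pderiv_apply, mul_apply, mul_apply, mul_apply, Multiset.antidiagonal_cons,
    Multiset.map_add, Multiset.sum_add, Multiset.map_map, Multiset.map_map, add_comm]
  rfl

theorem pderiv_comm (a b : Fin m) (f : SymSeries m) :
    pderiv a (pderiv b f) = pderiv b (pderiv a f) := by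
  funext s
  simp only [pderiv_apply]
  rw [Multiset.cons_swap]

theorem pderiv_one (b : Fin m) : pderiv b (1 : SymSeries m) = 0 := by
  funext s
  rw [pderiv_apply, one_apply, if_neg (Multiset.cons_ne_zero), zero_apply]

theorem pderiv_X (a b : Fin m) : pderiv b (X a) = if a = b then 1 else 0 := by
  funext s
  rw [pderiv_apply, X]
  have h1 : b ::ₘ s = {a} ↔ a = b ∧ s = 0 := by
    rw [← Multiset.cons_zero a, Multiset.cons_eq_cons]
    constructor
    · rintro (⟨rfl, rfl⟩ | ⟨h, t, -, ht⟩)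
      · simp
      · exact absurd ht.symm (Multiset.cons_ne_zero)
    · rintro ⟨rfl, rfl⟩; simp
  by_cases hab : a = b
  · rw [if_pos hab, one_apply]
    exact if_congr (h1.trans (and_iff_right hab)) rfl rfl
  · simp [h1, hab, zero_apply]

theorem mul_add' (f g h : SymSeries m) : f * (g + h) = f * g + f * h := by
  funext s
  simp only [mul_apply, add_apply, mul_add, Multiset.sum_map_add]

/-- A series is determined by its constant term and its partial derivatives. The ring axioms thus
follow by induction on the multiset, with the Leibniz rule as inductive step. -/
theorem mul_comm' (f g : SymSeries m) : f * g = g * f := by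
  funext s
  induction s using Multiset.induction_on generalizing f g with
  | empty => rw [mul_apply_zero, mul_apply_zero, mul_comm]
  | cons b s ih =>
    rw [← pderiv_apply b (f * g), ← pderiv_apply b (g * f), pderiv_mul, pderiv_mul, add_apply,
      add_apply, ih, ih f, add_comm]

theorem mul_assoc' (f g h : SymSeries m) : f * g * h = f * (g * h) := by
  funext s
  induction s using Multiset.induction_on generalizing f g h with
  | empty => simp only [mul_apply_zero, mul_assoc]
  | cons b s ih =>
    rw [← pderiv_apply b (f * g * h), ← pderiv_apply b (f * (g * h))]
    simp only [pderiv_mul, mul_add', mul_comm' (_ + _), add_apply]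
    rw [mul_comm' h, mul_comm' h, ih, ih, ih, add_assoc]

theorem one_mul' (f : SymSeries m) : 1 * f = f := by
  funext s
  induction s using Multiset.induction_on generalizing f with
  | empty => rw [mul_apply_zero, one_apply, if_pos rfl, one_mul]
  | cons b s ih =>
    have h0 : (0 : SymSeries m) * f = 0 := by
      funext s; simp [mul_apply, zero_apply]
    rw [← pderiv_apply b (1 * f), pderiv_mul, pderiv_one, h0, zero_add, ih, pderiv_apply]

instance : CommRing (SymSeries m) :=
  { (inferInstance : AddCommGroup (SymSeries m)), (inferInstance : Mul (SymSeries m)),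
    (inferInstance : One (SymSeries m)) with
    left_distrib := mul_add'
    right_distrib := fun f g h => by rw [mul_comm', mul_add', mul_comm' h, mul_comm' h]
    zero_mul := fun f => by funext s; simp [mul_apply, zero_apply]
    mul_zero := fun f => by funext s; simp [mul_apply, zero_apply]
    mul_assoc := mul_assoc'
    one_mul := one_mul'
    mul_one := fun f => by rw [mul_comm', one_mul']
    mul_comm := mul_comm' }

instance : IsScalarTower ℂ (SymSeries m) (SymSeries m) :=
  ⟨fun c f g => by
    funext s
    simp only [smul_eq_mul, mul_apply, smul_apply, mul_assoc, Multiset.sum_map_mul_left]⟩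

instance : SMulCommClass ℂ (SymSeries m) (SymSeries m) :=
  ⟨fun c f g => by
    rw [smul_eq_mul, smul_eq_mul, mul_comm, ← smul_mul_assoc, mul_comm]⟩

theorem X_mul_apply (a : Fin m) (f : SymSeries m) (s : Multiset (Fin m)) :
    (X a * f) s = (s.map fun b => if b = a then f (s.erase b) else 0).sum := by
  induction s using Multiset.induction_on generalizing f with
  | empty => simp [mul_apply_zero, X]
  | cons b s ih =>
    rw [← pderiv_apply b (X a * f), pderiv_mul, add_apply, pderiv_X, ih, Multiset.map_cons,
      Multiset.sum_cons, Multiset.erase_cons_head]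
    congr 1
    · by_cases h : a = b
      · rw [if_pos h, if_pos h.symm, one_mul]
      · rw [if_neg h, if_neg (Ne.symm h), zero_mul, zero_apply]
    · refine congrArg Multiset.sum (Multiset.map_congr rfl fun c hc => ?_)
      rw [pderiv_apply, Multiset.erase_cons_tail_of_mem hc]

theorem sum_multiset_sum {ι κ : Type*} [Fintype ι] (s : Multiset κ) (f : ι → κ → ℂ) :
    ∑ i, (s.map (f i)).sum = (s.map fun k => ∑ i, f i k).sum :=
  Multiset.sum_map_sum_map Finset.univ.val s

theorem sum_smul_X_mul_apply (c : Fin m → ℂ) (f : Fin m → SymSeries m) (s : Multiset (Fin m)) :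
    (∑ a, c a • (X a * f a)) s = (s.map fun a => c a * f a (s.erase a)).sum := by
  rw [sum_apply]
  simp only [smul_apply, X_mul_apply, ← Multiset.sum_map_mul_left]
  rw [sum_multiset_sum]
  simp

/-- The Euler operator multiplies by the degree. -/
theorem sum_X_mul_pderiv_apply (f : SymSeries m) (s : Multiset (Fin m)) :
    (∑ a, X a * pderiv a f) s = s.card * f s := by
  have h := sum_smul_X_mul_apply (fun _ => 1) (fun a => pderiv a f) s
  simp only [one_smul, one_mul] at h
  rw [h, Multiset.map_congr rfl fun a ha => by rw [pderiv_apply, Multiset.cons_erase ha],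
    Multiset.map_const', Multiset.sum_replicate, nsmul_eq_mul]

variable {ι : Type*} [Fintype ι]

/-- The first order operator `f ↦ c f + ∑ a_b ∂_b f`. -/
def firstOrder (c : SymSeries m) (a : Fin m → SymSeries m) (f : SymSeries m) : SymSeries m :=
  c * f + ∑ b, a b * pderiv b f

theorem firstOrder_one (c : SymSeries m) (a : Fin m → SymSeries m) : firstOrder c a 1 = c := by
  simp [firstOrder, pderiv_one]

/-- Together with the value at 1, this recovers both `c` and the `a b` from the action of the
operator on the first 1 + m components of the graph. -/
theorem firstOrder_neg_X (c : SymSeries m) (a : Fin m → SymSeries m) (b : Fin m) :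
    firstOrder c a (-X b) = -(c * X b) - a b := by
  simp only [firstOrder, map_neg, pderiv_X, mul_neg, Finset.sum_neg_distrib, mul_ite, mul_one,
    mul_zero, Finset.sum_ite_eq, Finset.mem_univ, if_true]
  ring

theorem firstOrder_sum_smul (c : SymSeries m) (a : Fin m → SymSeries m) (k : ι → ℂ)
    (y : ι → SymSeries m) :
    firstOrder c a (∑ j, k j • y j) = ∑ j, k j • firstOrder c a (y j) := by
  simp only [firstOrder, map_sum, map_smul, Finset.mul_sum, mul_smul_comm, smul_add,
    Finset.smul_sum, Finset.sum_add_distrib]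
  rw [Finset.sum_comm]

/-- The second order terms cancel because partial derivatives commute; this is why tangent linear
fields are closed under brackets. -/
theorem firstOrder_commutator (c c' : SymSeries m) (a a' : Fin m → SymSeries m)
    (f : SymSeries m) :
    firstOrder c a (firstOrder c' a' f) - firstOrder c' a' (firstOrder c a f) =
      firstOrder (∑ b, (a b * pderiv b c' - a' b * pderiv b c))
        (fun d => ∑ b, (a b * pderiv b (a' d) - a' b * pderiv b (a d))) f := by
  have key : ∀ (c c' : SymSeries m) (a a' : Fin m → SymSeries m),
      firstOrder c a (firstOrder c' a' f) = c * c' * f + ∑ d, c * a' d * pderiv d f +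
        ∑ b, a b * pderiv b c' * f + ∑ b, a b * c' * pderiv b f +
        ∑ b, ∑ d, a b * pderiv b (a' d) * pderiv d f +
        ∑ b, ∑ d, a b * a' d * pderiv b (pderiv d f) := by
    intro c c' a a'
    simp only [firstOrder, map_add, map_sum, pderiv_mul, mul_add, Finset.mul_sum,
      Finset.sum_add_distrib, mul_assoc]
    ring
  rw [key, key]
  have h1 : ∑ b, ∑ d, a b * a' d * pderiv b (pderiv d f) =
      ∑ b, ∑ d, a' b * a d * pderiv b (pderiv d f) := by
    rw [Finset.sum_comm]
    refine Finset.sum_congr rfl fun b _ => Finset.sum_congr rfl fun d _ => ?_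
    rw [pderiv_comm, mul_comm (a d)]
  have h2 : ∑ d, c * a' d * pderiv d f = ∑ d, a' d * c * pderiv d f := by
    simp only [mul_comm c]
  have h3 : ∑ d, c' * a d * pderiv d f = ∑ d, a d * c' * pderiv d f := by
    simp only [mul_comm c']
  rw [h1, h2, h3, firstOrder]
  simp only [Finset.sum_sub_distrib, sub_mul, Finset.sum_mul]
  rw [Finset.sum_comm (f := fun b d => a b * pderiv b (a' d) * pderiv d f),
    Finset.sum_comm (f := fun b d => a' b * pderiv b (a d) * pderiv d f)]
  ring

variable [DecidableEq ι]

/-- The Lie algebra of all matrices whose linear vector field is tangent to the (formal) cone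
parametrized by `y`. -/
def tangentAlgebra (y : ι → SymSeries m) : LieSubalgebra ℂ (Matrix ι ι ℂ) where
  carrier := {A | ∃ c a, ∀ i, ∑ j, A i j • y j = firstOrder c a (y i)}
  add_mem' := by
    rintro A B ⟨c, a, h⟩ ⟨c', a', h'⟩
    refine ⟨c + c', a + a', fun i => ?_⟩
    simp only [Matrix.add_apply, add_smul, Finset.sum_add_distrib, h, h', firstOrder, add_mul,
      Pi.add_apply]
    ring
  zero_mem' := ⟨0, 0, fun i => by simp [firstOrder]⟩
  smul_mem' := by
    rintro k A ⟨c, a, h⟩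
    refine ⟨k • c, k • a, fun i => ?_⟩
    simp only [Matrix.smul_apply, smul_assoc, ← Finset.smul_sum, h, firstOrder, smul_add,
      smul_mul_assoc, Pi.smul_apply]
  lie_mem' := by
    rintro A B ⟨c, a, h⟩ ⟨c', a', h'⟩
    -- The matrices act on the constant coefficients and the operators on the series, so a matrix
    -- product corresponds to the operators composed in reverse order. The bracket is given by the
    -- opposite commutator.
    have key : ∀ (A B : Matrix ι ι ℂ) (c c' : SymSeries m) (a a' : Fin m → SymSeries m),
        (∀ i, ∑ j, A i j • y j = firstOrder c a (y i)) →
        (∀ i, ∑ j, B i j • y j = firstOrder c' a' (y i)) → ∀ i,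
        ∑ j, (A * B) i j • y j = firstOrder c' a' (firstOrder c a (y i)) := by
      intro A B c c' a a' h h' i
      rw [← h, firstOrder_sum_smul]
      simp only [← h', Matrix.mul_apply, Finset.sum_smul, Finset.smul_sum, smul_smul]
      rw [Finset.sum_comm]
    refine ⟨∑ b, (a' b * pderiv b c - a b * pderiv b c'),
      fun d => ∑ b, (a' b * pderiv b (a d) - a b * pderiv b (a' d)), fun i => ?_⟩
    rw [← firstOrder_commutator c' c a' a, ← key A B c c' a a' h h', ← key B A c' c a' a h' h,
      ← Finset.sum_sub_distrib]
    simp only [← sub_smul]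
    rfl

theorem mem_tangentAlgebra {y : ι → SymSeries m} {A : Matrix ι ι ℂ} :
    A ∈ tangentAlgebra y ↔ ∃ c a, ∀ i, ∑ j, A i j • y j = firstOrder c a (y i) := Iff.rfl

theorem one_mem_tangentAlgebra (y : ι → SymSeries m) : (1 : Matrix ι ι ℂ) ∈ tangentAlgebra y :=
  ⟨1, 0, fun i => by simp [firstOrder, Matrix.one_apply]⟩

end SymSeries
end FubiniRigidity

namespace FubiniRigidity

/-! ### The Fubini equations -/

section
variable {m e : ℕ}

/-- The equation for the coefficients `F` of a linear vector field `ζ` in the symmetric index `s`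
and the normal index `μ`.  For constant coefficients on a curve of frames with velocity `ζ`, it is
the defining equation of the Fubini forms. -/
def fubiniEq (F : Multiset (Fin m) → Fin e → ℂ) (ζ : Mat m e) (s : Multiset (Fin m)) (μ : Fin e) :
    ℂ :=
  (if s = 0 then ζ (iN μ) i0 else 0) - (s.map fun a => if s.erase a = 0 then ζ (iN μ) (iT a) else 0).sum
  + ∑ b, F (b ::ₘ s) μ * ζ (iT b) i0 + ((s.card : ℂ) - 1) * F s μ * ζ i0 i0
  + ∑ ν, F s ν * ζ (iN μ) (iN ν)
  - (s.map fun a => ((s.card : ℂ) - 2) * F (s.erase a) μ * ζ i0 (iT a)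
      + ∑ b, F (b ::ₘ s.erase a) μ * ζ (iT b) (iT a)).sum
  + (s.antidiagonal.map fun tu =>
      ∑ b, ∑ ν, F (b ::ₘ tu.1) μ * F tu.2 ν * ζ (iT b) (iN ν)
      + ((tu.1.card : ℂ) - 1) * ∑ ν, F tu.1 μ * F tu.2 ν * ζ i0 (iN ν)).sum

open SymSeries

/-- The parametrized cone `(1, -x, F(x))`. -/
def graphSeries (F : Multiset (Fin m) → Fin e → ℂ) : Idx m e → SymSeries m :=
  Sum.elim (fun _ => 1) (Sum.elim (fun a => -X a) (fun μ s => F s μ))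

theorem sum_smul_graphSeries (F : Multiset (Fin m) → Fin e → ℂ) (c : Idx m e → ℂ) :
    ∑ j, c j • graphSeries F j = c i0 • (1 : SymSeries m) - ∑ a, c (iT a) • X a
      + ∑ ν, c (iN ν) • graphSeries F (iN ν) := by
  rw [Fintype.sum_sum_type, Fintype.sum_sum_type, ← add_assoc, sub_eq_add_neg,
    ← Finset.sum_neg_distrib]
  simp only [← smul_neg, Finset.univ_unique, Finset.sum_singleton]
  rfl

/-- The obstruction to the tangency of a linear vector field. -/
def tangency (F : Multiset (Fin m) → Fin e → ℂ) (ζ : Mat m e) (μ : Fin e) : SymSeries m :=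
  ∑ j, ζ (iN μ) j • graphSeries F j
  + (∑ j, ζ i0 j • graphSeries F j) *
    (∑ b, X b * pderiv b (graphSeries F (iN μ)) - graphSeries F (iN μ))
  + ∑ b, (∑ j, ζ (iT b) j • graphSeries F j) * pderiv b (graphSeries F (iN μ))

/-- Coefficients are extracted at `s`: multiplication by x_a gives the terms with `s.erase a`,
multiplication by F^ν gives the sums over splittings of `s`, and the Euler operator minus the
identity gives the factors `card - 1`. -/
theorem tangency_apply (F : Multiset (Fin m) → Fin e → ℂ) (ζ : Mat m e) (s : Multiset (Fin m))
    (μ : Fin e) : tangency F ζ μ s = fubiniEq F ζ s μ := by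
  set f : Fin e → SymSeries m := fun ν => graphSeries F (iN ν) with hf
  set E : SymSeries m := ∑ b, X b * pderiv b (f μ) - f μ with hE
  have hfa : ∀ ν s, f ν s = F s ν := fun _ _ => rfl
  have hEa : ∀ s, E s = ((s.card : ℂ) - 1) * F s μ := fun s => by
    rw [hE, sub_apply, sum_X_mul_pderiv_apply, hfa]; ring
  have expand : ∀ (c : Idx m e → ℂ) (g : SymSeries m), ((∑ j, c j • graphSeries F j) * g) s =
      c i0 * g s - (s.map fun a => c (iT a) * g (s.erase a)).sum
        + (s.antidiagonal.map fun tu => ∑ ν, c (iN ν) * (g tu.1 * F tu.2 ν)).sum := by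
    intro c g
    rw [sum_smul_graphSeries]
    simp only [add_mul, sub_mul, Finset.sum_mul, smul_mul_assoc, one_mul, add_apply, sub_apply,
      smul_apply]
    rw [sum_smul_X_mul_apply (fun a => c (iT a)) (fun _ => g), sum_apply]
    congr 1
    rw [← sum_multiset_sum]
    refine Finset.sum_congr rfl fun ν _ => ?_
    rw [smul_apply, mul_comm _ g, mul_apply, ← Multiset.sum_map_mul_left]
    rfl
  have h1 : (∑ j, ζ (iN μ) j • graphSeries F j) s = (if s = 0 then ζ (iN μ) i0 else 0) -
      (s.map fun a => if s.erase a = 0 then ζ (iN μ) (iT a) else 0).sum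
      + ∑ ν, F s ν * ζ (iN μ) (iN ν) := by
    rw [sum_smul_graphSeries]
    simp only [add_apply, sub_apply, smul_apply, one_apply]
    have := sum_smul_X_mul_apply (fun a => ζ (iN μ) (iT a)) (fun _ => 1) s
    simp only [mul_one, one_apply] at this
    rw [this, sum_apply]
    simp only [smul_apply, mul_ite, mul_one, mul_zero]
    congr 1
    exact Finset.sum_congr rfl fun ν _ => mul_comm _ _
  have h2 := expand (fun j => ζ i0 j) E
  have h3 : (∑ b, (∑ j, ζ (iT b) j • graphSeries F j) * pderiv b (f μ)) s =
      ∑ b, F (b ::ₘ s) μ * ζ (iT b) i0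
      - (s.map fun a => ∑ b, F (b ::ₘ s.erase a) μ * ζ (iT b) (iT a)).sum
      + (s.antidiagonal.map fun tu =>
        ∑ b, ∑ ν, F (b ::ₘ tu.1) μ * F tu.2 ν * ζ (iT b) (iN ν)).sum := by
    rw [sum_apply]
    simp only [fun b => expand (fun j => ζ (iT b) j) (pderiv b (f μ)), Finset.sum_add_distrib,
      Finset.sum_sub_distrib, sum_multiset_sum, pderiv_apply, hfa]
    simp only [mul_comm (ζ _ _)]
  -- The factor `card - 1` is evaluated at `s.erase a`, whence `card - 2`.
  have h2a : (s.map fun a => ζ i0 (iT a) * E (s.erase a)).sum =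
      (s.map fun a => ((s.card : ℂ) - 2) * F (s.erase a) μ * ζ i0 (iT a)).sum := by
    refine congrArg Multiset.sum (Multiset.map_congr rfl fun a ha => ?_)
    rw [hEa, Multiset.card_erase_of_mem ha, Nat.pred_eq_sub_one,
      Nat.cast_sub (Multiset.card_pos_iff_exists_mem.2 ⟨a, ha⟩)]
    push_cast
    ring
  have h2b : (s.antidiagonal.map fun tu => ∑ ν, ζ i0 (iN ν) * (E tu.1 * F tu.2 ν)).sum =
      (s.antidiagonal.map fun tu =>
        ((tu.1.card : ℂ) - 1) * ∑ ν, F tu.1 μ * F tu.2 ν * ζ i0 (iN ν)).sum := by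
    refine congrArg Multiset.sum (Multiset.map_congr rfl fun tu _ => ?_)
    rw [Finset.mul_sum, hEa]
    exact Finset.sum_congr rfl fun ν _ => by ring
  rw [tangency, add_apply, add_apply, h1, h2, h3, h2a, h2b, fubiniEq, hEa,
    Multiset.sum_map_add, Multiset.sum_map_add]
  ring

/-- The components 1 and -x of the graph force c = z_0 and a_b = -z_b - x_b z_0, where z = ζ ·
graph. What remains is the tangency condition in the normal components. -/
theorem mem_tangentAlgebra_graphSeries_iff {F : Multiset (Fin m) → Fin e → ℂ} {ζ : Mat m e} :
    ζ ∈ tangentAlgebra (graphSeries F) ↔ ∀ s μ, fubiniEq F ζ s μ = 0 := by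
  set z : Idx m e → SymSeries m := fun i => ∑ j, ζ i j • graphSeries F j with hz
  have hT : ∀ μ, tangency F ζ μ = z (iN μ) - firstOrder (z i0)
      (fun b => -z (iT b) - X b * z i0) (graphSeries F (iN μ)) := by
    intro μ
    change z (iN μ) + z i0 * (∑ b, X b * pderiv b (graphSeries F (iN μ)) - graphSeries F (iN μ))
      + ∑ b, z (iT b) * pderiv b (graphSeries F (iN μ)) = _
    simp only [firstOrder, mul_sub, sub_mul, neg_mul, Finset.sum_sub_distrib,
      Finset.sum_neg_distrib, Finset.mul_sum]
    have : ∀ b, z i0 * (X b * pderiv b (graphSeries F (iN μ))) =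
        X b * z i0 * pderiv b (graphSeries F (iN μ)) := fun b => by ring
    simp only [this]
    ring
  have hT' : (∀ s μ, fubiniEq F ζ s μ = 0) ↔ ∀ μ, z (iN μ) = firstOrder (z i0)
      (fun b => -z (iT b) - X b * z i0) (graphSeries F (iN μ)) := by
    rw [forall_comm]
    refine forall_congr' fun μ => ?_
    rw [← sub_eq_zero (a := z (iN μ)), ← hT]
    refine ⟨fun h => funext fun s => (tangency_apply F ζ s μ).trans (h s), fun h s => ?_⟩
    rw [← tangency_apply, h]
    rfl
  rw [hT', mem_tangentAlgebra]
  constructor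
  · rintro ⟨c, a, h⟩ μ
    have h0 : z i0 = c := (h i0).trans (firstOrder_one c a)
    have ha : (fun b => -z (iT b) - X b * z i0) = a := by
      funext b
      rw [h0, show z (iT b) = _ from (h (iT b)).trans (firstOrder_neg_X c a b)]
      ring
    rw [ha, h0]
    exact h (iN μ)
  · intro h
    refine ⟨z i0, fun b => -z (iT b) - X b * z i0, fun i => ?_⟩
    rcases i with _ | b | μ
    · exact (firstOrder_one _ _).symm
    · refine Eq.trans ?_ (firstOrder_neg_X _ _ _).symm
      change z (iT b) = _
      ring
    · exact h μ

end
end FubiniRigidity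

/-! ### Semi-simplicity and maximality of the algebra of tangent fields -/

namespace FubiniRigidity
namespace HomogeneousEmbedding
open LieAlgebra LieModule SymSeries
variable {m e : ℕ} (𝓗 : HomogeneousEmbedding m e)

/-- The element of `𝔤` that represents a linear functional for the Killing form. -/
def killingRep : Module.Dual ℂ 𝓗.g ≃ₗ[ℂ] 𝓗.g :=
  ((killingForm ℂ 𝓗.g).toDual (IsKilling.killingForm_nondegenerate ℂ 𝓗.g)).symm

theorem killingForm_killingRep (φ : Module.Dual ℂ 𝓗.g) (x : 𝓗.g) :
    killingForm ℂ 𝓗.g (𝓗.killingRep φ) x = φ x :=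
  LinearMap.BilinForm.apply_toDual_symm_apply φ x

theorem eq_zero_of_killingForm {x : 𝓗.g} (h : ∀ y, killingForm ℂ 𝓗.g x y = 0) : x = 0 :=
  (IsKilling.killingForm_nondegenerate ℂ 𝓗.g).1 x h

theorem eq_zero_of_forall_lie {a : 𝓗.g} (h : ∀ x : 𝓗.g, ⁅a, x⁆ = 0) : a = 0 := by
  have : a ∈ (ad ℂ 𝓗.g).ker := by
    rw [LieHom.mem_ker]
    ext x : 1
    exact h x
  rwa [ad_ker_eq_bot_of_hasTrivialRadical, LieSubmodule.mem_bot] at this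

/-- If a ∈ 𝔤 represents the trace, then κ([a, x], y) = κ(a, [x, y]) = tr [x, y] = 0, so a is central
and vanishes. -/
theorem trace_eq_zero {x : Mat m e} (hx : x ∈ 𝓗.g) : x.trace = 0 := by
  let φ : Module.Dual ℂ 𝓗.g := Matrix.traceLinearMap _ ℂ ℂ ∘ₗ 𝓗.g.toSubmodule.subtype
  have h0 : 𝓗.killingRep φ = 0 := by
    refine 𝓗.eq_zero_of_forall_lie fun x => 𝓗.eq_zero_of_killingForm fun y => ?_
    rw [killingForm, traceForm_apply_lie_apply]
    exact (𝓗.killingForm_killingRep φ _).trans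
      (matrix_trace_commutator_zero (Idx m e) ℂ (x : Mat m e) (y : Mat m e))
  have := 𝓗.killingForm_killingRep φ ⟨x, hx⟩
  rw [h0, map_zero] at this
  exact this.symm

/-- A Lie algebra with a faithful irreducible representation by trace-free matrices has trivial
radical; irreducibility is inherited from 𝔤. -/
theorem hasTrivialRadical_of_le (s : LieSubalgebra ℂ (Mat m e)) (hs : 𝓗.g ≤ s)
    (htr : ∀ x ∈ s, Matrix.trace x = 0) : HasTrivialRadical ℂ s := by
  have hn : Nontrivial (Vec m e) := inferInstance
  have hirr : LieModule.IsIrreducible ℂ s (Vec m e) := by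
    refine LieModule.IsIrreducible.mk fun N hN => ?_
    let N' : LieSubmodule ℂ 𝓗.g (Vec m e) :=
      { N.toSubmodule with lie_mem := fun {x v} hv => N.lie_mem (x := ⟨x, hs x.2⟩) hv }
    have hN' : N' = ⊤ := by
      refine (eq_bot_or_eq_top N').resolve_left fun h => hN ?_
      have : N'.toSubmodule = ⊥ := by rw [h]; rfl
      exact LieSubmodule.toSubmodule_injective this
    have : N'.toSubmodule = ⊤ := by rw [hN']; rfl
    exact LieSubmodule.toSubmodule_injective this
  have hfaith : LieModule.IsFaithful ℂ s (Vec m e) := by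
    refine ⟨fun x y h => Subtype.ext ?_⟩
    ext i j
    have := congrFun (LinearMap.congr_fun h (refVec j)) i
    change (x : Mat m e).mulVec _ i = (y : Mat m e).mulVec _ i at this
    rwa [mulVec_refVec, mulVec_refVec] at this
  refine hasTrivialRadical_of_isIrreducible_of_isFaithful ℂ s (Vec m e) fun x => ?_
  have : toEnd ℂ s (Vec m e) x = Matrix.toLin' (x : Mat m e) := rfl
  rw [this, Matrix.trace_toLin'_eq]
  exact htr x x.2

/-- If the linear vector fields in `𝔤` are tangent to the formal cone defined by `F`, then up to
scalars there are no other such fields. -/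
theorem mem_g_sup_scalars (hmax : 𝓗.IsMaximal) {F : Multiset (Fin m) → Fin e → ℂ}
    (h0 : ∀ μ, F 0 μ = 0) (h1 : ∀ a μ, F {a} μ = 0)
    (hg : ∀ ζ ∈ 𝓗.g, ∀ s μ, fubiniEq F ζ s μ = 0) {ζ : Mat m e}
    (hζ : ∀ s μ, fubiniEq F ζ s μ = 0) : ζ ∈ 𝓗.g.toSubmodule ⊔ scalars m e := by
  set t := tangentAlgebra (graphSeries F)
  have hgt : 𝓗.g ≤ t := fun x hx => mem_tangentAlgebra_graphSeries_iff.2 (hg x hx)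
  -- In the equation with `s = 0` every other term contains F at the empty or at a one-element
  -- index, and only ζ^μ_0 survives.
  have htN : ∀ x ∈ t, ∀ μ, x (iN μ) i0 = 0 := by
    intro x hx μ
    have := mem_tangentAlgebra_graphSeries_iff.1 hx 0 μ
    simpa [fubiniEq, h0, h1] using this
  -- The scalars are tangent to the cone as well, so maximality can only be applied to the
  -- trace-free fields. They lie in 𝔨 because `t` contains 𝔤_- and is closed under brackets.
  let s : LieSubalgebra ℂ (Mat m e) := t ⊓ SpecialLinear.sl (Idx m e) ℂ
  have hstr : ∀ x ∈ s, Matrix.trace x = 0 := fun x hx => hx.2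
  have hgs : 𝓗.g ≤ s := fun x hx => ⟨hgt hx, 𝓗.trace_eq_zero hx⟩
  have hsg : s = 𝓗.g := by
    refine hmax s (𝓗.hasTrivialRadical_of_le s hgs hstr) hgs fun x hx l hl μ => ?_
    refine htN _ ?_ μ
    induction l with
    | nil => exact hx.1
    | cons u l ih =>
      refine t.lie_mem (hgt ?_) (ih fun u hu => hl u (List.mem_cons_of_mem _ hu))
      have hle : 𝓗.gNeg ≤ 𝓗.g.toSubmodule := iSup_le fun _ => inf_le_left
      exact hle (hl u List.mem_cons_self)
  set c : ℂ := ζ.trace / Fintype.card (Idx m e)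
  have hcard : (Fintype.card (Idx m e) : ℂ) ≠ 0 := Nat.cast_ne_zero.2 Fintype.card_ne_zero
  have hmem : ζ - c • (1 : Mat m e) ∈ s := by
    refine ⟨t.sub_mem (mem_tangentAlgebra_graphSeries_iff.2 hζ)
      (t.smul_mem c (one_mem_tangentAlgebra _)), ?_⟩
    change Matrix.trace (ζ - c • (1 : Mat m e)) = 0
    rw [Matrix.trace_sub, Matrix.trace_smul, Matrix.trace_one, smul_eq_mul, div_mul_cancel₀ _ hcard,
      sub_self]
  rw [hsg] at hmem
  exact Submodule.mem_sup.2 ⟨_, hmem, c • 1, Submodule.smul_mem _ _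
    (Submodule.mem_span_singleton_self _), sub_add_cancel _ _⟩

theorem scalars_le_glSupp : scalars m e ≤ 𝓗.glSupp {0} := by
  rw [scalars, Submodule.span_singleton_le_iff_mem]
  intro i j h
  have : i = j := by by_contra hij; exact h (Matrix.one_apply_ne hij)
  simp [entryDeg, this]

/-! ### Homogeneity of the Fubini equations -/

/-- Coefficients of Fubini forms that are homogeneous for the grading. -/
def IsHomogeneousCoeff (F : Multiset (Fin m) → Fin e → ℂ) : Prop :=
  ∀ s μ, F s μ ≠ 0 → 𝓗.symDeg s = 𝓗.deg (iN μ)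

theorem symDeg_cons (a : Fin m) (s : Multiset (Fin m)) :
    𝓗.symDeg (a ::ₘ s) = 𝓗.deg (iT a) + 𝓗.symDeg s := by
  simp [symDeg]

theorem symDeg_add (s t : Multiset (Fin m)) : 𝓗.symDeg (s + t) = 𝓗.symDeg s + 𝓗.symDeg t := by
  simp [symDeg]

theorem symDeg_erase {a : Fin m} {s : Multiset (Fin m)} (h : a ∈ s) :
    𝓗.symDeg s = 𝓗.deg (iT a) + 𝓗.symDeg (s.erase a) := by
  rw [← symDeg_cons, Multiset.cons_erase h]

theorem symDeg_zero : 𝓗.symDeg 0 = 0 := by simp [symDeg]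

/-- The Fubini equation with indices `s` and `μ` only involves the matrix entries in one degree. -/
theorem fubiniEq_congr {F : Multiset (Fin m) → Fin e → ℂ} (hF : 𝓗.IsHomogeneousCoeff F)
    {ζ ξ : Mat m e} {s : Multiset (Fin m)} {μ : Fin e}
    (h : ∀ i j, 𝓗.entryDeg i j = 𝓗.symDeg s - 𝓗.deg (iN μ) → ζ i j = ξ i j) :
    fubiniEq F ζ s μ = fubiniEq F ξ s μ := by
  -- Each term with coefficients of F is a product of such coefficients and one matrix entry; where
  -- the coefficients are nonzero, homogeneity fixes the degree of the entry.
  have key : ∀ (c : ℂ) (i j : Idx m e),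
      (c ≠ 0 → 𝓗.entryDeg i j = 𝓗.symDeg s - 𝓗.deg (iN μ)) → c * ζ i j = c * ξ i j := by
    intro c i j hc
    by_cases hc0 : c = 0
    · rw [hc0, zero_mul, zero_mul]
    · rw [h i j (hc hc0)]
  have h00 := 𝓗.deg_zero
  unfold fubiniEq
  congr 1
  · congr 1
    · congr 1
      · congr 1
        · congr 1
          · congr 1
            · split_ifs with hs
              · exact h _ _ (by rw [hs, symDeg_zero, entryDeg]; omega)
              · rfl
            · refine congrArg Multiset.sum (Multiset.map_congr rfl fun a ha => ?_)
              split_ifs with hs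
              · refine h _ _ ?_
                have := 𝓗.symDeg_erase ha
                rw [hs, symDeg_zero] at this
                rw [entryDeg]; omega
              · rfl
          · refine Finset.sum_congr rfl fun b _ => key _ _ _ fun hc => ?_
            have := hF _ _ hc
            rw [symDeg_cons] at this
            rw [entryDeg]; omega
        · refine key _ _ _ fun hc => ?_
          have := hF _ _ (right_ne_zero_of_mul hc)
          rw [entryDeg]; omega
      · refine Finset.sum_congr rfl fun ν _ => key _ _ _ fun hc => ?_
        have := hF _ _ hc
        rw [entryDeg]; omega
    · refine congrArg Multiset.sum (Multiset.map_congr rfl fun a ha => ?_)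
      have hs := 𝓗.symDeg_erase ha
      congr 1
      · refine key _ _ _ fun hc => ?_
        have := hF _ _ (right_ne_zero_of_mul hc)
        rw [entryDeg]; omega
      · refine Finset.sum_congr rfl fun b _ => key _ _ _ fun hc => ?_
        have := hF _ _ hc
        rw [symDeg_cons] at this
        rw [entryDeg]; omega
  · refine congrArg Multiset.sum (Multiset.map_congr rfl fun tu htu => ?_)
    have hs := 𝓗.symDeg_add tu.1 tu.2
    rw [Multiset.mem_antidiagonal.1 htu] at hs
    congr 1
    · refine Finset.sum_congr rfl fun b _ => Finset.sum_congr rfl fun ν _ => key _ _ _ fun hc => ?_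
      have h1 := hF _ _ (left_ne_zero_of_mul hc)
      have h2 := hF _ _ (right_ne_zero_of_mul hc)
      rw [symDeg_cons] at h1
      rw [entryDeg]; omega
    · refine congrArg _ (Finset.sum_congr rfl fun ν _ => key _ _ _ fun hc => ?_)
      have h1 := hF _ _ (left_ne_zero_of_mul hc)
      have h2 := hF _ _ (right_ne_zero_of_mul hc)
      rw [entryDeg]; omega

theorem fubiniEq_zero (F : Multiset (Fin m) → Fin e → ℂ) (s : Multiset (Fin m)) (μ : Fin e) :
    fubiniEq F 0 s μ = 0 := by
  simp [fubiniEq]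

end HomogeneousEmbedding
end FubiniRigidity

namespace FubiniRigidity
variable {m e : ℕ}

/-! ### Curves of matrices -/

theorem smul_eq_mulVec (v : Frm m e) (y : Vec m e) : v • y = (v : Mat m e).mulVec y := rfl

theorem smul_refVec_apply (v : Frm m e) (i j : Idx m e) : (v • (refVec j : Vec m e)) i = (v : Mat m e) i j := by
  rw [smul_eq_mulVec, HomogeneousEmbedding.mulVec_refVec]

/-- A curve of matrices with the given derivative, entry by entry. -/
def HasMatDerivAt (A : ℂ → Mat m e) (A' : Mat m e) (t : ℂ) : Prop :=
  ∀ i j, HasDerivAt (fun u => A u i j) (A' i j) t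

theorem HasMatDerivAt.mul {A B : ℂ → Mat m e} {A' B' : Mat m e} {t : ℂ}
    (hA : HasMatDerivAt A A' t) (hB : HasMatDerivAt B B' t) :
    HasMatDerivAt (fun u => A u * B u) (A' * B t + A t * B') t := by
  intro i j
  have := HasDerivAt.fun_sum (u := Finset.univ) fun k _ => (hA i k).fun_mul (hB k j)
  simpa only [Matrix.mul_apply, Matrix.add_apply, Finset.sum_add_distrib] using this

theorem hasMatDerivAt_const (A : Mat m e) (t : ℂ) : HasMatDerivAt (fun _ => A) 0 t :=
  fun _ _ => hasDerivAt_const _ _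

theorem HasMatDerivAt.const_mul (B : Mat m e) {A : ℂ → Mat m e} {A' : Mat m e} {t : ℂ}
    (hA : HasMatDerivAt A A' t) : HasMatDerivAt (fun u => B * A u) (B * A') t := by
  simpa using (hasMatDerivAt_const B t).mul hA

theorem HasMatDerivAt.linear {A : ℂ → Mat m e} {A' : Mat m e} {t : ℂ} (hA : HasMatDerivAt A A' t)
    (φ : Mat m e →ₗ[ℂ] ℂ) : HasDerivAt (fun u => φ (A u)) (φ A') t := by
  have key : ∀ M : Mat m e, φ M = ∑ i, ∑ j, M i j * φ (Matrix.single i j 1) := by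
    intro M
    conv_lhs => rw [Matrix.matrix_eq_sum_single M]
    simp only [map_sum]
    refine Finset.sum_congr rfl fun i _ => Finset.sum_congr rfl fun j _ => ?_
    rw [← smul_eq_mul, ← map_smul, Matrix.smul_single, smul_eq_mul, mul_one]
  have h : (fun u => φ (A u)) = fun u => ∑ i, ∑ j, A u i j * φ (Matrix.single i j 1) :=
    funext fun u => key _
  rw [h, key A']
  exact HasDerivAt.fun_sum fun i _ => HasDerivAt.fun_sum fun j _ => (hA i j).mul_const _

section Exp
attribute [local instance] Matrix.linftyOpNormedRing Matrix.linftyOpNormedAlgebra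

theorem hasMatDerivAt_exp (A : Mat m e) (t : ℂ) :
    HasMatDerivAt (fun u : ℂ => NormedSpace.exp (u • A)) (NormedSpace.exp (t • A) * A) t :=
  fun i j => (LinearMap.toContinuousLinearMap (Matrix.entryLinearMap ℂ ℂ i j)).hasFDerivAt.comp_hasDerivAt
    t (hasDerivAt_exp_smul_const A t)

theorem hasMatDerivAt_exp' (A : Mat m e) (t : ℂ) :
    HasMatDerivAt (fun u : ℂ => NormedSpace.exp (u • A)) (A * NormedSpace.exp (t • A)) t :=
  fun i j => (LinearMap.toContinuousLinearMap (Matrix.entryLinearMap ℂ ℂ i j)).hasFDerivAt.comp_hasDerivAt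
    t (hasDerivAt_exp_smul_const' A t)

/-- The differential at `(1, 0)` of the map `(c, t) ↦ c exp (∑ t_b x_b) y`. -/
theorem exists_hasStrictFDerivAt_smul_exp {ι : Type*} [Fintype ι] (x : ι → Mat m e) (y : Vec m e) :
    ∃ ψ : ℂ × (ι → ℂ) →L[ℂ] Vec m e,
      HasStrictFDerivAt (fun p : ℂ × (ι → ℂ) =>
        p.1 • (NormedSpace.exp (∑ b, p.2 b • x b)).mulVec y) ψ (1, 0) ∧
      ∀ p, ψ p = p.1 • y + (∑ b, p.2 b • x b).mulVec y := by
  let L : ℂ × (ι → ℂ) →L[ℂ] Mat m e :=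
    ∑ b, ((ContinuousLinearMap.proj (R := ℂ) (φ := fun _ : ι => ℂ) b).comp
      (ContinuousLinearMap.snd ℂ ℂ (ι → ℂ))).smulRight (x b)
  have hL : ∀ p, L p = ∑ b, p.2 b • x b := by
    intro p
    simp [L]
  let V : Mat m e →L[ℂ] Vec m e :=
    LinearMap.toContinuousLinearMap ((Matrix.mulVecBilin ℂ ℂ).flip y)
  have hV : ∀ A, V A = A.mulVec y := fun A => rfl
  have h1 : HasStrictFDerivAt (fun p => NormedSpace.exp (L p)) L (1, 0) := by
    have h := hasStrictFDerivAt_exp_zero (𝕂 := ℂ) (𝔸 := Mat m e)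
    have h0 : L (1, 0) = 0 := by simp [hL]
    rw [← h0] at h
    exact h.comp (1, 0) L.hasStrictFDerivAt
  have h2 := V.hasStrictFDerivAt.comp (1, 0) h1
  have h3 := (hasStrictFDerivAt_fst (𝕜 := ℂ) (E := ℂ) (F := ι → ℂ) (p := (1, 0))).smul h2
  have h4 : (fun p : ℂ × (ι → ℂ) => p.1 • (NormedSpace.exp (∑ b, p.2 b • x b)).mulVec y) =
      (Prod.fst : ℂ × (ι → ℂ) → ℂ) • fun p => V (NormedSpace.exp (L p)) := by
    funext p
    simp [hL, hV]
  rw [h4]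
  refine ⟨_, h3, ?_⟩
  · intro p
    have h0 : L (1, 0) = 0 := by simp [hL]
    simp only [add_apply, ContinuousLinearMap.smulRight_apply, h0,
      NormedSpace.exp_zero, hV, Matrix.one_mulVec, one_smul, ContinuousLinearMap.coe_fst']
    rw [add_comm, ← hL]
    rfl

end Exp

/-- The exponential of a matrix, as a frame. -/
def expFrm (A : Mat m e) : Frm m e := (Matrix.isUnit_exp A).unit

theorem coe_expFrm (A : Mat m e) : (expFrm A : Mat m e) = NormedSpace.exp A := rfl

theorem expFrm_zero : expFrm (0 : Mat m e) = 1 := by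
  ext1; rw [coe_expFrm, NormedSpace.exp_zero]; rfl

theorem expFrm_neg (A : Mat m e) : expFrm (-A) = (expFrm A)⁻¹ := by
  refine eq_inv_of_mul_eq_one_left ?_
  ext1
  rw [Units.val_mul, coe_expFrm, coe_expFrm, ← Matrix.exp_add_of_commute _ _ (Commute.refl A).neg_left,
    neg_add_cancel, NormedSpace.exp_zero]
  rfl

/-- `D` expresses differentiation in t within the family `C`. All derivatives at 0 of the entire
function φ(C x t) then vanish, and so does its Taylor series. -/
theorem eq_zero_of_matDeriv {φ : Mat m e →ₗ[ℂ] ℂ} {C : Mat m e → ℂ → Mat m e} {D : Mat m e → Mat m e}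
    {S : Set (Mat m e)} (hD : ∀ x ∈ S, D x ∈ S) (hC : ∀ x t, HasMatDerivAt (C x) (C (D x) t) t)
    (h0 : ∀ x ∈ S, φ (C x 0) = 0) {x : Mat m e} (hx : x ∈ S) (t : ℂ) : φ (C x t) = 0 := by
  have hd : ∀ x, Differentiable ℂ fun t => φ (C x t) := fun x t =>
    ((hC x t).linear φ).differentiableAt
  have hn : ∀ n : ℕ, ∀ x ∈ S, iteratedDeriv n (fun t => φ (C x t)) 0 = 0 := by
    intro n
    induction n with
    | zero => intro x hx; simpa using h0 x hx
    | succ n ih =>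
      intro x hx
      rw [iteratedDeriv_succ']
      have : deriv (fun t => φ (C x t)) = fun t => φ (C (D x) t) :=
        funext fun t => ((hC x t).linear φ).deriv
      rw [this]
      exact ih _ (hD x hx)
  have := Complex.taylorSeries_eq_of_entire (hd x) 0 t
  simp only [hn _ x hx, smul_zero, tsum_zero] at this
  exact this.symm

namespace HomogeneousEmbedding
variable (𝓗 : HomogeneousEmbedding m e)

theorem expFrm_mem_G {A : Mat m e} (hA : A ∈ 𝓗.g) : expFrm A ∈ 𝓗.G :=
  Subgroup.subset_closure ⟨A, hA, rfl⟩

/-- A functional that vanishes on 𝔤 is tested on exp(tA) x exp(-tA): differentiation in t replaces x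
by [A, x] ∈ 𝔤. -/
theorem exp_conj_mem_g {A x : Mat m e} (hA : A ∈ 𝓗.g) (hx : x ∈ 𝓗.g) :
    (expFrm A : Mat m e) * x * ((expFrm A)⁻¹ : Frm m e).val ∈ 𝓗.g := by
  by_contra hn
  obtain ⟨φ, h1, h2⟩ := Submodule.exists_le_ker_of_notMem (p := 𝓗.g.toSubmodule) hn
  refine h1 ?_
  have := eq_zero_of_matDeriv (φ := φ) (S := 𝓗.g) (D := fun x => A * x - x * A)
    (C := fun x t => NormedSpace.exp (t • A) * x * NormedSpace.exp (t • (-A)))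
    (fun x hx => 𝓗.g.lie_mem hA hx) (fun x t => ?_) (fun x hx => ?_) hx 1
  · simpa [← expFrm_neg, coe_expFrm] using this
  · have h := ((hasMatDerivAt_exp A t).mul (hasMatDerivAt_const x t)).mul (hasMatDerivAt_exp' (-A) t)
    convert! h using 1
    noncomm_ring
  · simpa using h2 hx

theorem G_induction {p : Frm m e → Prop} (one : p 1)
    (exp_mul : ∀ A ∈ 𝓗.g, ∀ h ∈ 𝓗.G, p h → p (expFrm A * h)) {h : Frm m e} (hh : h ∈ 𝓗.G) : p h := by
  refine Subgroup.closure_induction_left (p := fun h _ => p h) one ?_ ?_ hh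
  · rintro x ⟨A, hA, hx⟩ y hy ih
    have : x = expFrm A := by ext1; exact hx
    rw [this]
    exact exp_mul A hA y hy ih
  · rintro x ⟨A, hA, hx⟩ y hy ih
    have : x = expFrm A := by ext1; exact hx
    rw [this, ← expFrm_neg]
    exact exp_mul _ (𝓗.g.neg_mem hA) y hy ih

theorem conj_mem_g {h : Frm m e} (hh : h ∈ 𝓗.G) {x : Mat m e} (hx : x ∈ 𝓗.g) :
    (h : Mat m e) * x * (h⁻¹ : Frm m e).val ∈ 𝓗.g := by
  refine 𝓗.G_induction (p := fun h => (h : Mat m e) * x * (h⁻¹ : Frm m e).val ∈ 𝓗.g) ?_ ?_ hh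
  · simpa using hx
  · intro A hA h _ ih
    have := 𝓗.exp_conj_mem_g hA ih
    rw [mul_inv_rev, Units.val_mul, Units.val_mul]
    simpa only [mul_assoc] using this

/-- Any element of `G` lies on an entire curve through the identity. -/
theorem exists_curve {h : Frm m e} (hh : h ∈ 𝓗.G) : ∃ γ : ℂ → Frm m e, γ 0 = 1 ∧ γ 1 = h ∧
    (∀ t, γ t ∈ 𝓗.G) ∧ ∀ t, ∃ A', HasMatDerivAt (fun t => (γ t : Mat m e)) A' t := by
  refine 𝓗.G_induction (p := fun h => ∃ γ : ℂ → Frm m e, γ 0 = 1 ∧ γ 1 = h ∧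
    (∀ t, γ t ∈ 𝓗.G) ∧ ∀ t, ∃ A', HasMatDerivAt (fun t => (γ t : Mat m e)) A' t) ?_ ?_ hh
  · exact ⟨fun _ => 1, rfl, rfl, fun _ => one_mem _, fun t => ⟨_, hasMatDerivAt_const _ _⟩⟩
  · rintro A hA h _ ⟨γ, h0, h1, h2, h3⟩
    refine ⟨fun t => expFrm (t • A) * γ t, by simp [h0, expFrm_zero], by simp [h1], fun t =>
      mul_mem (𝓗.expFrm_mem_G (𝓗.g.smul_mem t hA)) (h2 t), fun t => ?_⟩
    obtain ⟨A', hA'⟩ := h3 t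
    exact ⟨_, (hasMatDerivAt_exp A t).mul hA'⟩

/-- The adjoint action of `G` on `𝔤`. -/
def Ad {h : Frm m e} (hh : h ∈ 𝓗.G) : 𝓗.g ≃ₗ⁅ℂ⁆ 𝓗.g where
  toFun x := ⟨(h : Mat m e) * x * (h⁻¹ : Frm m e).val, 𝓗.conj_mem_g hh x.2⟩
  invFun x := ⟨((h⁻¹ : Frm m e) : Mat m e) * x * (h : Mat m e), by
    simpa using 𝓗.conj_mem_g (inv_mem hh) x.2⟩
  map_add' x y := Subtype.ext (by simp [mul_add, add_mul])
  map_smul' c x := Subtype.ext (by simp)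
  map_lie' {x y} := Subtype.ext (by
    simp only [LieSubalgebra.coe_bracket, Ring.lie_def, mul_sub, sub_mul]
    simp only [mul_assoc, Units.inv_mul_cancel_left])
  left_inv x := Subtype.ext (by simp [mul_assoc])
  right_inv x := Subtype.ext (by simp [mul_assoc])

theorem coe_Ad {h : Frm m e} (hh : h ∈ 𝓗.G) (x : 𝓗.g) :
    (𝓗.Ad hh x : Mat m e) = (h : Mat m e) * x * (h⁻¹ : Frm m e).val := rfl

theorem Ad_mulVec {h : Frm m e} (hh : h ∈ 𝓗.G) (x : 𝓗.g) (y : Vec m e) :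
    (𝓗.Ad hh x : Mat m e).mulVec (h • y) = h • (x : Mat m e).mulVec y := by
  rw [coe_Ad, smul_eq_mulVec, smul_eq_mulVec, Matrix.mulVec_mulVec, Matrix.mulVec_mulVec, mul_assoc,
    mul_assoc, Units.inv_mul, mul_one]

theorem killingForm_Ad {h : Frm m e} (hh : h ∈ 𝓗.G) (x y : 𝓗.g) :
    killingForm ℂ 𝓗.g (𝓗.Ad hh x) (𝓗.Ad hh y) = killingForm ℂ 𝓗.g x y :=
  LieAlgebra.killingForm_of_equiv_apply _ _ _

end HomogeneousEmbedding
end FubiniRigidity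

namespace FubiniRigidity

/-! ### Zero loci of holomorphic maps -/

section Submanifolds
open Filter

variable {E F W : Type*} [NormedAddCommGroup E] [NormedSpace ℂ E] [FiniteDimensional ℂ E]
  [NormedAddCommGroup F] [NormedSpace ℂ F] [FiniteDimensional ℂ F]
  [NormedAddCommGroup W] [NormedSpace ℂ W] [FiniteDimensional ℂ W]

/-- Composition with a linear left inverse of the derivative reduces this to the inverse function
theorem. -/
theorem exists_injOn_of_hasStrictFDerivAt {f : F → W} {f' : F →L[ℂ] W} {y : F}
    (hf : HasStrictFDerivAt f f' y) (h : f'.ker = ⊥) : ∃ s ∈ 𝓝 y, Set.InjOn f s := by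
  have := FiniteDimensional.complete ℂ F
  obtain ⟨g, hg⟩ := LinearMap.exists_leftInverse_of_injective f'.toLinearMap h
  let G : W →L[ℂ] F := LinearMap.toContinuousLinearMap g
  have hG : G.comp f' = ContinuousLinearMap.id ℂ F := by
    ext x
    exact LinearMap.congr_fun hg x
  have h1 := G.hasStrictFDerivAt.comp y hf
  rw [hG] at h1
  have h2 : HasStrictFDerivAt (G ∘ f) ((ContinuousLinearEquiv.refl ℂ F : F ≃L[ℂ] F) : F →L[ℂ] F) y := h1
  let e := HasStrictFDerivAt.toOpenPartialHomeomorph (G ∘ f) h2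
  refine ⟨e.source, e.open_source.mem_nhds h2.mem_toOpenPartialHomeomorph_source, fun a ha b hb hab => ?_⟩
  refine e.injOn ha hb ?_
  change G (f a) = G (f b)
  rw [hab]

/-- A parametrization that is tangent to all of the kernel covers the zero locus. -/
theorem eventually_exists_of_ker_le_range {φ : F → W} {φ' : F →L[ℂ] W} {y : F}
    (hφ : HasStrictFDerivAt φ φ' y) {ψ : E → F} {ψ' : E →L[ℂ] F} {u : E}
    (hψ : HasStrictFDerivAt ψ ψ' u) (hu : ψ u = y) (hker : φ'.ker ≤ ψ'.range)
    (h0 : ∀ᶠ t in 𝓝 u, φ (ψ t) = 0) {U : Set E} (hU : U ∈ 𝓝 u) :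
    ∀ᶠ z in 𝓝 y, φ z = 0 → ∃ t ∈ U, ψ t = z := by
  have := FiniteDimensional.complete ℂ F
  have := FiniteDimensional.complete ℂ E
  have := FiniteDimensional.complete ℂ φ'.ker
  obtain ⟨g, hg⟩ := LinearMap.exists_leftInverse_of_injective φ'.ker.subtype (Submodule.ker_subtype _)
  -- With `P` a projection to the kernel, (φ, P) is injective near `y` and P ∘ ψ is open at `u`. A
  -- zero z near `y` has the same `P`-value as some ψ(t), also a zero, so the two points coincide.
  let P : F →L[ℂ] φ'.ker := LinearMap.toContinuousLinearMap g
  have hP : ∀ k : φ'.ker, P k = k := fun k => LinearMap.congr_fun hg k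
  have h1 : HasStrictFDerivAt (fun z => (φ z, P z)) (φ'.prod P) y := hφ.prodMk P.hasStrictFDerivAt
  obtain ⟨s, hs, hinj⟩ := exists_injOn_of_hasStrictFDerivAt h1 (by
    refine LinearMap.ker_eq_bot'.2 fun z hz => ?_
    have hz1 : φ' z = 0 := congrArg Prod.fst hz
    have hz2 : P z = 0 := congrArg Prod.snd hz
    have := hP ⟨z, hz1⟩
    rw [hz2] at this
    exact (congrArg Subtype.val this).symm)
  have h2 : HasStrictFDerivAt (P ∘ ψ) (P.comp ψ') u := P.hasStrictFDerivAt.comp u hψ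
  have h3 : (P.comp ψ').range = ⊤ := by
    refine LinearMap.range_eq_top.2 fun k => ?_
    obtain ⟨t, ht⟩ := hker k.2
    exact ⟨t, (congrArg P ht).trans (hP k)⟩
  have h4 := h2.map_nhds_eq_of_surj h3
  have hcont : ContinuousAt ψ u := hψ.continuousAt
  have hs' : ∀ᶠ t in 𝓝 u, ψ t ∈ s := hcont (by rwa [hu])
  have h5 : (P ∘ ψ) '' {t | t ∈ U ∧ ψ t ∈ s ∧ φ (ψ t) = 0} ∈ 𝓝 (P y) := by
    have := image_mem_map (m := P ∘ ψ) (inter_mem hU (inter_mem hs' h0))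
    rw [h4] at this
    rw [Function.comp_apply, hu] at this
    exact this
  filter_upwards [hs, P.continuous.continuousAt.preimage_mem_nhds h5] with z hz hz' hz0
  obtain ⟨t, ⟨ht1, ht2, ht3⟩, ht4⟩ := hz'
  exact ⟨t, ht1, hinj ht2 hz (Prod.ext (ht3.trans hz0.symm) ht4)⟩

section TangentSpace
variable {m e : ℕ} {S S' : Set (Vec m e)} {y : Vec m e} {T T' : Submodule ℂ (Vec m e)}

theorem HasTangentSpace.mem (h : HasTangentSpace S y T) : y ∈ S := h.choose_spec.choose_spec.2.2.2.1

theorem HasTangentSpace.deriv_mem (h : HasTangentSpace S y T) {γ : ℂ → Vec m e} {γ' : Vec m e}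
    (hγ : HasDerivAt γ γ' 0) (h0 : γ 0 = y) (hS : ∀ᶠ t in 𝓝 0, γ t ∈ S) : γ' ∈ T := by
  obtain ⟨c, φ, h1, h2, rfl, h4, h5⟩ := h
  have h6 : HasFDerivAt φ (fderiv ℂ φ y) (γ 0) := by
    rw [h0]; exact h1.differentiableAt.hasFDerivAt
  have h7 := h6.comp_hasDerivAt 0 hγ
  have h8 : φ ∘ γ =ᶠ[𝓝 0] fun _ => 0 := by
    have : ∀ᶠ t in 𝓝 (0 : ℂ), γ t ∈ S ↔ φ (γ t) = 0 := hγ.continuousAt (by rwa [h0])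
    filter_upwards [hS, this] with t ht ht'
    exact ht'.1 ht
  exact (h7.congr_of_eventuallyEq h8.symm).unique (hasDerivAt_const _ _)

/-- A set that is parametrized near a point and is contained in a zero locus of the right dimension
is a submanifold near this point. -/
theorem hasTangentSpace_ker {Φ : Vec m e → F} (hΦ : AnalyticAt ℂ Φ y)
    (hS : ∀ᶠ z in 𝓝 y, z ∈ S → Φ z = 0) {ψ : E → Vec m e} {ψ' : E →L[ℂ] Vec m e} {u : E}
    (hψ : HasStrictFDerivAt ψ ψ' u) (hu : ψ u = y) (hker : (fderiv ℂ Φ y).ker ≤ ψ'.range)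
    (hψS : ∀ᶠ t in 𝓝 u, ψ t ∈ S) : HasTangentSpace S y (fderiv ℂ Φ y).ker := by
  have := FiniteDimensional.complete ℂ F
  -- `Φ` need not be a submersion. Projecting to the range of its derivative keeps the kernel; the
  -- equations dropped hold anyway, because the parametrization covers the larger zero locus.
  set R := (fderiv ℂ Φ y).range with hR
  obtain ⟨g, hg⟩ := LinearMap.exists_leftInverse_of_injective R.subtype (Submodule.ker_subtype _)
  let eqv : R ≃ₗ[ℂ] (Fin (Module.finrank ℂ R) → ℂ) := (Module.finBasis ℂ R).equivFun
  let L : F →L[ℂ] (Fin (Module.finrank ℂ R) → ℂ) := LinearMap.toContinuousLinearMap (eqv.toLinearMap ∘ₗ g)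
  have hL : ∀ r : R, L r = eqv r := fun r => congrArg eqv (LinearMap.congr_fun hg r)
  have hd : fderiv ℂ (L ∘ Φ) y = L.comp (fderiv ℂ Φ y) :=
    (L.hasFDerivAt.comp y hΦ.differentiableAt.hasFDerivAt).fderiv
  have hk : (fderiv ℂ (L ∘ Φ) y).ker = (fderiv ℂ Φ y).ker := by
    ext z
    rw [hd]
    change L (fderiv ℂ Φ y z) = 0 ↔ fderiv ℂ Φ y z = 0
    have := hL ⟨fderiv ℂ Φ y z, ⟨z, rfl⟩⟩
    rw [show L (fderiv ℂ Φ y z) = _ from this, LinearEquiv.map_eq_zero_iff]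
    exact Subtype.ext_iff
  have hA : AnalyticAt ℂ (L ∘ Φ) y := (L.analyticAt _).comp hΦ
  have h0 : ∀ᶠ z in 𝓝 y, z ∈ S → L (Φ z) = 0 := by
    filter_upwards [hS] with z hz hzS
    rw [hz hzS, map_zero]
  refine ⟨_, L ∘ Φ, hA, ?_, hk, ?_, ?_⟩
  · intro c
    obtain ⟨⟨_, z, rfl⟩, hr⟩ := eqv.surjective c
    refine ⟨z, ?_⟩
    rw [hd]
    exact (hL _).trans hr
  · rw [← hu]; exact hψS.self_of_nhds
  · have h1 : ∀ᶠ t in 𝓝 u, (L ∘ Φ) (ψ t) = 0 := by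
      have : ∀ᶠ t in 𝓝 u, ψ t ∈ S → L (Φ (ψ t)) = 0 := hψ.continuousAt (by rwa [hu])
      filter_upwards [this, hψS] with t h1 h2
      exact h1 h2
    have h2 := eventually_exists_of_ker_le_range hA.hasStrictFDerivAt hψ hu (hk.trans_le hker) h1 hψS
    filter_upwards [h0, h2] with z hz hz'
    refine ⟨hz, fun h => ?_⟩
    obtain ⟨t, ht, rfl⟩ := hz' h
    exact ht

/-- Nested submanifolds of the same dimension agree. -/
theorem HasTangentSpace.eventually_mem_of_le (h : HasTangentSpace S y T) (h' : HasTangentSpace S' y T')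
    (hT : Module.finrank ℂ T = Module.finrank ℂ T') (hSS : ∀ᶠ z in 𝓝 y, z ∈ S → z ∈ S') :
    ∀ᶠ z in 𝓝 y, z ∈ S' → z ∈ S := by
  obtain ⟨c, φ, h1, h2, rfl, h4, h5⟩ := h
  obtain ⟨c', φ', h1', h2', rfl, h4', h5'⟩ := h'
  have hs := h1.hasStrictFDerivAt
  have hr : (fderiv ℂ φ y).range = ⊤ := LinearMap.range_eq_top.2 h2
  have hy : φ y = 0 := h5.self_of_nhds.1 h4
  -- The implicit function parametrizes `S`. It lands in `S'`, so the tangent spaces are nested,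
  -- hence equal by dimension, and the parametrization covers `S'` too.
  let ψ := hs.implicitFunction φ (fderiv ℂ φ y) hr (φ y)
  have hψ : HasStrictFDerivAt ψ (fderiv ℂ φ y).ker.subtypeL 0 := hs.to_implicitFunction hr
  have hψ0 : ψ 0 = y := hs.implicitFunction_apply_image hr
  have hc : Tendsto ψ (𝓝 0) (𝓝 y) := by
    have : ContinuousAt ψ 0 := hψ.continuousAt
    rwa [ContinuousAt, hψ0] at this
  have h6 : ∀ᶠ t in 𝓝 0, φ (ψ t) = 0 := by
    have h7 := hs.map_implicitFunction_eq hr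
    have h8 : Tendsto (fun t : (fderiv ℂ φ y).ker => (φ y, t)) (𝓝 0) (𝓝 (φ y, 0)) :=
      (Continuous.prodMk_right (φ y)).tendsto 0
    filter_upwards [h8.eventually h7] with t ht
    exact ht.trans hy
  have h9 : ∀ᶠ t in 𝓝 0, ψ t ∈ S := by
    filter_upwards [hc.eventually h5, h6] with t ht ht'
    exact ht.2 ht'
  have h10 : ∀ᶠ t in 𝓝 0, φ' (ψ t) = 0 := by
    filter_upwards [h9, hc.eventually hSS, hc.eventually h5'] with t a b c
    exact c.1 (b a)
  have h13 : (fderiv ℂ φ y).ker ≤ (fderiv ℂ φ' y).ker := by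
    have hd' : HasFDerivAt φ' (fderiv ℂ φ' y) (ψ 0) := by
      rw [hψ0]; exact h1'.differentiableAt.hasFDerivAt
    have hcomp := hd'.comp 0 hψ.hasFDerivAt
    have hc0 : φ' ∘ ψ =ᶠ[𝓝 0] fun _ => 0 := h10
    have := (hcomp.congr_of_eventuallyEq hc0.symm).unique (hasFDerivAt_const _ _)
    intro z hz
    exact DFunLike.congr_fun this ⟨z, hz⟩
  have h14 := Submodule.eq_of_le_of_finrank_eq h13 hT
  have h15 := eventually_exists_of_ker_le_range h1'.hasStrictFDerivAt hψ hψ0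
    (by
      intro z hz
      rw [← h14] at hz
      exact ⟨⟨z, hz⟩, rfl⟩) h10 h9
  filter_upwards [h15, h5'] with z hz hz' hzS
  obtain ⟨t, ht, rfl⟩ := hz (hz'.1 hzS)
  exact ht

theorem HasTangentSpace.smul (h : HasTangentSpace S y T) (A : Frm m e)
    (hS : ∀ z, z ∈ S' ↔ A⁻¹ • z ∈ S) :
    HasTangentSpace S' (A • y) (T.map (Matrix.mulVecLin (A : Mat m e))) := by
  obtain ⟨c, φ, h1, h2, rfl, h4, h5⟩ := h
  let L : Vec m e →L[ℂ] Vec m e :=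
    LinearMap.toContinuousLinearMap (Matrix.mulVecLin ((A⁻¹ : Frm m e) : Mat m e))
  have hL : ∀ z, L z = A⁻¹ • z := fun z => rfl
  have hy : L (A • y) = y := by rw [hL, inv_smul_smul]
  rw [← hy] at h1
  have hd : fderiv ℂ (φ ∘ L) (A • y) = (fderiv ℂ φ y).comp L := by
    have := (h1.differentiableAt.hasFDerivAt.comp (A • y) L.hasFDerivAt).fderiv
    rwa [hy] at this
  refine ⟨c, φ ∘ L, h1.comp (L.analyticAt _), ?_, ?_, ?_, ?_⟩
  · intro r
    obtain ⟨z, hz⟩ := h2 r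
    refine ⟨A • z, ?_⟩
    rw [hd, ContinuousLinearMap.comp_apply, hL, inv_smul_smul, hz]
  · ext z
    rw [hd]
    change fderiv ℂ φ y (A⁻¹ • z) = 0 ↔ _
    constructor
    · intro hz
      exact ⟨A⁻¹ • z, hz, smul_inv_smul A z⟩
    · rintro ⟨w, hw, rfl⟩
      change fderiv ℂ φ y (A⁻¹ • A • w) = 0
      rw [inv_smul_smul]
      exact hw
  · rw [hS, inv_smul_smul]
    exact h4
  · have : ∀ᶠ z in 𝓝 (A • y), L z ∈ S ↔ φ (L z) = 0 :=
      L.continuous.continuousAt (by rwa [hy])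
    filter_upwards [this] with z hz
    rw [hS]
    exact hz

end TangentSpace

end Submanifolds
end FubiniRigidity

namespace FubiniRigidity
namespace HomogeneousEmbedding
open LieAlgebra LieAlgebra.IsKilling LieModule
variable {m e : ℕ} (𝓗 : HomogeneousEmbedding m e)

/-! ### Graded components of matrices -/

open Classical in
/-- The part of a matrix with degrees in `S`. -/
def trunc (S : Set ℤ) (x : Mat m e) : Mat m e :=
  Matrix.of fun i j => if 𝓗.entryDeg i j ∈ S then x i j else 0

theorem trunc_apply_of_mem {S : Set ℤ} {i j : Idx m e} (h : 𝓗.entryDeg i j ∈ S) (x : Mat m e) :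
    𝓗.trunc S x i j = x i j := if_pos h

theorem trunc_apply_of_notMem {S : Set ℤ} {i j : Idx m e} (h : 𝓗.entryDeg i j ∉ S) (x : Mat m e) :
    𝓗.trunc S x i j = 0 := if_neg h

theorem trunc_mem_glSupp (S : Set ℤ) (x : Mat m e) : 𝓗.trunc S x ∈ 𝓗.glSupp S := by
  intro i j h
  by_contra hn
  exact h (𝓗.trunc_apply_of_notMem hn x)

theorem trunc_eq_self {S : Set ℤ} {x : Mat m e} (hx : x ∈ 𝓗.glSupp S) : 𝓗.trunc S x = x := by
  ext i j
  by_cases h : 𝓗.entryDeg i j ∈ S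
  · exact 𝓗.trunc_apply_of_mem h x
  · rw [𝓗.trunc_apply_of_notMem h]
    by_contra hn
    exact h (hx i j (Ne.symm hn))

theorem trunc_add_trunc_compl (S : Set ℤ) (x : Mat m e) : 𝓗.trunc S x + 𝓗.trunc Sᶜ x = x := by
  ext i j
  rw [Matrix.add_apply]
  by_cases h : 𝓗.entryDeg i j ∈ S
  · rw [𝓗.trunc_apply_of_mem h, 𝓗.trunc_apply_of_notMem (not_not_intro h), add_zero]
  · rw [𝓗.trunc_apply_of_notMem h, 𝓗.trunc_apply_of_mem h, zero_add]

theorem trunc_add (S : Set ℤ) (x y : Mat m e) : 𝓗.trunc S (x + y) = 𝓗.trunc S x + 𝓗.trunc S y := by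
  ext i j
  rw [Matrix.add_apply]
  by_cases h : 𝓗.entryDeg i j ∈ S
  · simp only [𝓗.trunc_apply_of_mem h, Matrix.add_apply]
  · simp only [𝓗.trunc_apply_of_notMem h, add_zero]

/-- A subspace stable under the grading element contains the graded components of its elements. -/
theorem trunc_mem {p : Submodule ℂ (Mat m e)} (hp : ∀ x ∈ p, ⁅𝓗.Emat, x⁆ ∈ p) (S : Set ℤ)
    {x : Mat m e} (hx : x ∈ p) : 𝓗.trunc S x ∈ p := by
  let f : Module.End ℂ (Mat m e) := ad ℂ (Mat m e) 𝓗.Emat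
  have htop : ⨆ μ, f.eigenspace μ = ⊤ := by
    rw [eq_top_iff]
    have h := 𝓗.iSup_glDeg fun _ => True
    have hsup : 𝓗.glSupp {d | True} = ⊤ := by
      rw [eq_top_iff]
      intro x _ i j _
      trivial
    rw [← hsup, ← h]
    refine iSup_le fun d => le_iSup_of_le (d.1 : ℂ) fun x hx => ?_
    rw [Module.End.mem_eigenspace_iff]
    exact hx
  -- Since ad E is diagonalizable, `p` is spanned by eigenvectors, each of which is either fixed or
  -- killed by the truncation.
  have h1 := Submodule.eq_iSup_inf_genEigenspace (p := p) (f := f) 1 hp htop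
  rw [h1] at hx
  induction hx using Submodule.iSup_induction' with
  | zero =>
    have : 𝓗.trunc S 0 = 0 := by
      ext i j
      by_cases h : 𝓗.entryDeg i j ∈ S
      · exact 𝓗.trunc_apply_of_mem h 0
      · exact 𝓗.trunc_apply_of_notMem h 0
    rw [this]
    exact Submodule.zero_mem _
  | add x y _ _ hx hy =>
    rw [trunc_add]
    exact Submodule.add_mem _ hx hy
  | mem μ x hx =>
    obtain ⟨hxp, hx⟩ := hx
    replace hx : ⁅𝓗.Emat, x⁆ = μ • x := Module.End.mem_eigenspace_iff.1 hx
    by_cases hμ : ∃ d ∈ S, μ = ((d : ℤ) : ℂ)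
    · obtain ⟨d, hd, rfl⟩ := hμ
      have : x ∈ 𝓗.glSupp S := by
        have h2 : x ∈ 𝓗.glDeg d := hx
        rw [glDeg_eq] at h2
        exact 𝓗.glSupp_mono (Set.singleton_subset_iff.2 hd) h2
      rwa [𝓗.trunc_eq_self this]
    · have : 𝓗.trunc S x = 0 := by
        ext i j
        by_cases h : 𝓗.entryDeg i j ∈ S
        · rw [𝓗.trunc_apply_of_mem h]
          by_contra hn
          have h2 := congrFun (congrFun hx i) j
          rw [lie_Emat_apply] at h2
          exact hμ ⟨_, h, (mul_right_cancel₀ hn h2).symm⟩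
        · exact 𝓗.trunc_apply_of_notMem h x
      rw [this]
      exact Submodule.zero_mem _

/-- A subspace stable under the grading element is the sum of its graded components. -/
theorem inf_glSupp_le {p : Submodule ℂ (Mat m e)} (hp : ∀ x ∈ p, ⁅𝓗.Emat, x⁆ ∈ p) (P : ℤ → Prop) :
    p ⊓ 𝓗.glSupp {d | P d} ≤ ⨆ d : {d : ℤ // P d}, p ⊓ 𝓗.glDeg d := by
  classical
  rintro x ⟨hx, hxS⟩
  let D : Finset ℤ := Finset.image (fun ij : Idx m e × Idx m e => 𝓗.entryDeg ij.1 ij.2) Finset.univ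
  have hsum : x = ∑ d ∈ D, 𝓗.trunc {d} x := by
    ext i j
    rw [Matrix.sum_apply, Finset.sum_eq_single (𝓗.entryDeg i j)]
    · exact (𝓗.trunc_apply_of_mem (Set.mem_singleton _) x).symm
    · intro d _ hd
      exact 𝓗.trunc_apply_of_notMem (fun h => hd h.symm) x
    · intro h
      exact absurd (Finset.mem_image.2 ⟨(i, j), Finset.mem_univ _, rfl⟩) h
  rw [hsum]
  refine Submodule.sum_mem _ fun d _ => ?_
  by_cases hd : P d
  · refine Submodule.mem_iSup_of_mem ⟨d, hd⟩ ⟨𝓗.trunc_mem hp _ hx, ?_⟩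
    rw [glDeg_eq]
    exact 𝓗.trunc_mem_glSupp _ _
  · have : 𝓗.trunc {d} x = 0 := by
      ext i j
      by_cases h : 𝓗.entryDeg i j ∈ ({d} : Set ℤ)
      · rw [𝓗.trunc_apply_of_mem h]
        by_contra hn
        have := hxS i j hn
        rw [Set.mem_singleton_iff.1 h] at this
        exact hd this
      · exact 𝓗.trunc_apply_of_notMem h x
    rw [this]
    exact Submodule.zero_mem _

theorem lie_Emat_mem_g {x : Mat m e} (hx : x ∈ 𝓗.g.toSubmodule) : ⁅𝓗.Emat, x⁆ ∈ 𝓗.g.toSubmodule :=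
  𝓗.g.lie_mem (𝓗.E : 𝓗.g).2 hx

/-! ### The Killing form and the grading -/

/-- Invariance under E gives (d + d') κ(x, y) = 0. -/
theorem killingForm_eq_zero_of_glDeg {x y : 𝓗.g} {d d' : ℤ} (hx : (x : Mat m e) ∈ 𝓗.glDeg d)
    (hy : (y : Mat m e) ∈ 𝓗.glDeg d') (h : d + d' ≠ 0) : killingForm ℂ 𝓗.g x y = 0 := by
  have h1 : ⁅(𝓗.E : 𝓗.g), x⁆ = (d : ℂ) • x := Subtype.ext hx
  have h2 : ⁅(𝓗.E : 𝓗.g), y⁆ = (d' : ℂ) • y := Subtype.ext hy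
  have h3 : killingForm ℂ 𝓗.g ⁅x, (𝓗.E : 𝓗.g)⁆ y = killingForm ℂ 𝓗.g x ⁅(𝓗.E : 𝓗.g), y⁆ :=
    traceForm_apply_lie_apply ℂ 𝓗.g 𝓗.g x 𝓗.E y
  rw [← lie_skew, h1, h2, map_neg, map_smul, map_smul, LinearMap.neg_apply, LinearMap.smul_apply,
    smul_eq_mul, smul_eq_mul, ← sub_eq_zero, neg_sub_left, ← add_mul, neg_eq_zero, mul_eq_zero] at h3
  refine h3.resolve_left fun h4 => h ?_
  rw [add_comm]
  exact_mod_cast h4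

theorem killingForm_eq_zero_of_glSupp {x y : 𝓗.g} {P Q : ℤ → Prop}
    (hx : (x : Mat m e) ∈ 𝓗.glSupp {d | P d}) (hy : (y : Mat m e) ∈ 𝓗.glSupp {d | Q d})
    (h : ∀ d d', P d → Q d' → d + d' ≠ 0) : killingForm ℂ 𝓗.g x y = 0 := by
  have key : ∀ {φ : 𝓗.g →ₗ[ℂ] ℂ} {P : ℤ → Prop} {x : 𝓗.g}, (x : Mat m e) ∈ 𝓗.glSupp {d | P d} →
      (∀ d, P d → ∀ z : 𝓗.g, (z : Mat m e) ∈ 𝓗.glDeg d → φ z = 0) → φ x = 0 := by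
    intro φ P x hx hφ
    have h1 := 𝓗.inf_glSupp_le (p := 𝓗.g.toSubmodule) (fun _ => 𝓗.lie_Emat_mem_g) P ⟨x.2, hx⟩
    have h2 : ⨆ d : {d : ℤ // P d}, 𝓗.g.toSubmodule ⊓ 𝓗.glDeg d ≤
        φ.ker.map 𝓗.g.toSubmodule.subtype := by
      refine iSup_le fun d z hz => ⟨⟨z, hz.1⟩, hφ d d.2 _ hz.2, rfl⟩
    obtain ⟨z, hz, hzx⟩ := h2 h1
    rw [← Subtype.ext hzx]
    exact hz
  refine key (φ := (killingForm ℂ 𝓗.g).flip y) hx fun d hd z hz => ?_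
  exact key (φ := killingForm ℂ 𝓗.g z) hy fun d' hd' w hw =>
    𝓗.killingForm_eq_zero_of_glDeg hz hw (h d d' hd hd')

/-- The orthogonal complement of `𝔤_{>0}` is `𝔤_{≥0}`. -/
theorem mem_gNonneg_of_killingForm {a : 𝓗.g}
    (h : ∀ x : 𝓗.g, (x : Mat m e) ∈ 𝓗.glSupp {d | 0 < d} → killingForm ℂ 𝓗.g a x = 0) :
    (a : Mat m e) ∈ 𝓗.gNonneg := by
  have hmem : ∀ (S : Set ℤ) (x : 𝓗.g), 𝓗.trunc S x ∈ 𝓗.g := fun S x =>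
    𝓗.trunc_mem (p := 𝓗.g.toSubmodule) (fun _ => 𝓗.lie_Emat_mem_g) S x.2
  have hdec : ∀ (S : Set ℤ) (x : 𝓗.g), (⟨_, hmem S x⟩ : 𝓗.g) + ⟨_, hmem Sᶜ x⟩ = x := fun S x =>
    Subtype.ext (𝓗.trunc_add_trunc_compl S x)
  set N : Set ℤ := {d | 0 ≤ d}
  set a₀ : 𝓗.g := ⟨_, hmem N a⟩ with ha₀
  set a₁ : 𝓗.g := ⟨_, hmem Nᶜ a⟩ with ha₁
  have ha : a₀ + a₁ = a := hdec N a
  -- The negative part of `a` is orthogonal to 𝔤_{≤0} by degree, and to 𝔤_{>0} because both `a` and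
  -- its nonnegative part are. Nondegeneracy kills it.
  have h0 : a₁ = 0 := by
    refine 𝓗.eq_zero_of_killingForm fun x => ?_
    set S : Set ℤ := {d | 0 < d}
    rw [← hdec S x, map_add]
    have h1 : killingForm ℂ 𝓗.g a ⟨_, hmem S x⟩ = 0 := h _ (𝓗.trunc_mem_glSupp _ _)
    have h2 : killingForm ℂ 𝓗.g a₀ ⟨_, hmem S x⟩ = 0 :=
      𝓗.killingForm_eq_zero_of_glSupp (P := (0 ≤ ·)) (Q := (0 < ·)) (𝓗.trunc_mem_glSupp _ _)
        (𝓗.trunc_mem_glSupp _ _) fun d d' h h' => by omega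
    have h3 : killingForm ℂ 𝓗.g a₁ ⟨_, hmem Sᶜ x⟩ = 0 :=
      𝓗.killingForm_eq_zero_of_glSupp (P := (¬ 0 ≤ ·)) (Q := (¬ 0 < ·)) (𝓗.trunc_mem_glSupp _ _)
        (𝓗.trunc_mem_glSupp _ _) fun d d' h h' => by omega
    rw [← ha, map_add, LinearMap.add_apply, h2, zero_add] at h1
    rw [h1, h3, add_zero]
  rw [h0, add_zero] at ha
  rw [𝓗.mem_gNonneg_iff a.2, ← ha]
  exact 𝓗.apply_tangent_zero_of_mem_glSupp (𝓗.trunc_mem_glSupp N a)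

/-- The functional `κ(π, -)` on `𝔤` is the matrix coefficient at the highest weight vector. -/
theorem killingForm_dualElt (x : 𝓗.g) : killingForm ℂ 𝓗.g 𝓗.dualElt x = (x : Mat m e) i0 i0 := by
  have hx : x ∈ (⊤ : LieSubmodule ℂ 𝓗.H 𝓗.g) := trivial
  rw [← LieModule.iSup_genWeightSpace_eq_top' ℂ 𝓗.H 𝓗.g] at hx
  induction hx using LieSubmodule.iSup_induction' with
  | zero => simp
  | add x y _ _ hx hy => rw [map_add, hx, hy]; rfl
  | mem α x hx =>
    replace hx : x ∈ rootSpace 𝓗.H α := hx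
    have h00 : ∀ h : 𝓗.H, ((h : 𝓗.g) : Mat m e) i0 i0 = 𝓗.wt h := by
      intro h
      have := congrFun (𝓗.highest.2.1 h) i0
      rw [lie_vec, mulVec_refVec] at this
      simpa [refVec] using this
    by_cases hα : α.IsZero
    · rw [Weight.IsZero] at hα
      rw [hα, rootSpace_zero_eq] at hx
      have h1 := traceForm_killingDual 𝓗.wt (⟨x, hx⟩ : 𝓗.H)
      rw [← h00] at h1
      exact h1
    -- For a root vector both sides vanish: the left by invariance of κ, since 𝔥 is abelian; the
    -- right because [h, x] = α(h) x, and the (0,0) entry of a commutator with the degree-zero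
    -- matrix h is zero.
    · obtain ⟨h, hh⟩ : ∃ h, α h ≠ 0 := by
        by_contra hn
        push Not at hn
        exact hα (funext hn)
      have h1 : ⁅(h : 𝓗.g), x⁆ = α h • x := lie_eq_smul_of_mem_rootSpace hx h
      have h2 : killingForm ℂ 𝓗.g ⁅𝓗.dualElt, (h : 𝓗.g)⁆ x = killingForm ℂ 𝓗.g 𝓗.dualElt ⁅(h : 𝓗.g), x⁆ :=
        traceForm_apply_lie_apply ℂ 𝓗.g 𝓗.g 𝓗.dualElt h x
      have h3 : ⁅𝓗.dualElt, (h : 𝓗.g)⁆ = 0 := by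
        have := lie_eq_smul_of_mem_rootSpace (α := 0) (x := (h : 𝓗.g)) (by simp) (killingDual 𝓗.H 𝓗.wt)
        rw [Pi.zero_apply, zero_smul] at this
        exact this
      rw [h3, h1, map_zero, LinearMap.zero_apply, map_smul, smul_eq_mul, eq_comm, mul_eq_zero,
        or_iff_right hh] at h2
      rw [h2]
      have h4 : ((h : 𝓗.g) : Mat m e) ∈ 𝓗.glDeg 0 := 𝓗.cartan_mem_glDeg h
      have h5 := congrFun (congrFun (congrArg Subtype.val h1) i0) i0
      change (((h : 𝓗.g) : Mat m e) * (x : Mat m e) - (x : Mat m e) * ((h : 𝓗.g) : Mat m e)) i0 i0 =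
        α h * (x : Mat m e) i0 i0 at h5
      have h6 : ∀ j : Idx m e, j ≠ i0 → ((h : 𝓗.g) : Mat m e) i0 j = 0 ∧ ((h : 𝓗.g) : Mat m e) j i0 = 0 := by
        intro j hj
        have hd := 𝓗.deg_pos hj
        constructor <;> by_contra hn <;>
        · have := 𝓗.mem_glDeg.1 h4 _ _ hn
          rw [entryDeg, 𝓗.deg_zero] at this
          omega
      rw [Matrix.sub_apply, Matrix.mul_apply, Matrix.mul_apply, Finset.sum_eq_single i0,
        Finset.sum_eq_single i0, mul_comm, sub_self, eq_comm, mul_eq_zero, or_iff_right hh] at h5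
      · exact h5.symm
      all_goals simp +contextual [h6]

theorem mulVec_refVec_of_mem_gNonneg {x : 𝓗.g} (hx : (x : Mat m e) ∈ 𝓗.gNonneg) :
    (x : Mat m e).mulVec (refVec i0) = killingForm ℂ 𝓗.g 𝓗.dualElt x • refVec i0 := by
  rw [𝓗.killingForm_dualElt]
  ext j
  rw [mulVec_refVec]
  rcases j with _ | j | j
  · simp [refVec]
  · simpa [refVec] using (𝓗.mem_gNonneg_iff x.2).1 hx j
  · simpa [refVec] using 𝓗.apply_normal_zero x.2 j

end HomogeneousEmbedding
end FubiniRigidity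

/-! ### Cones and quadratic equations -/

namespace FubiniRigidity
open Filter
variable {m e : ℕ}

theorem mulVecLin_apply_eq_smul (A : Frm m e) (y : Vec m e) :
    Matrix.mulVecLin (A : Mat m e) y = A • y := rfl

theorem smul_mem_cone {X : Set (ℙ ℂ (Vec m e))} {c : ℂ} (hc : c ≠ 0) {y : Vec m e} :
    c • y ∈ cone X ↔ y ∈ cone X := by
  have key : ∀ {c : ℂ} (_ : c ≠ 0) {y : Vec m e}, y ∈ cone X → c • y ∈ cone X := by
    rintro c hc y ⟨hy, h⟩
    refine ⟨smul_ne_zero hc hy, ?_⟩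
    rwa [(Projectivization.mk_eq_mk_iff' ℂ _ y _ hy).2 ⟨c, rfl⟩]
  refine ⟨fun h => ?_, key hc⟩
  have := key (inv_ne_zero hc) h
  rwa [smul_smul, inv_mul_cancel₀ hc, one_smul] at this

theorem mem_cone_smul_image {X : Set (ℙ ℂ (Vec m e))} (A : Frm m e) {y : Vec m e} :
    y ∈ cone ((fun x => A • x) '' X) ↔ A⁻¹ • y ∈ cone X := by
  constructor
  · rintro ⟨hy, x, hx, hxy⟩
    refine ⟨(smul_ne_zero_iff_ne _).2 hy, ?_⟩
    rw [← Projectivization.smul_mk _ hy, ← hxy]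
    simpa using hx
  · rintro ⟨hy, h⟩
    have hy' : y ≠ 0 := (smul_ne_zero_iff_ne _).1 hy
    refine ⟨hy', _, h, ?_⟩
    change A • _ = _
    rw [← Projectivization.smul_mk _ hy', smul_inv_smul]

theorem isHomogeneous_quadratic (B : Idx m e → Idx m e → ℂ) :
    (∑ i, ∑ j, MvPolynomial.C (B i j) * (MvPolynomial.X i * MvPolynomial.X j)).IsHomogeneous 2 := by
  refine MvPolynomial.IsHomogeneous.sum _ _ _ fun i _ => MvPolynomial.IsHomogeneous.sum _ _ _ fun j _ => ?_
  exact (MvPolynomial.isHomogeneous_C _ _).mul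
    ((MvPolynomial.isHomogeneous_X _ i).mul (MvPolynomial.isHomogeneous_X _ j))

/-- The cone of common zeros of vector-valued quadratic forms is Zariski closed. -/
theorem isZariskiClosed_of_bilinear {ι : Type*} (B : ι → Vec m e →ₗ[ℂ] Vec m e →ₗ[ℂ] ℂ)
    {X : Set (ℙ ℂ (Vec m e))} (hX : ∀ y, y ∈ cone X ↔ y ≠ 0 ∧ ∀ k, B k y y = 0) :
    IsZariskiClosed X := by
  have heval : ∀ k y, MvPolynomial.eval y (∑ i, ∑ j, MvPolynomial.C (B k (refVec i) (refVec j)) *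
      (MvPolynomial.X i * MvPolynomial.X j)) = B k y y := by
    intro k y
    have hy : y = ∑ i, y i • refVec i := by
      ext j
      simp [refVec, Finset.sum_apply, Pi.single_apply]
    conv_rhs => rw [hy]
    simp only [map_sum, LinearMap.sum_apply, map_smul, LinearMap.smul_apply, smul_eq_mul, map_mul,
      MvPolynomial.eval_C, MvPolynomial.eval_X, Finset.mul_sum]
    rw [Finset.sum_comm]
    refine Finset.sum_congr rfl fun i _ => Finset.sum_congr rfl fun j _ => ?_
    ring
  refine ⟨Set.range fun k => ∑ i, ∑ j, MvPolynomial.C (B k (refVec i) (refVec j)) *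
      (MvPolynomial.X i * MvPolynomial.X j), ?_, fun y hy => ?_⟩
  · rintro _ ⟨k, rfl⟩
    exact ⟨2, isHomogeneous_quadratic _⟩
  · have : Projectivization.mk ℂ y hy ∈ X ↔ y ∈ cone X := ⟨fun h => ⟨hy, h⟩, fun h => h.2⟩
    rw [this, hX, and_iff_right hy, Set.forall_mem_range]
    exact forall_congr' fun k => by rw [heval]

namespace HomogeneousEmbedding
open LieAlgebra LieAlgebra.IsKilling LieModule
variable (𝓗 : HomogeneousEmbedding m e)

/-! ### The quadrics through `Z` -/

/-- The element of `𝔤` that represents the functional `x ↦ ψ (x y)`. -/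
def moment : Module.Dual ℂ (Vec m e) →ₗ[ℂ] Vec m e →ₗ[ℂ] 𝓗.g :=
  LinearMap.mk₂ ℂ (fun ψ y => 𝓗.killingRep
      (ψ ∘ₗ (Matrix.mulVecBilin ℂ ℂ).flip y ∘ₗ 𝓗.g.toSubmodule.subtype))
    (fun ψ ψ' y => by rw [LinearMap.add_comp, map_add])
    (fun c ψ y => by rw [LinearMap.smul_comp, map_smul])
    (fun ψ y y' => by rw [map_add, LinearMap.add_comp, LinearMap.comp_add, map_add])
    (fun c ψ y => by rw [map_smul, LinearMap.smul_comp, LinearMap.comp_smul, map_smul])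

theorem killingForm_moment (ψ : Module.Dual ℂ (Vec m e)) (y : Vec m e) (x : 𝓗.g) :
    killingForm ℂ 𝓗.g (𝓗.moment ψ y) x = ψ ((x : Mat m e).mulVec y) :=
  𝓗.killingForm_killingRep _ x

theorem eq_of_killingForm {x x' : 𝓗.g} (h : ∀ y, killingForm ℂ 𝓗.g x y = killingForm ℂ 𝓗.g x' y) :
    x = x' := by
  rw [← sub_eq_zero]
  refine 𝓗.eq_zero_of_killingForm fun y => ?_
  rw [map_sub, LinearMap.sub_apply, h, sub_self]

/-- The square length of the highest weight. -/
def sqLength : ℂ := 𝓗.wt (killingDual 𝓗.H 𝓗.wt)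

theorem dualElt_mulVec : (𝓗.dualElt : Mat m e).mulVec (refVec i0) = 𝓗.sqLength • refVec i0 :=
  𝓗.highest.2.1 _

/-- The bilinear map whose restrictions to the diagonal are the quadrics through `Z`. -/
def quadric (ψ : Module.Dual ℂ (Vec m e)) : Vec m e →ₗ[ℂ] Vec m e →ₗ[ℂ] Vec m e :=
  Matrix.mulVecBilin ℂ ℂ ∘ₗ 𝓗.g.toSubmodule.subtype ∘ₗ 𝓗.moment ψ -
    LinearMap.lsmul ℂ (Vec m e) ∘ₗ (𝓗.sqLength • ψ)

theorem quadric_apply (ψ : Module.Dual ℂ (Vec m e)) (y z : Vec m e) :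
    𝓗.quadric ψ y z = (𝓗.moment ψ y : Mat m e).mulVec z - (𝓗.sqLength * ψ y) • z := rfl

/-- The cone cut out by the quadrics. -/
def quadricCone : Set (Vec m e) := {y | ∀ ψ, 𝓗.quadric ψ y y = 0}

theorem moment_smul {h : Frm m e} (hh : h ∈ 𝓗.G) (ψ : Module.Dual ℂ (Vec m e)) (y : Vec m e) :
    𝓗.moment ψ (h • y) = 𝓗.Ad hh (𝓗.moment (ψ ∘ₗ Matrix.mulVecLin (h : Mat m e)) y) := by
  refine 𝓗.eq_of_killingForm fun x => ?_
  obtain ⟨x, rfl⟩ : ∃ x', 𝓗.Ad hh x' = x := (𝓗.Ad hh).surjective x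
  rw [killingForm_Ad, killingForm_moment, killingForm_moment, Ad_mulVec]
  rfl

theorem smul_mem_quadricCone_of_mem {h : Frm m e} (hh : h ∈ 𝓗.G) {y : Vec m e} (hy : y ∈ 𝓗.quadricCone) :
    h • y ∈ 𝓗.quadricCone := by
  intro ψ
  have := hy (ψ ∘ₗ Matrix.mulVecLin (h : Mat m e))
  rw [quadric_apply, sub_eq_zero] at this ⊢
  rw [moment_smul 𝓗 hh, Ad_mulVec, this, LinearMap.comp_apply, mulVecLin_apply_eq_smul,
    smul_comm]

theorem const_smul_mem_quadricCone (c : ℂ) {y : Vec m e} (hy : y ∈ 𝓗.quadricCone) :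
    c • y ∈ 𝓗.quadricCone := by
  intro ψ
  rw [map_smul, map_smul, LinearMap.smul_apply, hy, smul_zero, smul_zero]

/-- The moment of (ψ, 𝗏_0) is orthogonal to 𝔤_{>0}, which kills 𝗏_0, so it lies in 𝔤_{≥0} and scales
𝗏_0. The scalar is its pairing with `dualElt`, that is, ψ(`dualElt` · 𝗏_0) = (π, π) ψ(𝗏_0). -/
theorem refVec_mem_quadricCone : (refVec i0 : Vec m e) ∈ 𝓗.quadricCone := by
  intro ψ
  have h1 : (𝓗.moment ψ (refVec i0) : Mat m e) ∈ 𝓗.gNonneg := by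
    refine 𝓗.mem_gNonneg_of_killingForm fun x hx => ?_
    have : (x : Mat m e).mulVec (refVec i0) = 0 := by
      ext j
      rw [mulVec_refVec]
      by_contra hn
      have h1 := hx j i0 hn
      rw [entryDeg, 𝓗.deg_zero, Set.mem_ofPred_eq] at h1
      omega
    rw [killingForm_moment, this, map_zero]
  rw [quadric_apply, 𝓗.mulVec_refVec_of_mem_gNonneg h1, ← sub_smul]
  have h2 : killingForm ℂ 𝓗.g 𝓗.dualElt (𝓗.moment ψ (refVec i0)) = 𝓗.sqLength * ψ (refVec i0) := by
    rw [killingForm, traceForm_comm]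
    refine (𝓗.killingForm_moment ψ _ _).trans ?_
    rw [dualElt_mulVec, map_smul, smul_eq_mul]
  rw [h2, sub_self, zero_smul]

theorem cone_Z_subset : cone 𝓗.Z ⊆ 𝓗.quadricCone := by
  rintro y ⟨hy, h, hh, hyh⟩
  rw [refPt, Projectivization.smul_mk, Projectivization.mk_eq_mk_iff'] at hyh
  obtain ⟨c, rfl⟩ := hyh
  exact 𝓗.const_smul_mem_quadricCone c (𝓗.smul_mem_quadricCone_of_mem hh 𝓗.refVec_mem_quadricCone)

theorem smul_refVec_mem_cone_Z {h : Frm m e} (hh : h ∈ 𝓗.G) : h • (refVec i0 : Vec m e) ∈ cone 𝓗.Z :=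
  ⟨(smul_ne_zero_iff_ne _).2 (refVec_ne_zero _), h, hh, by rw [refPt, Projectivization.smul_mk]⟩

theorem smul_mem_cone_Z {h : Frm m e} (hh : h ∈ 𝓗.G) {y : Vec m e} :
    h • y ∈ cone 𝓗.Z ↔ y ∈ cone 𝓗.Z := by
  have key : ∀ {h : Frm m e} (_ : h ∈ 𝓗.G) {y : Vec m e}, y ∈ cone 𝓗.Z → h • y ∈ cone 𝓗.Z := by
    rintro h hh y ⟨hy, k, hk, hyk⟩
    refine ⟨(smul_ne_zero_iff_ne _).2 hy, h * k, mul_mem hh hk, ?_⟩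
    rw [← Projectivization.smul_mk _ hy, hyk, mul_smul]
  refine ⟨fun H => ?_, key hh⟩
  have := key (inv_mem hh) H
  rwa [inv_smul_smul] at this

theorem moment_proj_refVec : 𝓗.moment (LinearMap.proj i0) (refVec i0) = 𝓗.dualElt := by
  refine 𝓗.eq_of_killingForm fun x => ?_
  rw [killingForm_moment, killingForm_dualElt, LinearMap.proj_apply, mulVec_refVec]

theorem analyticAt_quadric (ψ : Module.Dual ℂ (Vec m e)) (y : Vec m e) :
    AnalyticAt ℂ (fun y => 𝓗.quadric ψ y y) y := by
  have h := ContinuousLinearMap.analyticAt_bilinear (LinearMap.toContinuousBilinearMap (𝓗.quadric ψ)) (y, y)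
  exact h.comp (f := fun y : Vec m e => (y, y)) (analyticAt_id.prod analyticAt_id)

theorem fderiv_quadric (ψ : Module.Dual ℂ (Vec m e)) (y w : Vec m e) :
    fderiv ℂ (fun y => 𝓗.quadric ψ y y) y w = 𝓗.quadric ψ y w + 𝓗.quadric ψ w y := by
  let B := LinearMap.toContinuousBilinearMap (𝓗.quadric ψ)
  have h1 : HasFDerivAt (fun y => B y y) _ y :=
    B.hasFDerivAt_of_bilinear (hasFDerivAt_id y) (hasFDerivAt_id y)
  have h2 : fderiv ℂ (fun y => 𝓗.quadric ψ y y) y = _ := h1.fderiv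
  rw [h2]
  rfl

/-- For ψ the 0-th coordinate, the moment at 𝗏_0 is `dualElt`. The linearized equation then says
that `dualElt` · w - (π, π) w lies in ℂ𝗏_0 + 𝔤.𝗏_0, and the eigenvalue gap puts w there as well.
This single ψ already yields the right tangent space. -/
theorem ker_fderiv_quadric_le :
    (fderiv ℂ (fun y => 𝓗.quadric (LinearMap.proj i0) y y) (refVec i0 : Vec m e)).ker ≤ tangent m e := by
  intro w hw
  replace hw := (𝓗.fderiv_quadric (LinearMap.proj i0) (refVec i0) w).symm.trans hw
  rw [quadric_apply, quadric_apply, moment_proj_refVec] at hw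
  have h1 : (LinearMap.proj i0 : Vec m e →ₗ[ℂ] ℂ) (refVec i0) = 1 := by simp [refVec]
  rw [h1, mul_one] at hw
  refine 𝓗.mem_tangent_of_dualElt ?_
  have h2 := eq_neg_of_add_eq_zero_left hw
  change (𝓗.dualElt : Mat m e).mulVec w - 𝓗.sqLength • w ∈ _
  rw [h2]
  exact Submodule.neg_mem _ (Submodule.sub_mem _ (𝓗.lie_refVec_zero_mem_tangent _)
    (Submodule.smul_mem _ _ refVec_zero_mem_tangent))

/-- `Z` is a submanifold near the base point. -/
theorem hasTangentSpace_cone_Z_refVec : HasTangentSpace (cone 𝓗.Z) (refVec i0) (tangent m e) ∧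
    ∀ᶠ y in 𝓝 (refVec i0 : Vec m e), y ∈ 𝓗.quadricCone → y ∈ cone 𝓗.Z := by
  classical
  have hx : ∀ b : Fin m, ∃ x ∈ 𝓗.g, ∀ b', x (iT b') i0 = (Pi.single b 1 : Fin m → ℂ) b' := fun b =>
    𝓗.exists_apply_tangent_zero _
  choose x hxg hxb using hx
  -- The cone is parametrized by c exp(∑ t_b x_b) 𝗏_0, with x_b ∈ 𝔤 chosen so that x_b 𝗏_0 has
  -- tangential part 𝗏_b.
  obtain ⟨ψ', hψ, hψ'⟩ := exists_hasStrictFDerivAt_smul_exp x (refVec i0 : Vec m e)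
  set ψ : ℂ × (Fin m → ℂ) → Vec m e := fun p =>
    p.1 • (NormedSpace.exp (∑ b, p.2 b • x b)).mulVec (refVec i0) with hψdef
  have hψ0 : ψ (1, 0) = refVec i0 := by simp [hψdef]
  set Φ : Vec m e → Vec m e := fun y => 𝓗.quadric (LinearMap.proj i0) y y
  have hΦ : AnalyticAt ℂ Φ (refVec i0) := 𝓗.analyticAt_quadric _ _
  have hrange : tangent m e ≤ ψ'.range := by
    intro y hy
    let t : Fin m → ℂ := fun b => y (iT b)
    refine ⟨(y i0 - ∑ b, t b * x b i0 i0, t), ?_⟩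
    refine (hψ' _).trans ?_
    ext j
    simp only [Pi.add_apply, Pi.smul_apply, mulVec_refVec, Matrix.sum_apply, Matrix.smul_apply, smul_eq_mul]
    rcases j with _ | j | j
    · simp [refVec]
    · simp only [hxb]
      simp [refVec, t, Pi.single_apply]
    · simp only [𝓗.apply_normal_zero (hxg _)]
      simpa [refVec] using (hy j).symm
  have hmem : ∀ᶠ p in 𝓝 ((1 : ℂ), (0 : Fin m → ℂ)), ψ p ∈ cone 𝓗.Z := by
    have : ∀ᶠ p in 𝓝 ((1 : ℂ), (0 : Fin m → ℂ)), p.1 ≠ 0 :=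
      continuous_fst.continuousAt.eventually_ne one_ne_zero
    filter_upwards [this] with p hp
    rw [hψdef]
    refine (smul_mem_cone hp).2 ?_
    exact 𝓗.smul_refVec_mem_cone_Z (𝓗.expFrm_mem_G (Submodule.sum_mem 𝓗.g.toSubmodule fun b _ =>
      𝓗.g.smul_mem (p.2 b) (hxg b)))
  have hker : tangent m e = (fderiv ℂ Φ (refVec i0)).ker := by
    refine le_antisymm ?_ 𝓗.ker_fderiv_quadric_le
    have h0 : Φ ∘ ψ =ᶠ[𝓝 (1, 0)] fun _ => 0 := by
      filter_upwards [hmem] with p hp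
      exact 𝓗.cone_Z_subset hp _
    have hd : HasFDerivAt Φ (fderiv ℂ Φ (refVec i0)) (ψ (1, 0)) := by
      rw [hψ0]; exact hΦ.differentiableAt.hasFDerivAt
    have h2 := ((hd.comp _ hψ.hasFDerivAt).congr_of_eventuallyEq h0.symm).unique (hasFDerivAt_const _ _)
    intro y hy
    obtain ⟨p, rfl⟩ := hrange hy
    exact DFunLike.congr_fun h2 p
  have hker' : (fderiv ℂ Φ (refVec i0)).ker ≤ ψ'.range := hker ▸ hrange
  refine ⟨?_, ?_⟩
  · rw [hker]
    exact hasTangentSpace_ker hΦ (Eventually.of_forall fun z hz => 𝓗.cone_Z_subset hz _) hψ hψ0 hker' hmem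
  · have h0 : ∀ᶠ p in 𝓝 ((1 : ℂ), (0 : Fin m → ℂ)), Φ (ψ p) = 0 := by
      filter_upwards [hmem] with p hp
      exact 𝓗.cone_Z_subset hp _
    filter_upwards [eventually_exists_of_ker_le_range hΦ.hasStrictFDerivAt hψ hψ0 hker' h0 hmem] with y hy hyq
    obtain ⟨p, hp, rfl⟩ := hy (hyq _)
    exact hp

theorem map_tangent (v : Frm m e) : (tangent m e).map (Matrix.mulVecLin (v : Mat m e)) =
    Submodule.span ℂ (insert (v • refVec i0) (Set.range fun α : Fin m => v • refVec (iT α))) := by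
  rw [tangent_eq_span, Submodule.map_span, Set.image_insert_eq, ← Set.range_comp]
  rfl

theorem mem_frameBundle_iff {X : Set (ℙ ℂ (Vec m e))} {v : Frm m e} : v ∈ frameBundle X ↔
    HasTangentSpace (cone X) (v • refVec i0) ((tangent m e).map (Matrix.mulVecLin (v : Mat m e))) := by
  rw [map_tangent]
  rfl

theorem mem_frameBundle_Z {h : Frm m e} (hh : h ∈ 𝓗.G) : h ∈ frameBundle 𝓗.Z := by
  rw [mem_frameBundle_iff]
  exact 𝓗.hasTangentSpace_cone_Z_refVec.1.smul h fun z => (𝓗.smul_mem_cone_Z (inv_mem hh)).symm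

/-- The vectors for which every G-translate has zero 0-th coordinate form a 𝔤-submodule, as
differentiation along exp(tx) shows. It does not contain 𝗏_0, so it is zero. -/
theorem exists_smul_apply_zero_ne_zero {y : Vec m e} (hy : y ≠ 0) : ∃ h ∈ 𝓗.G, (h • y) i0 ≠ 0 := by
  by_contra! hn
  let W : LieSubmodule ℂ 𝓗.g (Vec m e) :=
    { carrier := {w | ∀ h ∈ 𝓗.G, (h • w) i0 = 0}
      add_mem' := fun {w w'} hw hw' h hh => by
        rw [smul_add, Pi.add_apply, hw h hh, hw' h hh, add_zero]
      zero_mem' := fun h _ => by rw [smul_zero]; rfl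
      smul_mem' := fun c w hw h hh => by
        rw [smul_comm, Pi.smul_apply, hw h hh, smul_zero]
      lie_mem := fun {x w} hw h hh => by
        have h1 := ((hasMatDerivAt_exp (x : Mat m e) 0).const_mul (h : Mat m e)).linear
          (LinearMap.proj i0 ∘ₗ (Matrix.mulVecBilin ℂ ℂ).flip w)
        have h2 : ∀ t : ℂ, (LinearMap.proj i0 ∘ₗ (Matrix.mulVecBilin ℂ ℂ).flip w)
            ((h : Mat m e) * NormedSpace.exp (t • (x : Mat m e))) = 0 := fun t =>
          hw (h * expFrm (t • (x : Mat m e))) (mul_mem hh (𝓗.expFrm_mem_G (𝓗.g.smul_mem t x.2)))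
        simp only [h2] at h1
        have h3 := h1.unique (hasDerivAt_const _ _)
        rw [zero_smul, NormedSpace.exp_zero, one_mul] at h3
        rw [lie_vec, smul_eq_mulVec, Matrix.mulVec_mulVec]
        exact h3 }
  rcases eq_bot_or_eq_top W with h | h
  · have : y ∈ W := hn
    rw [h, LieSubmodule.mem_bot] at this
    exact hy this
  · have : (refVec i0 : Vec m e) ∈ W := by rw [h]; trivial
    have := this 1 (one_mem _)
    simp [refVec] at this

/-- `Z` is cut out by quadrics. -/
theorem mem_cone_Z_iff {y : Vec m e} : y ∈ cone 𝓗.Z ↔ y ≠ 0 ∧ y ∈ 𝓗.quadricCone := by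
  refine ⟨fun h => ⟨h.1, 𝓗.cone_Z_subset h⟩, fun ⟨hy0, hy⟩ => ?_⟩
  obtain ⟨h, hh, hne⟩ := 𝓗.exists_smul_apply_zero_ne_zero hy0
  set z := h • y with hz
  have hzq : z ∈ 𝓗.quadricCone := 𝓗.smul_mem_quadricCone_of_mem hh hy
  -- The flow of E, normalized to have 0-th coordinate 1, multiplies coordinate j by e^{-t deg j}
  -- and contracts `z` to 𝗏_0. Near 𝗏_0 the quadrics cut out exactly the cone over Z, and both cones
  -- are invariant under G and nonzero scalars.
  let γ : ℝ → Vec m e := fun t =>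
    ((z i0)⁻¹ * Complex.exp (-(t * 𝓗.wt 𝓗.E))) • expFrm ((t : ℂ) • 𝓗.Emat) • z
  have hγ : ∀ (t : ℝ) (j : Idx m e), γ t j = ((z i0)⁻¹ * z j) * ((Real.exp (-t) : ℝ) : ℂ) ^ 𝓗.deg j := by
    intro t j
    have h1 : NormedSpace.exp ((t : ℂ) • 𝓗.Emat) = Matrix.diagonal fun j =>
        Complex.exp (t * (𝓗.wt 𝓗.E - (𝓗.deg j : ℂ))) := by
      rw [Emat_eq, ← Matrix.diagonal_smul, Matrix.exp_diagonal]
      congr 1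
      ext j
      rw [Pi.coe_exp, ← Complex.exp_eq_exp_ℂ]
      rfl
    change _ * (Matrix.mulVec (expFrm ((t : ℂ) • 𝓗.Emat) : Mat m e) z j) = _
    rw [coe_expFrm, h1, Matrix.mulVec_diagonal, Complex.ofReal_exp, ← Complex.exp_nat_mul,
      show ∀ a b c d : ℂ, a * b * (c * d) = a * d * (b * c) by intros; ring, ← Complex.exp_add]
    congr 2
    push_cast
    ring
  have hlim : Tendsto γ atTop (𝓝 (refVec i0)) := by
    refine tendsto_pi_nhds.2 fun j => ?_
    simp only [hγ]
    by_cases hj : j = i0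
    · subst hj
      rw [𝓗.deg_zero]
      simp [refVec, inv_mul_cancel₀ hne]
    · have h1 : Tendsto (fun t : ℝ => ((Real.exp (-t) : ℝ) : ℂ)) atTop (𝓝 0) := by
        have := (Complex.continuous_ofReal.tendsto 0).comp Real.tendsto_exp_neg_atTop_nhds_zero
        rw [Complex.ofReal_zero] at this
        exact this
      have h2 := (h1.pow (𝓗.deg j)).const_mul ((z i0)⁻¹ * z j)
      rw [zero_pow (𝓗.deg_pos hj).ne', mul_zero] at h2
      simpa [refVec, hj] using h2
  obtain ⟨t, ht⟩ := (hlim.eventually 𝓗.hasTangentSpace_cone_Z_refVec.2).exists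
  have hE : expFrm ((t : ℂ) • 𝓗.Emat) ∈ 𝓗.G := 𝓗.expFrm_mem_G (𝓗.g.smul_mem _ (𝓗.E : 𝓗.g).2)
  have h1 := ht (𝓗.const_smul_mem_quadricCone _ (𝓗.smul_mem_quadricCone_of_mem hE hzq))
  rw [smul_mem_cone (mul_ne_zero (inv_ne_zero hne) (Complex.exp_ne_zero _)), 𝓗.smul_mem_cone_Z hE, hz,
    𝓗.smul_mem_cone_Z hh] at h1
  exact h1

/-- The translates of `Z` are Zariski closed. -/
theorem isZariskiClosed_smul_Z (A : Frm m e) : IsZariskiClosed ((fun x => A • x) '' 𝓗.Z) := by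
  refine isZariskiClosed_of_bilinear (ι := Module.Dual ℂ (Vec m e) × Idx m e) (fun k =>
    (((𝓗.quadric k.1).compr₂ (LinearMap.proj k.2)).compl₁₂
      (Matrix.mulVecLin ((A⁻¹ : Frm m e) : Mat m e)) (Matrix.mulVecLin ((A⁻¹ : Frm m e) : Mat m e))))
    fun y => ?_
  rw [mem_cone_smul_image, mem_cone_Z_iff, smul_ne_zero_iff_ne]
  refine and_congr_right fun _ => ⟨fun h k => congrFun (h k.1) k.2, fun h ψ => ?_⟩
  ext j
  exact h (ψ, j)

end HomogeneousEmbedding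
end FubiniRigidity

namespace FubiniRigidity
open Filter
variable {m e : ℕ}

/-! ### The Fubini equations along curves of frames -/

/-- Besides the leading sum over `b ::ₘ s`, only coefficients at sub-multisets of `s` occur, and
those with one index exchanged. For the latter just the products with the matrix entry need agree,
since agreement of the coefficients may be known only where the entry is nonzero. -/
theorem fubiniEq_sub_congr {F F' : Multiset (Fin m) → Fin e → ℂ} {ζ : Mat m e} {s : Multiset (Fin m)}
    {μ : Fin e} (hle : ∀ t ≤ s, ∀ ν, F t ν = F' t ν)
    (herase : ∀ a ∈ s, ∀ b, F (b ::ₘ s.erase a) μ * ζ (iT b) (iT a) =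
      F' (b ::ₘ s.erase a) μ * ζ (iT b) (iT a))
    (hadd : ∀ t u, t + u = s → ∀ b ν, F (b ::ₘ t) μ * F u ν * ζ (iT b) (iN ν) =
      F' (b ::ₘ t) μ * F' u ν * ζ (iT b) (iN ν)) :
    fubiniEq F ζ s μ - ∑ b, F (b ::ₘ s) μ * ζ (iT b) i0 =
      fubiniEq F' ζ s μ - ∑ b, F' (b ::ₘ s) μ * ζ (iT b) i0 := by
  have h1 : (s.map fun a => ((s.card : ℂ) - 2) * F (s.erase a) μ * ζ i0 (iT a)
      + ∑ b, F (b ::ₘ s.erase a) μ * ζ (iT b) (iT a)) =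
      s.map fun a => ((s.card : ℂ) - 2) * F' (s.erase a) μ * ζ i0 (iT a)
      + ∑ b, F' (b ::ₘ s.erase a) μ * ζ (iT b) (iT a) := by
    refine Multiset.map_congr rfl fun a ha => ?_
    rw [hle _ (Multiset.erase_le a s), Finset.sum_congr rfl fun b _ => herase a ha b]
  have h2 : (s.antidiagonal.map fun tu =>
      ∑ b, ∑ ν, F (b ::ₘ tu.1) μ * F tu.2 ν * ζ (iT b) (iN ν)
      + ((tu.1.card : ℂ) - 1) * ∑ ν, F tu.1 μ * F tu.2 ν * ζ i0 (iN ν)) =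
      s.antidiagonal.map fun tu =>
      ∑ b, ∑ ν, F' (b ::ₘ tu.1) μ * F' tu.2 ν * ζ (iT b) (iN ν)
      + ((tu.1.card : ℂ) - 1) * ∑ ν, F' tu.1 μ * F' tu.2 ν * ζ i0 (iN ν) := by
    refine Multiset.map_congr rfl fun tu htu => ?_
    have h := Multiset.mem_antidiagonal.1 htu
    rw [Finset.sum_congr rfl fun b _ => Finset.sum_congr rfl fun ν _ => hadd _ _ h b ν]
    simp only [hle _ (h ▸ Multiset.le_add_right tu.1 tu.2), hle _ (h ▸ Multiset.le_add_left tu.2 tu.1)]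
  rw [fubiniEq, fubiniEq, h1, h2]
  simp only [hle s le_rfl]
  ring

/-- The coefficients of the Fubini forms of degree at least two in a frame. -/
def coeffAt (r : Multiset (Fin m) → Fin e → Frm m e → ℂ) (v : Frm m e) (s : Multiset (Fin m))
    (μ : Fin e) : ℂ := if 2 ≤ s.card then r s μ v else 0

theorem coeffAt_of_le {r : Multiset (Fin m) → Fin e → Frm m e → ℂ} {v : Frm m e}
    {s : Multiset (Fin m)} (h : 2 ≤ s.card) (μ : Fin e) : coeffAt r v s μ = r s μ v := if_pos h

theorem coeffAt_of_lt {r : Multiset (Fin m) → Fin e → Frm m e → ℂ} {v : Frm m e}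
    {s : Multiset (Fin m)} (h : s.card < 2) (μ : Fin e) : coeffAt r v s μ = 0 := if_neg (not_le.2 h)

/-- The case `s = 0` is excluded because the defining equations do not constrain r at the empty
multiset; `coeffAt` assigns it the value 0. -/
theorem IsFubiniCoeff.coeffAt_eq {X : Set (ℙ ℂ (Vec m e))} {r : Multiset (Fin m) → Fin e → Frm m e → ℂ}
    (hr : IsFubiniCoeff X r) {v : Frm m e} (hv : v ∈ frameBundle X) {s : Multiset (Fin m)}
    (h : 1 ≤ s.card) (μ : Fin e) : r s μ v = coeffAt r v s μ := by
  rcases h.eq_or_lt with h | h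
  · obtain ⟨a, rfl⟩ := Multiset.card_eq_one.1 h.symm
    rw [hr.1 a μ v hv, coeffAt_of_lt (by simp)]
  · exact (coeffAt_of_le h μ).symm

/-- The Fubini equations for the velocity of a curve along which a coefficient is stationary. -/
theorem IsFubiniCoeff.fubiniEq_mcCurve {X : Set (ℙ ℂ (Vec m e))}
    {r : Multiset (Fin m) → Fin e → Frm m e → ℂ} (hr : IsFubiniCoeff X r) {γ : ℂ → Frm m e}
    (hγ : IsCurveIn X γ) (h0 : ∀ μ, mcCurve γ (iN μ) i0 = 0) {s : Multiset (Fin m)} {μ : Fin e}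
    (hs : 2 ≤ s.card → HasDerivAt (fun t => r s μ (γ t)) 0 0) :
    fubiniEq (coeffAt r (γ 0)) (mcCurve γ) s μ = 0 := by
  set ζ := mcCurve γ with hζ
  set F := coeffAt r (γ 0) with hF
  have hv : γ 0 ∈ frameBundle X := hγ.2.self_of_nhds
  have hF0 : ∀ t ν, t.card < 2 → F t ν = 0 := fun t ν ht => coeffAt_of_lt ht ν
  have hF1 : ∀ t ν, 1 ≤ t.card → r t ν (γ 0) = F t ν := fun t ν ht => hr.coeffAt_eq hv ht ν
  have hF00 : ∀ ν, F 0 ν = 0 := fun ν => hF0 0 ν (by simp)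
  have hFs : ∀ a ν, F {a} ν = 0 := fun a ν => hF0 _ ν (by simp)
  rcases Nat.lt_or_ge s.card 2 with hc | hc
  · rcases Nat.lt_or_ge s.card 1 with hc' | hc'
    · have : s = 0 := Multiset.card_eq_zero.1 (by omega)
      subst this
      simp [fubiniEq, h0, hF00, hFs]
    -- For a single index the equation is ω^μ_α = r^μ_{αβ} ω^β_0.
    · obtain ⟨a, rfl⟩ := Multiset.card_eq_one.1 (show s.card = 1 by omega)
      have h1 := (hr.2 γ hγ).1 a μ
      have h2 : ∀ b, r {a, b} μ (γ 0) = F (b ::ₘ {a}) μ := by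
        intro b
        rw [hF1 _ _ (by simp), Multiset.pair_comm]
        rfl
      simp only [h2] at h1
      have h3 : (({a} : Multiset (Fin m)).antidiagonal.map fun tu =>
          ∑ b, ∑ ν, F (b ::ₘ tu.1) μ * F tu.2 ν * ζ (iT b) (iN ν)
          + ((tu.1.card : ℂ) - 1) * ∑ ν, F tu.1 μ * F tu.2 ν * ζ i0 (iN ν)).sum = 0 := by
        refine Multiset.sum_eq_zero fun x hx => ?_
        obtain ⟨tu, htu, rfl⟩ := Multiset.mem_map.1 hx
        have h4 := congrArg Multiset.card (Multiset.mem_antidiagonal.1 htu)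
        rw [Multiset.card_add, Multiset.card_singleton] at h4
        simp [fun ν => hF0 tu.2 ν (by omega)]
      rw [fubiniEq, h3]
      simp [hF00, hFs, hζ, h1]
  · obtain ⟨dr, hdr, h1⟩ := (hr.2 γ hγ).2 s hc μ
    obtain rfl := hdr.unique (hs hc)
    have hm : (s.map fun a => ((s.card : ℂ) - 2) * r (s.erase a) μ (γ 0) * ζ i0 (iT a)
        + ∑ b, r (b ::ₘ s.erase a) μ (γ 0) * ζ (iT b) (iT a)) =
        s.map fun a => ((s.card : ℂ) - 2) * F (s.erase a) μ * ζ i0 (iT a)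
        + ∑ b, F (b ::ₘ s.erase a) μ * ζ (iT b) (iT a) := by
      refine Multiset.map_congr rfl fun a ha => ?_
      have := Multiset.card_erase_of_mem ha
      rw [Nat.pred_eq_sub_one] at this
      simp only [hF1 (s.erase a) μ (by omega), hF1 (_ ::ₘ s.erase a) μ (by simp)]
    set f : Multiset (Fin m) × Multiset (Fin m) → ℂ := fun tu =>
      ∑ b, ∑ ν, F (b ::ₘ tu.1) μ * F tu.2 ν * ζ (iT b) (iN ν)
      + ((tu.1.card : ℂ) - 1) * ∑ ν, F tu.1 μ * F tu.2 ν * ζ i0 (iN ν) with hf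
    have hd : ((s.antidiagonal.filter fun tu => 1 ≤ tu.1.card ∧ 2 ≤ tu.2.card).map fun tu =>
        ∑ b, ∑ ν, r (b ::ₘ tu.1) μ (γ 0) * r tu.2 ν (γ 0) * ζ (iT b) (iN ν)
        + ((tu.1.card : ℂ) - 1) * ∑ ν, r tu.1 μ (γ 0) * r tu.2 ν (γ 0) * ζ i0 (iN ν)) =
        (s.antidiagonal.filter fun tu => 1 ≤ tu.1.card ∧ 2 ≤ tu.2.card).map f := by
      refine Multiset.map_congr rfl fun tu htu => ?_
      obtain ⟨h2, h3⟩ := (Multiset.mem_filter.1 htu).2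
      simp only [hF1 tu.1 μ h2, fun ν => hF1 tu.2 ν (by omega), hF1 (_ ::ₘ tu.1) μ (by simp), hf]
    -- The splittings excluded from the recursion contribute nothing, since F vanishes on multisets
    -- with fewer than two elements.
    have hd' : (s.antidiagonal.map f).sum =
        ((s.antidiagonal.filter fun tu => 1 ≤ tu.1.card ∧ 2 ≤ tu.2.card).map f).sum := by
      conv_lhs => rw [← Multiset.filter_add_not (fun tu : Multiset (Fin m) × Multiset (Fin m) =>
        1 ≤ tu.1.card ∧ 2 ≤ tu.2.card) s.antidiagonal]
      rw [Multiset.map_add, Multiset.sum_add, add_eq_left]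
      refine Multiset.sum_eq_zero fun x hx => ?_
      obtain ⟨tu, htu, rfl⟩ := Multiset.mem_map.1 hx
      have h2 := (Multiset.mem_filter.1 htu).2
      rcases not_and_or.1 h2 with h2 | h2
      · have : tu.1 = 0 := Multiset.card_eq_zero.1 (by omega)
        simp [hf, this, hF00, hFs]
      · simp [hf, fun ν => hF0 tu.2 ν (not_le.1 h2)]
    have hsum : ∑ b, r (b ::ₘ s) μ (γ 0) * ζ (iT b) i0 = ∑ b, F (b ::ₘ s) μ * ζ (iT b) i0 :=
      Finset.sum_congr rfl fun b _ => by rw [hF1 _ _ (by simp)]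
    have hν : ∑ ν, r s ν (γ 0) * ζ (iN μ) (iN ν) = ∑ ν, F s ν * ζ (iN μ) (iN ν) :=
      Finset.sum_congr rfl fun ν _ => by rw [hF1 _ _ (by omega)]
    rw [hm, hd, ← hd', hsum, hν, hF1 s μ (by omega)] at h1
    have hs0 : s ≠ 0 := by
      rintro rfl
      simp at hc
    have herase : (s.map fun a => if s.erase a = 0 then ζ (iN μ) (iT a) else 0) = s.map fun _ => 0 := by
      refine Multiset.map_congr rfl fun a ha => if_neg fun h => ?_
      have h2 := Multiset.card_erase_of_mem ha
      rw [h, Multiset.card_zero, Nat.pred_eq_sub_one] at h2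
      omega
    rw [fubiniEq, if_neg hs0, herase, Multiset.map_const', Multiset.sum_replicate, smul_zero, h1]
    simp only [← hf]
    ring

namespace HomogeneousEmbedding
variable (𝓗 : HomogeneousEmbedding m e)

/-! ### The Fubini forms of `Z` -/

theorem isCurveIn_Z {h : Frm m e} (hh : h ∈ 𝓗.G) {η : Mat m e} (hη : η ∈ 𝓗.g) :
    IsCurveIn 𝓗.Z (fun t : ℂ => h * expFrm (t • η)) ∧ mcCurve (fun t : ℂ => h * expFrm (t • η)) = η := by
  have hd : ∀ t, HasMatDerivAt (fun t : ℂ => ((h * expFrm (t • η) : Frm m e) : Mat m e)) _ t := fun t =>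
    (hasMatDerivAt_exp η t).const_mul (h : Mat m e)
  refine ⟨⟨fun i j => ?_, Eventually.of_forall fun t => 𝓗.mem_frameBundle_Z (mul_mem hh
    (𝓗.expFrm_mem_G (𝓗.g.smul_mem t hη)))⟩, ?_⟩
  · have : Differentiable ℂ fun t : ℂ => ((h * expFrm (t • η) : Frm m e) : Mat m e) i j := fun t =>
      (hd t i j).differentiableAt
    exact this.analyticAt 0
  · have hv : velocity (fun t : ℂ => h * expFrm (t • η)) = (h : Mat m e) * η := by
      ext i j
      have := (hd 0 i j).deriv
      rw [zero_smul, NormedSpace.exp_zero, one_mul] at this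
      exact this
    rw [mcCurve, hv, zero_smul, expFrm_zero, mul_one, ← mul_assoc, Units.inv_mul, one_mul]

variable {r : Multiset (Fin m) → Fin e → Frm m e → ℂ}

/-- The coefficients of the Fubini forms of `Z` are constant on `𝒢`. -/
theorem coeff_const (hr : IsFubiniCoeff 𝓗.Z r) (n : ℕ) : ∀ s : Multiset (Fin m), 1 ≤ s.card →
    s.card ≤ n → ∀ μ, ∀ h ∈ 𝓗.G, r s μ h = r s μ 1 := by
  classical
  induction n with
  | zero => intro s h1 h2; omega
  | succ n ih =>
    intro s h1 h2 μ h hh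
    rcases Nat.lt_or_ge s.card (n + 1) with h3 | h3
    · exact ih s h1 (by omega) μ h hh
    · obtain ⟨b, hb⟩ := Multiset.card_pos_iff_exists_mem.1 h1
      obtain ⟨s, rfl⟩ := Multiset.exists_cons_of_mem hb
      rw [Multiset.card_cons] at h2 h3
      -- With ω^c_0(η) = δ_{bc}, the leading sum reduces to the coefficient at `b ::ₘ s`. The
      -- equation then expresses it through shorter ones, which are constant on 𝒢 by induction.
      obtain ⟨η, hη, hηb⟩ := 𝓗.exists_apply_tangent_zero (Pi.single b 1)
      have key : ∀ k ∈ 𝓗.G, fubiniEq (coeffAt r k) η s μ = 0 := by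
        intro k hk
        obtain ⟨hc, hmc⟩ := 𝓗.isCurveIn_Z hk hη
        have := hr.fubiniEq_mcCurve hc (s := s) (μ := μ) (fun ν => by
          rw [hmc]; exact 𝓗.apply_normal_zero hη ν) fun hs => ?_
        · rwa [hmc, zero_smul, expFrm_zero, mul_one] at this
        · have : (fun t : ℂ => r s μ (k * expFrm (t • η))) = fun _ => r s μ 1 := funext fun t =>
            ih s (by omega) (by omega) μ _ (mul_mem hk (𝓗.expFrm_mem_G (𝓗.g.smul_mem t hη)))
          rw [this]
          exact hasDerivAt_const _ _
      have hcoe : ∀ t : Multiset (Fin m), t.card ≤ n → ∀ ν, coeffAt r h t ν = coeffAt r 1 t ν := by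
        intro t ht ν
        rcases Nat.lt_or_ge t.card 2 with h4 | h4
        · rw [coeffAt_of_lt h4, coeffAt_of_lt h4]
        · rw [coeffAt_of_le h4, coeffAt_of_le h4, ih t (by omega) ht ν h hh]
      have hF0 : ∀ k ν, coeffAt r k 0 ν = 0 := fun k ν => coeffAt_of_lt (by simp) ν
      have hsub := fubiniEq_sub_congr (F := coeffAt r h) (F' := coeffAt r 1) (ζ := η) (s := s) (μ := μ)
        (fun t ht ν => hcoe t ((Multiset.card_le_card ht).trans (by omega)) ν)
        (fun a ha c => by
          have := Multiset.card_erase_add_one ha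
          rw [hcoe _ (by rw [Multiset.card_cons]; omega)])
        (fun t u htu c ν => by
          have hcard := congrArg Multiset.card htu
          rw [Multiset.card_add] at hcard
          by_cases hu : u = 0
          · rw [hu, hF0, hF0, mul_zero, mul_zero]
          · have := Multiset.card_pos.2 hu
            rw [hcoe u (by omega), hcoe (c ::ₘ t) (by rw [Multiset.card_cons]; omega)])
      rw [key h hh, key 1 (one_mem _), zero_sub, zero_sub, neg_inj] at hsub
      simp only [hηb] at hsub
      rw [Finset.sum_eq_single b, Finset.sum_eq_single b] at hsub
      · rw [Pi.single_eq_same, mul_one, mul_one] at hsub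
        rwa [hr.coeffAt_eq (𝓗.mem_frameBundle_Z hh) h1, hr.coeffAt_eq (𝓗.mem_frameBundle_Z (one_mem _)) h1]
      all_goals simp +contextual

/-- The curve exp(tη) stays in 𝒢, where the coefficients are constant, and has velocity η. -/
theorem fubiniEq_eq_zero_of_mem_g (hr : IsFubiniCoeff 𝓗.Z r) {η : Mat m e} (hη : η ∈ 𝓗.g)
    (s : Multiset (Fin m)) (μ : Fin e) : fubiniEq (coeffAt r 1) η s μ = 0 := by
  obtain ⟨hc, hmc⟩ := 𝓗.isCurveIn_Z (one_mem _) hη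
  have := hr.fubiniEq_mcCurve hc (s := s) (μ := μ) (fun ν => by
    rw [hmc]; exact 𝓗.apply_normal_zero hη ν) fun hs => ?_
  · rwa [hmc, zero_smul, expFrm_zero, mul_one] at this
  · have : (fun t : ℂ => r s μ (1 * expFrm (t • η))) = fun _ => r s μ 1 := funext fun t =>
      𝓗.coeff_const hr _ s (by omega) le_rfl μ _ (mul_mem (one_mem _) (𝓗.expFrm_mem_G (𝓗.g.smul_mem t hη)))
    rw [this]
    exact hasDerivAt_const _ _

/-- The Fubini forms of `Z` are invariant under the grading element. -/
theorem isHomogeneousCoeff (hr : IsFubiniCoeff 𝓗.Z r) : 𝓗.IsHomogeneousCoeff (coeffAt r 1) := by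
  intro s μ hs
  have h2 : 2 ≤ s.card := by
    by_contra hn
    exact hs (coeffAt_of_lt (not_le.1 hn) μ)
  -- E is diagonal, and its Fubini equation collapses to (|s| - deg μ) F^μ_s = 0.
  have h := 𝓗.fubiniEq_eq_zero_of_mem_g hr (η := 𝓗.Emat) (𝓗.E : 𝓗.g).2 s μ
  rw [Emat_eq, fubiniEq] at h
  set F := coeffAt r 1
  set c := 𝓗.wt 𝓗.E
  have e1 : ∀ {i j : Idx m e}, i ≠ j →
      Matrix.diagonal (fun j => c - (𝓗.deg j : ℂ)) i j = 0 := fun hij => Matrix.diagonal_apply_ne _ hij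
  have e2 : (s.map fun a => if s.erase a = 0 then
      Matrix.diagonal (fun j => c - (𝓗.deg j : ℂ)) (iN μ) (iT a) else 0).sum = 0 := by
    refine Multiset.sum_eq_zero fun x hx => ?_
    obtain ⟨a, -, rfl⟩ := Multiset.mem_map.1 hx
    rw [e1 (by simp), ite_self]
  have e3 : (s.map fun a => ((s.card : ℂ) - 2) * F (s.erase a) μ *
        Matrix.diagonal (fun j => c - (𝓗.deg j : ℂ)) i0 (iT a)
      + ∑ b, F (b ::ₘ s.erase a) μ * Matrix.diagonal (fun j => c - (𝓗.deg j : ℂ)) (iT b) (iT a)) =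
      s.map fun a => F s μ * (c - 𝓗.deg (iT a)) := by
    refine Multiset.map_congr rfl fun a ha => ?_
    rw [e1 (by simp), mul_zero, zero_add, Finset.sum_eq_single a, Matrix.diagonal_apply_eq,
      Multiset.cons_erase ha]
    · intro b _ hb
      rw [e1 (by simpa using hb), mul_zero]
    · simp
  have e4 : (s.map fun a => F s μ * (c - 𝓗.deg (iT a))).sum = F s μ * (s.card * c - 𝓗.symDeg s) := by
    rw [Multiset.sum_map_mul_left, Multiset.sum_map_sub, Multiset.map_const', Multiset.sum_replicate,
      nsmul_eq_mul, symDeg]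
    congr 2
    rw [Nat.cast_multiset_sum, Multiset.map_map]
    rfl
  rw [e2, e3, e4, e1 (by simp), ite_self, Matrix.diagonal_apply_eq, 𝓗.deg_zero,
    Finset.sum_eq_single μ, Matrix.diagonal_apply_eq] at h
  · have f1 : ∀ b : Fin m, Matrix.diagonal (fun j => c - (𝓗.deg j : ℂ)) (iT b) i0 = 0 := fun b =>
      e1 (by simp)
    have f2 : ∀ (b : Fin m) (ν : Fin e), Matrix.diagonal (fun j => c - (𝓗.deg j : ℂ)) (iT b) (iN ν) = 0 :=
      fun b ν => e1 (by simp)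
    have f3 : ∀ ν : Fin e, Matrix.diagonal (fun j => c - (𝓗.deg j : ℂ)) i0 (iN ν) = 0 := fun ν =>
      e1 (by simp)
    simp only [f1, f2, f3, mul_zero, Finset.sum_const_zero, add_zero, Multiset.map_const', Multiset.sum_replicate,
      smul_zero, Nat.cast_zero, sub_zero, zero_add] at h
    have h3 : F s μ * ((𝓗.symDeg s : ℂ) - 𝓗.deg (iN μ)) = 0 := by linear_combination h
    rcases mul_eq_zero.1 h3 with h4 | h4
    · exact absurd h4 hs
    · exact_mod_cast sub_eq_zero.1 h4
  · intro ν _ hν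
    rw [e1 (by simpa using hν.symm), mul_zero]
  · simp

end HomogeneousEmbedding
end FubiniRigidity

namespace FubiniRigidity
open Filter

/-! ### Annihilators -/

section Annihilator
variable {V W U : Type*} [AddCommGroup V] [Module ℂ V] [AddCommGroup W] [Module ℂ W] [AddCommGroup U] [Module ℂ U]

/-- A functional that vanishes on f⁻¹(K) factors through the image of V in W / K and extends to W /
K. -/
theorem map_dualMap_dualAnnihilator (f : V →ₗ[ℂ] W) (K : Submodule ℂ W) :
    K.dualAnnihilator.map f.dualMap = (K.comap f).dualAnnihilator := by
  refine le_antisymm ?_ fun φ hφ => ?_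
  · rintro _ ⟨φ, hφ, rfl⟩
    rw [Submodule.mem_dualAnnihilator]
    exact fun v hv => (Submodule.mem_dualAnnihilator φ).1 hφ _ hv
  · have hker : (K.mkQ ∘ₗ f).ker = K.comap f := by rw [LinearMap.ker_comp, Submodule.ker_mkQ]
    rw [← hker, ← LinearMap.range_dualMap_eq_dualAnnihilator_ker] at hφ
    obtain ⟨θ, rfl⟩ := hφ
    refine ⟨K.mkQ.dualMap θ, (Submodule.mem_dualAnnihilator _).2 fun w hw => ?_, rfl⟩
    change θ (K.mkQ w) = 0
    rw [Submodule.mkQ_apply, (Submodule.Quotient.mk_eq_zero K).2 hw, map_zero]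

/-- Meant for `f` the Maurer–Cartan form, `A` and `B` the annihilators of I and J, and `ev` the
forms ω^α_0: both A / B and the quotient of the tangent space by f⁻¹(B) are identified with `U`. -/
theorem finrank_dualAnnihilator_add [FiniteDimensional ℂ V] [FiniteDimensional ℂ W] {f : V →ₗ[ℂ] W}
    {A B : Submodule ℂ W} {ev : W →ₗ[ℂ] U} (hB : A ⊓ ev.ker = B) (hA : A.map ev = ⊤)
    (hf : Function.Surjective (ev ∘ₗ f)) (hker : (ev ∘ₗ f).ker = B.comap f) :
    Module.finrank ℂ A.dualAnnihilator + Module.finrank ℂ (B.dualAnnihilator.map f.dualMap) =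
      Module.finrank ℂ B.dualAnnihilator := by
  rw [map_dualMap_dualAnnihilator, ← hker]
  have h1 := Subspace.finrank_add_finrank_dualAnnihilator_eq A
  have h2 := Subspace.finrank_add_finrank_dualAnnihilator_eq B
  have h3 := Subspace.finrank_add_finrank_dualAnnihilator_eq (ev ∘ₗ f).ker
  have h4 := LinearMap.finrank_range_add_finrank_ker (ev ∘ₗ f)
  rw [LinearMap.range_eq_top.2 hf, finrank_top] at h4
  have h5 := LinearMap.finrank_range_add_finrank_ker (ev.domRestrict A)
  have h6 : (ev.domRestrict A).range = ⊤ := by rw [LinearMap.range_domRestrict, hA]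
  have h7 : (ev.domRestrict A).ker = (A ⊓ ev.ker).comap A.subtype := by
    ext x
    simp
  rw [h6, finrank_top, h7, (Submodule.comapSubtypeEquivOfLe inf_le_left).finrank_eq, hB] at h5
  omega

end Annihilator

/-! ### Tangent vectors as velocities of curves of frames -/

section Curves
variable {m e : ℕ} {N : ℕ} {M : Type} [TopologicalSpace M] [ChartedSpace (EuclideanSpace ℂ (Fin N)) M]
  [IsManifold 𝓘(ℂ, EuclideanSpace ℂ (Fin N)) ω M] {g : M → Frm m e}

/-- Tangent vectors of a manifold are velocities of holomorphic curves. -/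
theorem exists_curve_of_tangent (x : M) (ξ : TangentSpace 𝓘(ℂ, EuclideanSpace ℂ (Fin N)) x) :
    ∃ γ : ℂ → M, γ 0 = x ∧ ∀ f : M → ℂ,
      MDifferentiable 𝓘(ℂ, EuclideanSpace ℂ (Fin N)) 𝓘(ℂ, ℂ) f →
      AnalyticAt ℂ (fun t => f (γ t)) 0 ∧ HasDerivAt (fun t => f (γ t))
        (mfderiv 𝓘(ℂ, EuclideanSpace ℂ (Fin N)) 𝓘(ℂ, ℂ) f x ξ) 0 := by
  have : IsManifold 𝓘(ℂ, EuclideanSpace ℂ (Fin N)) 1 M := IsManifold.of_le (n := ω) le_top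
  let φ := extChartAt 𝓘(ℂ, EuclideanSpace ℂ (Fin N)) x
  let ξ' : EuclideanSpace ℂ (Fin N) := ξ
  -- A straight line in a chart; outside the target of the chart the curve takes irrelevant values.
  let ℓ : ℂ → EuclideanSpace ℂ (Fin N) := fun t => φ x + t • ξ'
  have hℓ : ∀ t, HasDerivAt ℓ ξ' t := fun t => by
    have := ((hasDerivAt_id t).smul_const ξ').const_add (φ x)
    rwa [one_smul] at this
  have hℓ0 : ℓ 0 = φ x := by simp [ℓ]
  refine ⟨fun t => φ.symm (ℓ t), ?_, fun f hf => ?_⟩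
  · exact (congrArg φ.symm hℓ0).trans (extChartAt_to_inv x)
  · have hdiff : ∀ z ∈ φ.target, DifferentiableAt ℂ (f ∘ φ.symm) z := by
      intro z hz
      have h1 : MDifferentiableAt 𝓘(ℂ, EuclideanSpace ℂ (Fin N)) 𝓘(ℂ, EuclideanSpace ℂ (Fin N)) φ.symm z :=
        (mdifferentiableOn_extChartAt_symm (I := 𝓘(ℂ, EuclideanSpace ℂ (Fin N))) (x := x) z hz).mdifferentiableAt
          ((isOpen_extChartAt_target x).mem_nhds hz)
      exact mdifferentiableAt_iff_differentiableAt.1 ((hf _).comp z h1)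
    have hopen : IsOpen (ℓ ⁻¹' φ.target) :=
      (isOpen_extChartAt_target x).preimage (continuous_iff_continuousAt.2 fun t => (hℓ t).continuousAt)
    have h0 : (0 : ℂ) ∈ ℓ ⁻¹' φ.target := by
      rw [Set.mem_preimage, hℓ0]; exact mem_extChartAt_target x
    have hon : DifferentiableOn ℂ (fun t => f (φ.symm (ℓ t))) (ℓ ⁻¹' φ.target) := fun t ht =>
      ((hdiff _ ht).comp t (hℓ t).differentiableAt).differentiableWithinAt
    refine ⟨hon.analyticAt (hopen.mem_nhds h0), ?_⟩
    have h1 : mfderiv 𝓘(ℂ, EuclideanSpace ℂ (Fin N)) 𝓘(ℂ, ℂ) f x = fderiv ℂ (f ∘ φ.symm) (φ x) := by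
      rw [(hf x).mfderiv, ModelWithCorners.range_eq_univ, fderivWithin_univ]
      rfl
    rw [h1]
    have h2 : HasFDerivAt (f ∘ φ.symm) (fderiv ℂ (f ∘ φ.symm) (φ x)) (ℓ 0) := by
      rw [hℓ0]
      exact (hdiff _ (mem_extChartAt_target x)).hasFDerivAt
    exact h2.comp_hasDerivAt 0 (hℓ 0)

theorem exists_mcCurve_eq {X : Set (ℙ ℂ (Vec m e))} (hg : IsHolomorphicFrame N g)
    (hX : ∀ x, g x ∈ frameBundle X) (x : M) (ξ : TangentSpace 𝓘(ℂ, EuclideanSpace ℂ (Fin N)) x) :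
    ∃ γ : ℂ → M, γ 0 = x ∧ IsCurveIn X (fun t => g (γ t)) ∧
      mcCurve (fun t => g (γ t)) = maurerCartan N g x ξ ∧
      HasMatDerivAt (fun t => (g (γ t) : Mat m e)) (frameDeriv N g x ξ) 0 := by
  obtain ⟨γ, h0, hγ⟩ := exists_curve_of_tangent x ξ
  have hd : HasMatDerivAt (fun t => (g (γ t) : Mat m e)) (frameDeriv N g x ξ) 0 := fun i j =>
    (hγ _ (hg i j)).2
  refine ⟨γ, h0, ⟨fun i j => (hγ _ (hg i j)).1, Eventually.of_forall fun t => hX _⟩, ?_, hd⟩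
  have hv : velocity (fun t => g (γ t)) = frameDeriv N g x ξ := by
    ext i j
    exact (hd i j).deriv
  rw [mcCurve, hv, h0]
  rfl

/-- The forms `ω^μ_0` vanish on first order adapted frames. -/
theorem maurerCartan_normal_zero {X : Set (ℙ ℂ (Vec m e))} (hg : IsHolomorphicFrame N g)
    (hX : ∀ x, g x ∈ frameBundle X) (x : M) (ξ : TangentSpace 𝓘(ℂ, EuclideanSpace ℂ (Fin N)) x)
    (μ : Fin e) : maurerCartan N g x ξ (iN μ) i0 = 0 := by
  obtain ⟨γ, h0, -, -, hd⟩ := exists_mcCurve_eq hg hX x ξ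
  have hT := HomogeneousEmbedding.mem_frameBundle_iff.1 (hX x)
  have hγ : HasDerivAt (fun t => g (γ t) • (refVec i0 : Vec m e))
      ((frameDeriv N g x ξ).mulVec (refVec i0)) 0 := by
    refine hasDerivAt_pi.2 fun i => ?_
    simp only [smul_refVec_apply, HomogeneousEmbedding.mulVec_refVec]
    exact hd i i0
  have h1 := hT.deriv_mem hγ (by rw [h0]) (Eventually.of_forall fun t =>
    (HomogeneousEmbedding.mem_frameBundle_iff.1 (hX (γ t))).mem)
  obtain ⟨y, hy, hy'⟩ := h1
  have h2 : (maurerCartan N g x ξ).mulVec (refVec i0) = y := by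
    have h3 : maurerCartan N g x ξ = ((g x)⁻¹ : Frm m e).val * frameDeriv N g x ξ := rfl
    rw [h3, ← Matrix.mulVec_mulVec, ← hy', mulVecLin_apply_eq_smul]
    exact inv_smul_smul (g x) y
  rw [← HomogeneousEmbedding.mulVec_refVec (maurerCartan N g x ξ), h2]
  exact hy μ

end Curves
end FubiniRigidity

namespace FubiniRigidity
namespace HomogeneousEmbedding
open Filter
variable {m e : ℕ} (𝓗 : HomogeneousEmbedding m e)

/-! ### Agreement implies integrality -/

section Agreement
variable {N : ℕ} {M : Type} [TopologicalSpace M] [ChartedSpace (EuclideanSpace ℂ (Fin N)) M]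

/-- A manifold of frames of `X`, transverse to the fibres, on which the Fubini forms agree with those
of `Z` to graded order `d`. -/
structure IsAgreeing (N : ℕ) {M : Type} [TopologicalSpace M] [ChartedSpace (EuclideanSpace ℂ (Fin N)) M]
    (X : Set (ℙ ℂ (Vec m e))) (d : ℤ) (g : M → Frm m e) : Prop where
  immersed : IsImmersedFrame N g
  mem_frameBundle : ∀ x, g x ∈ frameBundle X
  surjective : ∀ x, Function.Surjective fun ξ => fun α : Fin m => maurerCartan N g x ξ (iT α) i0
  agrees : ∃ rX rZ : Multiset (Fin m) → Fin e → Frm m e → ℂ, IsFubiniCoeff X rX ∧ IsFubiniCoeff 𝓗.Z rZ ∧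
    ∀ s : Multiset (Fin m), 2 ≤ s.card → (𝓗.symDeg s : ℤ) ≤ d →
      ∀ (μ : Fin e) (x : M), rX s μ (g x) = rZ s μ 1

theorem symDeg_mono {s t : Multiset (Fin m)} (h : s ≤ t) : 𝓗.symDeg s ≤ 𝓗.symDeg t := by
  obtain ⟨u, rfl⟩ := Multiset.le_iff_exists_add.1 h
  rw [symDeg_add]
  omega

theorem apply_eq_zero_of_mem_scalars {ζ : Mat m e} (h : ζ ∈ scalars m e) (b : Fin m) : ζ (iT b) i0 = 0 := by
  obtain ⟨c, rfl⟩ := Submodule.mem_span_singleton.1 h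
  rw [Matrix.smul_apply, Matrix.one_apply_ne (by simp), smul_zero]

/-- Both 𝔤 and 𝔤^⊥ are stable under ad E, so the two components of a matrix of degrees > p may be
truncated to these degrees. -/
theorem mem_of_inf_glSupp {gperp : Submodule ℂ (Mat m e)} (hperp : 𝓗.IsModuleComplement gperp)
    {p : ℤ} {x : Mat m e} (hx : x ∈ 𝓗.glSupp {d | p < d}) : x ∈ 𝓗.g.toSubmodule ⊔ 𝓗.perpGT gperp p := by
  have : x ∈ 𝓗.g.toSubmodule ⊔ gperp := by rw [hperp.1.sup_eq_top]; trivial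
  obtain ⟨a, ha, b, hb, hab⟩ := Submodule.mem_sup.1 this
  have hE : ∀ y ∈ gperp, ⁅𝓗.Emat, y⁆ ∈ gperp := fun y hy => hperp.2 _ (𝓗.E : 𝓗.g).2 y hy
  rw [← 𝓗.trunc_eq_self hx, ← hab, trunc_add]
  exact Submodule.add_mem_sup (𝓗.trunc_mem (fun _ => 𝓗.lie_Emat_mem_g) _ ha)
    (𝓗.inf_glSupp_le hE (p < ·) ⟨𝓗.trunc_mem hE _ hb, 𝓗.trunc_mem_glSupp _ _⟩)

/-- The hypothesis means p ≥ -1, so that degrees > p are nonnegative. -/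
theorem perpGT_le_glSupp (gperp : Submodule ℂ (Mat m e)) {p : ℤ} (hp : 0 < p + 2) :
    𝓗.perpGT gperp p ≤ 𝓗.glSupp (Set.Ici 0) := by
  refine iSup_le fun d => inf_le_right.trans ?_
  rw [glDeg_eq]
  refine 𝓗.glSupp_mono (Set.singleton_subset_iff.2 ?_)
  have := d.2
  rw [Set.mem_Ici]
  omega

theorem sup_le_glSupp (gperp : Submodule ℂ (Mat m e)) {p : ℤ} (hp : 0 < p + 2) :
    𝓗.gNonneg ⊔ 𝓗.perpGT gperp p ⊔ scalars m e ≤ 𝓗.glSupp (Set.Ici 0) :=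
  sup_le (sup_le 𝓗.gNonneg_le_glSupp (𝓗.perpGT_le_glSupp gperp hp))
    (𝓗.scalars_le_glSupp.trans (𝓗.glSupp_mono (Set.singleton_subset_iff.2 Set.self_mem_Ici)))

/-- The forms `ω^α_0`. -/
def tangentialPart (m e : ℕ) : Mat m e →ₗ[ℂ] (Fin m → ℂ) :=
  LinearMap.pi fun b => Matrix.entryLinearMap ℂ ℂ (iT b) i0

/-- The entries (α, 0) have negative degree, so 𝔤^⊥_{>p} and the scalars do not contribute to them;
inside 𝔤 their vanishing characterizes 𝔤_{≥0}. -/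
theorem inf_ker_tangentialPart (gperp : Submodule ℂ (Mat m e)) {p : ℤ} (hp : 0 < p + 2) :
    (𝓗.g.toSubmodule ⊔ 𝓗.perpGT gperp p ⊔ scalars m e) ⊓ (tangentialPart m e).ker =
      𝓗.gNonneg ⊔ 𝓗.perpGT gperp p ⊔ scalars m e := by
  refine le_antisymm ?_ (le_inf (sup_le_sup_right (sup_le_sup_right 𝓗.gNonneg_le_g _) _) fun x hx => ?_)
  · rintro x ⟨hx, h0⟩
    obtain ⟨y, hy, s, hs, rfl⟩ := Submodule.mem_sup.1 hx
    obtain ⟨a, ha, b, hb, rfl⟩ := Submodule.mem_sup.1 hy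
    refine Submodule.add_mem_sup (Submodule.add_mem_sup ((𝓗.mem_gNonneg_iff ha).2 fun c => ?_) hb) hs
    have h1 : (a + b + s) (iT c) i0 = 0 := congrFun h0 c
    rwa [Matrix.add_apply, Matrix.add_apply, apply_eq_zero_of_mem_scalars hs,
      𝓗.apply_tangent_zero_of_mem_glSupp (𝓗.perpGT_le_glSupp gperp hp hb), add_zero, add_zero] at h1
  · exact funext fun b => 𝓗.apply_tangent_zero_of_mem_glSupp (𝓗.sup_le_glSupp gperp hp hx) b

variable {𝓗} {X : Set (ℙ ℂ (Vec m e))} {g : M → Frm m e} {p : ℤ}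

theorem _root_.FubiniRigidity.IsAgreementBundle.isAgreeing {d : ℤ} (hg : IsAgreementBundle N 𝓗 X d g) :
    𝓗.IsAgreeing N X d g :=
  ⟨hg.1.1, hg.1.2.2.1, hg.1.2.2.2.2, hg.2⟩

variable [IsManifold 𝓘(ℂ, EuclideanSpace ℂ (Fin N)) ω M]

/-- The heart of the argument. The truncation solves all Fubini equations of Z: in degrees > c
trivially, and in degrees ≤ c because there the equations of X and Z coincide, the lower bound on
the degrees of ζ keeping every relevant coefficient within the range of agreement. -/
theorem IsAgreeing.trunc_mem (hg : 𝓗.IsAgreeing N X (𝓗.q + p + 1) g) (hmax : 𝓗.IsMaximal) {x : M}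
    {ξ : TangentSpace 𝓘(ℂ, EuclideanSpace ℂ (Fin N)) x} {c : ℤ} (hc : c ≤ p)
    (hξ : maurerCartan N g x ξ ∈ 𝓗.glSupp {d | c - p - 1 ≤ d}) :
    𝓗.trunc {d | d ≤ c} (maurerCartan N g x ξ) ∈ 𝓗.g.toSubmodule ⊔ scalars m e := by
  obtain ⟨rX, rZ, hrX, hrZ, hr⟩ := hg.agrees
  set ζ := maurerCartan N g x ξ with hζ
  set F := coeffAt rZ 1 with hF
  have hF0 : ∀ t ν, t.card < 2 → F t ν = 0 := fun t ν ht => coeffAt_of_lt ht ν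
  have hhom : 𝓗.IsHomogeneousCoeff F := 𝓗.isHomogeneousCoeff hrZ
  obtain ⟨γ, h0, hγ, hmc, -⟩ := exists_mcCurve_eq hg.immersed.1 hg.mem_frameBundle x ξ
  have hXF : ∀ t, (𝓗.symDeg t : ℤ) ≤ 𝓗.q + p + 1 → ∀ ν, coeffAt rX (g x) t ν = F t ν := by
    intro t ht ν
    rcases Nat.lt_or_ge t.card 2 with h | h
    · rw [coeffAt_of_lt h, hF0 t ν h]
    · rw [coeffAt_of_le h, hF, coeffAt_of_le h, hr t h ht]
  refine 𝓗.mem_g_sup_scalars hmax (F := F) (fun μ => hF0 _ _ (by simp)) (fun a μ => hF0 _ _ (by simp))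
    (fun η hη s μ => 𝓗.fubiniEq_eq_zero_of_mem_g hrZ hη s μ) fun s μ => ?_
  -- The equation (s, μ) lives in degree |s| - deg μ. When this is ≤ c, then |s| ≤ c + 𝗊 ≤ 𝗊 + p.
  rcases lt_or_ge c (𝓗.symDeg s - 𝓗.deg (iN μ) : ℤ) with hD | hD
  · rw [← fubiniEq_zero F s μ]
    refine 𝓗.fubiniEq_congr hhom fun i j hij => 𝓗.trunc_apply_of_notMem ?_ ζ
    rw [hij, Set.mem_ofPred_eq]
    omega
  · rw [𝓗.fubiniEq_congr hhom (ξ := ζ) fun i j hij => 𝓗.trunc_apply_of_mem (by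
      rw [hij, Set.mem_ofPred_eq]; omega) ζ]
    have hq := 𝓗.deg_le_q (iN μ)
    have hle : ∀ t ≤ s, ∀ ν, coeffAt rX (g x) t ν = F t ν := fun t ht ν =>
      hXF t (by have := 𝓗.symDeg_mono ht; omega) ν
    have hX0 : fubiniEq (coeffAt rX (g x)) ζ s μ = 0 := by
      have := hrX.fubiniEq_mcCurve hγ (s := s) (μ := μ)
        (fun ν => by rw [hmc]; exact maurerCartan_normal_zero hg.immersed.1 hg.mem_frameBundle x ξ ν)
        fun hs => by
          have : (fun t => rX s μ (g (γ t))) = fun _ => rZ s μ 1 := funext fun t =>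
            hr s hs (by omega) μ (γ t)
          rw [this]
          exact hasDerivAt_const _ _
      rwa [hmc, h0] at this
    have hmul : ∀ {a b : ℂ} {i j : Idx m e}, (ζ i j ≠ 0 → a = b) → a * ζ i j = b * ζ i j := by
      intro a b i j hab
      by_cases hz : ζ i j = 0
      · rw [hz, mul_zero, mul_zero]
      · rw [hab hz]
    have hdeg : ∀ {i j : Idx m e}, ζ i j ≠ 0 → c - p - 1 ≤ (𝓗.deg j : ℤ) - 𝓗.deg i := fun hz => hξ _ _ hz
    -- A nonzero entry (b, j) gives deg b - deg j ≤ p + 1 - c. Replacing indices of total degree deg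
    -- j in `s` by b therefore leads to degree at most (c + 𝗊) + (p + 1 - c) = 𝗊 + p + 1. For j = ν
    -- the part `u` removed has degree deg ν, by homogeneity of F.
    have hsub := fubiniEq_sub_congr (F := coeffAt rX (g x)) (F' := F) (ζ := ζ) (μ := μ) hle
      (fun a ha b => hmul fun hz => hXF _ (by
        have h1 := hdeg hz
        have h2 := 𝓗.symDeg_erase ha
        rw [symDeg_cons]
        omega) μ)
      (fun t u htu b ν => hmul fun hz => by
        rw [hle u (htu ▸ Multiset.le_add_left u t)]
        by_cases hu : F u ν = 0
        · rw [hu, mul_zero, mul_zero]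
        · have h1 := hdeg hz
          have h2 := hhom u ν hu
          have h3 := 𝓗.symDeg_add t u
          rw [htu] at h3
          rw [hXF (b ::ₘ t) (by rw [symDeg_cons]; omega)])
    have hsum : ∑ b, coeffAt rX (g x) (b ::ₘ s) μ * ζ (iT b) i0 = ∑ b, F (b ::ₘ s) μ * ζ (iT b) i0 := by
      refine Finset.sum_congr rfl fun b _ => hmul fun hz => hXF _ ?_ μ
      have h1 := hdeg hz
      rw [𝓗.deg_zero] at h1
      rw [symDeg_cons]
      omega
    rw [hsum, hX0] at hsub
    exact (sub_left_inj.1 hsub).symm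

/-- The case c = p of the truncation statement, where the lower bound on degrees is -1; the
remaining degrees > p are absorbed by 𝔤 and 𝔤^⊥_{>p}. -/
theorem IsAgreeing.mem_of_mem_glSupp (hg : 𝓗.IsAgreeing N X (𝓗.q + p + 1) g) (hmax : 𝓗.IsMaximal)
    {gperp : Submodule ℂ (Mat m e)} (hperp : 𝓗.IsModuleComplement gperp) {x : M}
    {ξ : TangentSpace 𝓘(ℂ, EuclideanSpace ℂ (Fin N)) x}
    (hξ : maurerCartan N g x ξ ∈ 𝓗.glSupp (Set.Ici 0)) :
    maurerCartan N g x ξ ∈ 𝓗.g.toSubmodule ⊔ 𝓗.perpGT gperp p ⊔ scalars m e := by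
  have h1 := hg.trunc_mem hmax (c := p) (ξ := ξ) le_rfl (𝓗.glSupp_mono (fun d (hd : 0 ≤ d) => by
    rw [Set.mem_ofPred_eq]; omega) hξ)
  have h2 := 𝓗.mem_of_inf_glSupp hperp (p := p) (x := 𝓗.trunc {d | d ≤ p}ᶜ (maurerCartan N g x ξ))
    (𝓗.glSupp_mono (fun d (hd : ¬ d ≤ p) => not_le.1 hd) (𝓗.trunc_mem_glSupp _ _))
  rw [← 𝓗.trunc_add_trunc_compl {d | d ≤ p} (maurerCartan N g x ξ)]
  exact Submodule.add_mem _ ((sup_le_sup_right le_sup_left _ : 𝓗.g.toSubmodule ⊔ scalars m e ≤ _) h1) (Submodule.mem_sup_left h2)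

/-- All degrees are ≥ -𝗊, and this bound is raised by one repeatedly: the bottom component belongs
to a truncation in 𝔤 + ℂ Id with vanishing tangential part, hence in 𝔤_{≥0} + ℂ Id, so it vanishes
while its degree is negative. -/
theorem IsAgreeing.mem_glSupp_of_tangentialPart (hg : 𝓗.IsAgreeing N X (𝓗.q + p + 1) g)
    (hmax : 𝓗.IsMaximal) (hp : 0 < p + 2) {x : M} {ξ : TangentSpace 𝓘(ℂ, EuclideanSpace ℂ (Fin N)) x}
    (hξ : ∀ b, maurerCartan N g x ξ (iT b) i0 = 0) : maurerCartan N g x ξ ∈ 𝓗.glSupp (Set.Ici 0) := by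
  set ζ := maurerCartan N g x ξ with hζ
  have hq : ∀ i j, -𝓗.q ≤ 𝓗.entryDeg i j := by
    intro i j
    have := 𝓗.deg_le_q i
    rw [entryDeg]
    omega
  have key : ∀ n : ℕ, ζ ∈ 𝓗.glSupp {d | min 0 (-𝓗.q + n) ≤ d} := by
    intro n
    induction n with
    | zero =>
      intro i j _
      have := hq i j
      rw [Set.mem_ofPred_eq]
      omega
    | succ n ih =>
      rcases le_or_gt 0 (-𝓗.q + n) with hn | hn
      · refine 𝓗.glSupp_mono (fun d hd => ?_) ih
        rw [Set.mem_ofPred_eq] at hd ⊢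
        push_cast
        omega
      · rw [min_eq_right hn.le] at ih
        -- This c makes c - p - 1 the current bound -𝗊 + n. It satisfies c ≤ p as the bound is
        -- negative, and p + 1 ≥ 0 ensures that the truncation retains the bottom degree.
        have h1 := hg.trunc_mem hmax (c := -𝓗.q + n + p + 1) (ξ := ξ) (by omega) (by
          convert ih using 4
          omega)
        obtain ⟨y, hy, s, hs, hys⟩ := Submodule.mem_sup.1 h1
        have hy' : y ∈ 𝓗.gNonneg := by
          refine (𝓗.mem_gNonneg_iff hy).2 fun b => ?_
          have h2 := congrFun (congrFun hys (iT b)) i0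
          rw [Matrix.add_apply, apply_eq_zero_of_mem_scalars hs, add_zero] at h2
          rw [h2]
          by_cases h3 : 𝓗.entryDeg (iT b) i0 ∈ {d | d ≤ -𝓗.q + n + p + 1}
          · rw [𝓗.trunc_apply_of_mem h3]
            exact hξ b
          · exact 𝓗.trunc_apply_of_notMem h3 _
        have h3 : 𝓗.trunc {d | d ≤ -𝓗.q + n + p + 1} ζ ∈ 𝓗.glSupp (Set.Ici 0) := by
          rw [← hys]
          exact Submodule.add_mem _ (𝓗.gNonneg_le_glSupp hy')
            (𝓗.scalars_le_glSupp.trans (𝓗.glSupp_mono (Set.singleton_subset_iff.2 Set.self_mem_Ici)) hs)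
        intro i j hij
        have h4 : -𝓗.q + n ≤ 𝓗.entryDeg i j := ih i j hij
        rw [Set.mem_ofPred_eq]
        by_contra hlt
        push_cast at hlt
        have h5 : 𝓗.entryDeg i j = -𝓗.q + n := by omega
        have h6 := h3 i j (by
          rw [𝓗.trunc_apply_of_mem (by rw [Set.mem_ofPred_eq]; omega)]
          exact hij)
        rw [Set.mem_Ici] at h6
        omega
  refine 𝓗.glSupp_mono (fun d hd => ?_) (key 𝓗.q.toNat)
  rw [Set.mem_ofPred_eq] at hd
  rw [Set.mem_Ici]
  have := Int.self_le_toNat 𝓗.q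
  omega

/-- Manifolds of frames with the Fubini forms of `Z` are integral manifolds. -/
theorem IsAgreeing.isIntegral (hg : 𝓗.IsAgreeing N X (𝓗.q + p + 1) g) (hmax : 𝓗.IsMaximal)
    {gperp : Submodule ℂ (Mat m e)} (hperp : 𝓗.IsModuleComplement gperp) (hp : 0 < p + 2) :
    𝓗.IsIntegral gperp p (p + 2) N g := by
  set A := 𝓗.g.toSubmodule ⊔ 𝓗.perpGT gperp p ⊔ scalars m e with hA
  set B := 𝓗.gNonneg ⊔ 𝓗.perpGT gperp p ⊔ scalars m e with hB
  refine ⟨hg.immersed, fun x c => ?_, fun x => ?_⟩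
  · have h1 : ∀ (K : Submodule ℂ (Mat m e)) (c : ℤ), (K.dualAnnihilator ⊓ 𝓗.cotFilt c).map
        (maurerCartan N g x).dualMap =
        ((K ⊔ 𝓗.glSupp {d | c < d}).comap (maurerCartan N g x)).dualAnnihilator := by
      intro K c
      rw [cotFilt, iSup_glDeg, ← Submodule.dualAnnihilator_sup_eq, map_dualMap_dualAnnihilator]
    change (A.dualAnnihilator ⊓ 𝓗.cotFilt c).map _ ≤ (B.dualAnnihilator ⊓ 𝓗.cotFilt (c - (p + 2))).map _
    rw [h1, h1]
    refine Submodule.dualAnnihilator_anti fun ξ hξ => ?_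
    rw [Submodule.mem_comap] at hξ ⊢
    have hB0 : B ≤ 𝓗.glSupp (Set.Ici 0) := 𝓗.sup_le_glSupp gperp hp
    -- Degrees > c - (p + 2) are those ≥ c - p - 1. For c ≤ p this bound is negative and the
    -- truncation statement applies; for c > p all degrees are already nonnegative.
    rcases le_or_gt c p with hc | hc
    · have h2 : maurerCartan N g x ξ ∈ 𝓗.glSupp {d | c - p - 1 ≤ d} := by
        refine (sup_le (hB0.trans (𝓗.glSupp_mono fun d hd => ?_)) (𝓗.glSupp_mono fun d hd => ?_)) hξ
        · rw [Set.mem_Ici] at hd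
          rw [Set.mem_ofPred_eq]; omega
        · rw [Set.mem_ofPred_eq] at hd ⊢; omega
      have h3 := hg.trunc_mem hmax hc h2
      rw [← 𝓗.trunc_add_trunc_compl {d | d ≤ c} (maurerCartan N g x ξ)]
      exact Submodule.add_mem_sup ((sup_le_sup_right le_sup_left _ : 𝓗.g.toSubmodule ⊔ scalars m e ≤ A) h3)
        (𝓗.glSupp_mono (fun d (hd : ¬ d ≤ c) => not_le.1 hd) (𝓗.trunc_mem_glSupp _ _))
    · refine Submodule.mem_sup_left (hg.mem_of_mem_glSupp hmax hperp ?_)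
      refine (sup_le hB0 (𝓗.glSupp_mono fun d hd => ?_)) hξ
      rw [Set.mem_ofPred_eq] at hd
      rw [Set.mem_Ici]; omega
  · have hAB : A ⊓ (tangentialPart m e).ker = B := 𝓗.inf_ker_tangentialPart gperp hp
    have : FiniteDimensional ℂ (TangentSpace 𝓘(ℂ, EuclideanSpace ℂ (Fin N)) x) :=
      inferInstanceAs (FiniteDimensional ℂ (EuclideanSpace ℂ (Fin N)))
    refine finrank_dualAnnihilator_add hAB ?_ (hg.surjective x) ?_
    · rw [eq_top_iff]
      intro c _
      obtain ⟨y, hy, hyc⟩ := 𝓗.exists_apply_tangent_zero c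
      exact ⟨y, Submodule.mem_sup_left (Submodule.mem_sup_left hy), funext hyc⟩
    · ext ξ
      change _ ↔ maurerCartan N g x ξ ∈ B
      rw [← hAB, LinearMap.mem_ker, Submodule.mem_inf, LinearMap.mem_ker]
      refine ⟨fun h => ⟨?_, h⟩, fun h => h.2⟩
      exact hg.mem_of_mem_glSupp hmax hperp (hg.mem_glSupp_of_tangentialPart hmax hp fun b => congrFun h b)

end Agreement
end HomogeneousEmbedding
end FubiniRigidity

namespace FubiniRigidity
open Cardinal

/-! ### Countable unions of Zariski closed sets -/

/-- A transcendental x would give uncountably many linearly independent elements (x - a)⁻¹, a ∈ ℂ.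
-/
theorem algebraMap_bijective_of_rank_le_aleph0 {K : Type} [Field K] [Algebra ℂ K]
    (h : Module.rank ℂ K ≤ ℵ₀) : Function.Bijective (algebraMap ℂ K) := by
  have : Algebra.IsAlgebraic ℂ K := by
    refine ⟨fun x => ?_⟩
    by_contra hx
    have h1 := (Transcendental.linearIndependent_sub_inv hx).cardinal_le_rank
    rw [mk_complex] at h1
    exact (aleph0_lt_continuum.trans_le (h1.trans h)).false
  have : Algebra.IsIntegral ℂ K := Algebra.isAlgebraic_iff_isIntegral.1 this
  exact IsAlgClosed.algebraMap_bijective_of_isIntegral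

/-- Countably many polynomial inequations can be solved on an affine variety. -/
theorem exists_eval_eq_zero_and_ne_zero {σ : Type} [Countable σ] (I : Ideal (MvPolynomial σ ℂ))
    (S : Submonoid (MvPolynomial σ ℂ)) [Countable S] (hIS : Disjoint (S : Set (MvPolynomial σ ℂ)) I) :
    ∃ y : σ → ℂ, (∀ f ∈ I, MvPolynomial.eval y f = 0) ∧ ∀ f ∈ S, MvPolynomial.eval y f ≠ 0 := by
  -- After inverting `S` and dividing by a maximal ideal above `I`, the residue field has countable
  -- dimension over ℂ, hence is ℂ. The images of the variables are the coordinates of the desired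
  -- point.
  let R := MvPolynomial σ ℂ
  let L := Localization S
  have hne : I.map (algebraMap R L) ≠ ⊤ := (IsLocalization.map_algebraMap_ne_top_iff_disjoint S L I).2 hIS
  obtain ⟨P, hP, hIP⟩ := Ideal.exists_le_maximal _ hne
  let K := L ⧸ P
  let _ : Field K := Ideal.Quotient.field P
  let q : R →ₐ[ℂ] K := (Ideal.Quotient.mkₐ ℂ P).comp (IsScalarTower.toAlgHom ℂ R L)
  have hrankL : Module.rank ℂ L ≤ ℵ₀ := by
    let v : (σ →₀ ℕ) × S → L := fun ds => IsLocalization.mk' L (MvPolynomial.monomial ds.1 (1 : ℂ)) ds.2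
    have hspan : Submodule.span ℂ (Set.range v) = ⊤ := by
      rw [eq_top_iff]
      rintro z -
      obtain ⟨f, s, rfl⟩ := IsLocalization.exists_mk'_eq S z
      rw [MvPolynomial.as_sum f]
      have hsum : IsLocalization.mk' L (∑ d ∈ f.support, MvPolynomial.monomial d (f.coeff d)) s =
          ∑ d ∈ f.support, f.coeff d • v (d, s) := by
        have hmk : ∀ f : R, IsLocalization.mk' L f s = algebraMap R L f * IsLocalization.mk' L 1 s :=
          fun f => IsLocalization.mk'_eq_mul_mk'_one f s
        simp only [v]
        rw [hmk, map_sum, Finset.sum_mul]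
        refine Finset.sum_congr rfl fun d _ => ?_
        have : MvPolynomial.monomial d (f.coeff d) = f.coeff d • MvPolynomial.monomial d (1 : ℂ) := by
          rw [MvPolynomial.smul_monomial, smul_eq_mul, mul_one]
        have hsm : algebraMap R L (f.coeff d • MvPolynomial.monomial d (1 : ℂ)) =
            f.coeff d • algebraMap R L (MvPolynomial.monomial d (1 : ℂ)) :=
          map_smul (IsScalarTower.toAlgHom ℂ R L) _ _
        rw [this, hsm, smul_mul_assoc, ← hmk]
      rw [hsum]
      exact Submodule.sum_mem _ fun d _ => Submodule.smul_mem _ _ (Submodule.subset_span ⟨_, rfl⟩)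
    rw [← rank_top, ← hspan]
    exact (rank_span_le _).trans (mk_le_aleph0_iff.2 (Set.countable_range v).to_subtype)
  have hrankK : Module.rank ℂ K ≤ ℵ₀ :=
    (LinearMap.rank_le_of_surjective (Ideal.Quotient.mkₐ ℂ P).toLinearMap
      (Ideal.Quotient.mkₐ_surjective ℂ P)).trans hrankL
  have hbij := algebraMap_bijective_of_rank_le_aleph0 hrankK
  choose y hy using fun i => hbij.2 (q (MvPolynomial.X i))
  have key : ∀ f, algebraMap ℂ K (MvPolynomial.eval y f) = q f := by
    intro f
    have : (Algebra.ofId ℂ K).comp (MvPolynomial.aeval y) = q := by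
      refine MvPolynomial.algHom_ext fun i => ?_
      rw [AlgHom.comp_apply, MvPolynomial.aeval_X]
      exact hy i
    rw [← this, AlgHom.comp_apply, MvPolynomial.aeval_eq_eval]
    rfl
  refine ⟨y, fun f hf => ?_, fun f hf h0 => ?_⟩
  · refine hbij.1 ?_
    rw [key, map_zero]
    exact Ideal.Quotient.eq_zero_iff_mem.2 (hIP (Ideal.mem_map_of_mem _ hf))
  · have h1 := key f
    rw [h0, map_zero] at h1
    have h2 : IsUnit (q f) := (IsLocalization.map_units L (⟨f, hf⟩ : S)).map (Ideal.Quotient.mkₐ ℂ P)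
    rw [← h1] at h2
    exact not_isUnit_zero h2

variable {m e : ℕ}

theorem eval_smul_of_isHomogeneous {f : MvPolynomial (Idx m e) ℂ} {d : ℕ} (hf : f.IsHomogeneous d)
    (c : ℂ) (y : Vec m e) : MvPolynomial.eval (c • y) f = c ^ d * MvPolynomial.eval y f := by
  rw [MvPolynomial.eval_eq', MvPolynomial.eval_eq', Finset.mul_sum]
  refine Finset.sum_congr rfl fun s hs => ?_
  have h1 : ∑ i, s i = d := by
    have := hf (MvPolynomial.mem_support_iff.1 hs)
    rwa [Finsupp.weight_apply, Finsupp.sum_fintype _ _ (by simp), ← Finset.sum_congr rfl] at this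
    intro i _
    simp
  simp only [Pi.smul_apply, smul_eq_mul, mul_pow, Finset.prod_mul_distrib]
  rw [Finset.prod_pow_eq_pow_sum, h1]
  ring

/-- The hypersurface defined by a homogeneous polynomial. -/
def hypersurface (f : MvPolynomial (Idx m e) ℂ) : Set (ℙ ℂ (Vec m e)) :=
  {x | ∀ (y : Vec m e) (hy : y ≠ 0), Projectivization.mk ℂ y hy = x → MvPolynomial.eval y f = 0}

theorem mk_mem_hypersurface {f : MvPolynomial (Idx m e) ℂ} {d : ℕ} (hf : f.IsHomogeneous d)
    {y : Vec m e} (hy : y ≠ 0) :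
    Projectivization.mk ℂ y hy ∈ hypersurface f ↔ MvPolynomial.eval y f = 0 := by
  refine ⟨fun h => h y hy rfl, fun h z hz hzy => ?_⟩
  obtain ⟨c, rfl⟩ := (Projectivization.mk_eq_mk_iff' ℂ z y hz hy).1 hzy
  rw [eval_smul_of_isHomogeneous hf, h, mul_zero]

theorem isZariskiClosed_hypersurface {f : MvPolynomial (Idx m e) ℂ} {d : ℕ} (hf : f.IsHomogeneous d) :
    IsZariskiClosed (hypersurface f) :=
  ⟨{f}, fun _ h => h ▸ ⟨d, hf⟩, fun y hy => by simp [mk_mem_hypersurface hf hy]⟩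

theorem subset_hypersurface_iff {X : Set (ℙ ℂ (Vec m e))} {f : MvPolynomial (Idx m e) ℂ} {d : ℕ}
    (hf : f.IsHomogeneous d) : X ⊆ hypersurface f ↔ ∀ y ∈ cone X, MvPolynomial.eval y f = 0 := by
  refine ⟨fun h y hy => (mk_mem_hypersurface hf hy.1).1 (h hy.2), fun h x hx => ?_⟩
  induction x using Projectivization.ind with
  | h y hy => exact (mk_mem_hypersurface hf hy).2 (h y ⟨hy, hx⟩)

/-- A projective variety contained in a countable union of closed sets is contained in one of them. -/
theorem IsProjectiveVariety.exists_subset {X : Set (ℙ ℂ (Vec m e))} (hX : IsProjectiveVariety X)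
    {ι : Type*} [Countable ι] {Y : ι → Set (ℙ ℂ (Vec m e))} (hY : ∀ i, IsZariskiClosed (Y i))
    (hXY : X ⊆ ⋃ i, Y i) : ∃ i, X ⊆ Y i := by
  by_contra! hn
  obtain ⟨⟨SX, hSX, hmemX⟩, ⟨x₀, hx₀⟩, hirr⟩ := hX
  let good : MvPolynomial (Idx m e) ℂ → Prop := fun f =>
    (∃ d, f.IsHomogeneous d) ∧ ¬ ∀ y ∈ cone X, MvPolynomial.eval y f = 0
  have hf : ∀ i, ∃ f, good f ∧ ∀ y ∈ cone (Y i), MvPolynomial.eval y f = 0 := by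
    intro i
    obtain ⟨S, hS, hmem⟩ := hY i
    obtain ⟨x, hx, hxi⟩ := Set.not_subset.1 (hn i)
    induction x using Projectivization.ind with
    | h y hy =>
      rw [hmem] at hxi
      push Not at hxi
      obtain ⟨f, hfS, hfy⟩ := hxi
      refine ⟨f, ⟨hS f hfS, fun h => hfy (h y ⟨hy, hx⟩)⟩, fun z hz => ?_⟩
      exact (hmem z hz.1).1 hz.2 f hfS
  choose f hfgood hfY using hf
  -- A coordinate not vanishing identically on X is added to the inequations, so that the solution
  -- is a nonzero vector and defines a point of ℙ V.
  obtain ⟨j, hj⟩ : ∃ j : Idx m e, good (MvPolynomial.X j) := by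
    induction x₀ using Projectivization.ind with
    | h y hy =>
      obtain ⟨j, hj⟩ := Function.ne_iff.1 hy
      refine ⟨j, ⟨1, MvPolynomial.isHomogeneous_X _ _⟩, fun h => hj ?_⟩
      have := h y ⟨hy, hx₀⟩
      rwa [MvPolynomial.eval_X] at this
  let F : Option ι → MvPolynomial (Idx m e) ℂ := fun o => o.elim (MvPolynomial.X j) f
  have hFgood : ∀ o, good (F o) := by
    rintro (_ | i)
    · exact hj
    · exact hfgood i
  let S : Submonoid (MvPolynomial (Idx m e) ℂ) := MonoidHom.mrange (FreeMonoid.lift F)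
  have hScount : Countable S := by
    have : Countable (FreeMonoid (Option ι)) := inferInstanceAs (Countable (List (Option ι)))
    exact (Set.countable_range (FreeMonoid.lift F)).to_subtype
  have hSgood : ∀ g ∈ S, good g := by
    intro g hg
    rw [show S = Submonoid.closure (Set.range F) from FreeMonoid.mrange_lift F] at hg
    induction hg using Submonoid.closure_induction with
    | mem g hg => obtain ⟨o, rfl⟩ := hg; exact hFgood o
    | one =>
      refine ⟨⟨0, MvPolynomial.isHomogeneous_one _ _⟩, fun h => ?_⟩
      induction x₀ using Projectivization.ind with
      | h y hy =>
        have := h y ⟨hy, hx₀⟩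
        rw [map_one] at this
        exact one_ne_zero this
    | mul g g' _ _ hg hg' =>
      obtain ⟨⟨d, hd⟩, h1⟩ := hg
      obtain ⟨⟨d', hd'⟩, h1'⟩ := hg'
      refine ⟨⟨d + d', hd.mul hd'⟩, fun h => ?_⟩
      -- Irreducibility shows that a product of forms not vanishing identically on X is again such a
      -- form; hence `S` is disjoint from the ideal of X.
      rcases hirr _ _ (isZariskiClosed_hypersurface hd) (isZariskiClosed_hypersurface hd') (fun x hx => by
        induction x using Projectivization.ind with
        | h y hy =>
          have := h y ⟨hy, hx⟩
          rw [map_mul, mul_eq_zero] at this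
          exact this.imp (mk_mem_hypersurface hd hy).2 (mk_mem_hypersurface hd' hy).2) with h2 | h2
      · exact h1 ((subset_hypersurface_iff hd).1 h2)
      · exact h1' ((subset_hypersurface_iff hd').1 h2)
  let I : Ideal (MvPolynomial (Idx m e) ℂ) :=
    { carrier := {g | ∀ y ∈ cone X, MvPolynomial.eval y g = 0}
      add_mem' := fun {a b} ha hb y hy => by rw [map_add, ha y hy, hb y hy, add_zero]
      zero_mem' := fun y _ => map_zero _
      smul_mem' := fun c a ha y hy => by rw [smul_eq_mul, map_mul, ha y hy, mul_zero] }
  obtain ⟨y, hyI, hyS⟩ := exists_eval_eq_zero_and_ne_zero I S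
    (Set.disjoint_left.2 fun g hg hgI => (hSgood g hg).2 hgI)
  have hFS : ∀ o, F o ∈ S := fun o => ⟨FreeMonoid.of o, FreeMonoid.lift_eval_of F o⟩
  have hy0 : y ≠ 0 := by
    rintro rfl
    exact hyS _ (hFS none) (MvPolynomial.eval_X _)
  have hyX : Projectivization.mk ℂ y hy0 ∈ X :=
    (hmemX y hy0).2 fun g hg => hyI g fun z hz => (hmemX z hz.1).1 hz.2 g hg
  obtain ⟨i, hi⟩ := Set.mem_iUnion.1 (hXY hyX)
  exact hyS _ (hFS (some i)) (hfY i y ⟨hy0, hi⟩)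

end FubiniRigidity

namespace FubiniRigidity
namespace HomogeneousEmbedding
open Filter TopologicalSpace
variable {m e : ℕ} {𝓗 : HomogeneousEmbedding m e}

/-! ### Rigidity -/

theorem IsRigid.isPointRigid {gperp : Submodule ℂ (Mat m e)} {p r : ℤ} (h : 𝓗.IsRigid gperp p r) :
    𝓗.IsPointRigid gperp p r := by
  intro N M _ _ _ _ _ _ g hg
  obtain ⟨A, hA⟩ := h N M g hg
  refine ⟨A, fun x => ?_⟩
  obtain ⟨c, k, hk, hc⟩ := hA x
  refine ⟨k, hk, ?_⟩
  rw [refPt, Projectivization.smul_mk, Projectivization.smul_mk, Projectivization.smul_mk,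
    Projectivization.mk_eq_mk_iff']
  refine ⟨c, ?_⟩
  rw [← mul_smul, smul_eq_mulVec (A * g x), hc, Matrix.smul_mulVec]
  rfl

/-! ### Restriction to open subsets, and reconstruction of the variety -/

section Components
variable {N : ℕ} {M : Type} [TopologicalSpace M] [ChartedSpace (EuclideanSpace ℂ (Fin N)) M]

theorem mfderiv_comp_subtype_val {U : Opens M} {f : M → ℂ}
    (hf : MDifferentiable 𝓘(ℂ, EuclideanSpace ℂ (Fin N)) 𝓘(ℂ, ℂ) f) (x : U) :
    MDifferentiableAt 𝓘(ℂ, EuclideanSpace ℂ (Fin N)) 𝓘(ℂ, ℂ) (fun y : U => f y) x ∧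
    (mfderiv 𝓘(ℂ, EuclideanSpace ℂ (Fin N)) 𝓘(ℂ, ℂ) (fun y : U => f y) x :
      EuclideanSpace ℂ (Fin N) →L[ℂ] ℂ) =
      mfderiv 𝓘(ℂ, EuclideanSpace ℂ (Fin N)) 𝓘(ℂ, ℂ) f (x : M) := by
  have hval : MDifferentiableAt 𝓘(ℂ, EuclideanSpace ℂ (Fin N)) 𝓘(ℂ, EuclideanSpace ℂ (Fin N))
      (Subtype.val : U → M) x := 
    (contMDiff_subtype_val (n := 1) x).mdifferentiableAt one_ne_zero
  have h1 : MDifferentiableAt 𝓘(ℂ, EuclideanSpace ℂ (Fin N)) 𝓘(ℂ, ℂ) (fun y : U => f y) x :=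
    (hf x).comp x hval
  refine ⟨h1, ?_⟩
  rw [h1.mfderiv, (hf x).mfderiv, ModelWithCorners.range_eq_univ, fderivWithin_univ, fderivWithin_univ]
  refine Filter.EventuallyEq.fderiv_eq ?_
  have := U.chartAt_subtype_val_symm_eventuallyEq (H := EuclideanSpace ℂ (Fin N)) (x := x)
  filter_upwards [this] with z hz
  exact congrArg f hz.symm

/-- Possible because `IsAgreeing` contains only conditions local on M, with nothing on the image in
X. It lets the integrality statement be applied to single connected components. -/
theorem IsAgreeing.restrict {X : Set (ℙ ℂ (Vec m e))} {d : ℤ} {g : M → Frm m e}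
    (hg : 𝓗.IsAgreeing N X d g) (U : Opens M) : 𝓗.IsAgreeing N X d (fun x : U => g x) := by
  have hd : ∀ x : U, (frameDeriv N (fun x : U => g x) x : EuclideanSpace ℂ (Fin N) →ₗ[ℂ] Mat m e) =
      frameDeriv N g (x : M) := by
    intro x
    ext ξ i j
    exact DFunLike.congr_fun (mfderiv_comp_subtype_val (hg.immersed.1 i j) x).2 ξ
  have hmc : ∀ x : U, (maurerCartan N (fun x : U => g x) x : EuclideanSpace ℂ (Fin N) →ₗ[ℂ] Mat m e) =
      maurerCartan N g (x : M) := by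
    intro x
    change LinearMap.mulLeft ℂ _ ∘ₗ (frameDeriv N (fun x : U => g x) x :
      EuclideanSpace ℂ (Fin N) →ₗ[ℂ] Mat m e) = _
    rw [hd]
    rfl
  refine ⟨⟨fun i j x => (mfderiv_comp_subtype_val (hg.immersed.1 i j) x).1, fun x => ?_⟩,
    fun x => hg.mem_frameBundle x, fun x c => ?_, ?_⟩
  · rw [hd]
    exact hg.immersed.2 x
  · obtain ⟨ξ, hξ⟩ := hg.surjective x c
    refine ⟨ξ, ?_⟩
    rw [← hξ]
    funext α
    exact congrFun (congrFun (DFunLike.congr_fun (hmc x) ξ) _) _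
  · obtain ⟨rX, rZ, h1, h2, h3⟩ := hg.agrees
    exact ⟨rX, rZ, h1, h2, fun s hs hs' μ x => h3 s hs hs' μ x⟩

end Components

theorem eval_eq_zero_of_eventually {f : MvPolynomial (Idx m e) ℂ} {w : ℂ → Vec m e}
    (hw : ∀ i, Differentiable ℂ fun t => w t i) (h0 : ∀ᶠ t in 𝓝 0, MvPolynomial.eval (w t) f = 0) (t : ℂ) :
    MvPolynomial.eval (w t) f = 0 := by
  have hd : ∀ f : MvPolynomial (Idx m e) ℂ, Differentiable ℂ fun t => MvPolynomial.eval (w t) f := by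
    intro f
    induction f using MvPolynomial.induction_on with
    | C a => simp
    | add p q hp hq => simpa only [map_add] using hp.fun_add hq
    | mul_X p i hp => simpa only [map_mul, MvPolynomial.eval_X] using hp.fun_mul (hw i)
  have h1 : AnalyticOnNhd ℂ (fun t => MvPolynomial.eval (w t) f) Set.univ := fun t _ => (hd f).analyticAt t
  exact congrFun (h1.eq_of_eventuallyEq (analyticOnNhd_const (v := (0 : ℂ))) h0) t

/-- The frame `c • v`. -/
def scaleFrm (c : ℂˣ) (v : Frm m e) : Frm m e := Units.map (algebraMap ℂ (Mat m e)).toMonoidHom c * v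

theorem scaleFrm_smul (c : ℂˣ) (v : Frm m e) (y : Vec m e) : scaleFrm c v • y = (c : ℂ) • v • y := by
  rw [scaleFrm, mul_smul, smul_eq_mulVec]
  change (algebraMap ℂ (Mat m e) c).mulVec _ = _
  rw [Algebra.algebraMap_eq_smul_one, Matrix.smul_mulVec, Matrix.one_mulVec]

theorem finrank_map_tangent (v : Frm m e) :
    Module.finrank ℂ ((tangent m e).map (Matrix.mulVecLin (v : Mat m e))) =
      Module.finrank ℂ (tangent m e) := by
  have hinj : Function.Injective (Matrix.mulVecLin (v : Mat m e)) := fun y z h => smul_left_cancel v h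
  exact (Submodule.equivMapOfInjective _ hinj _).finrank_eq.symm

theorem exists_eq_of_mem_cone_Z {y : Vec m e} (hy : y ∈ cone 𝓗.Z) :
    ∃ (c : ℂˣ) (h : Frm m e), h ∈ 𝓗.G ∧ y = (c : ℂ) • h • refVec i0 := by
  obtain ⟨hy0, h, hh, hyh⟩ := hy
  rw [refPt, Projectivization.smul_mk, Projectivization.mk_eq_mk_iff'] at hyh
  obtain ⟨c, rfl⟩ := hyh
  refine ⟨Units.mk0 c ?_, h, hh, rfl⟩
  rintro rfl
  exact hy0 (zero_smul _ _)

/-- A projective variety which is contained in a translate of `Z` and has the same dimension is equal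
to this translate. -/
theorem eq_of_subset {X : Set (ℙ ℂ (Vec m e))} (hX : IsZariskiClosed X) {v : Frm m e}
    (hv : v ∈ frameBundle X) {A : Frm m e} (hsub : X ⊆ (fun x => A • x) '' 𝓗.Z) :
    X = (fun x => A • x) '' 𝓗.Z := by
  refine hsub.antisymm ?_
  rw [mem_frameBundle_iff] at hv
  set Z' := (fun x => A • x) '' 𝓗.Z with hZ'
  set y := v • (refVec i0 : Vec m e) with hy
  have hcone : ∀ z, z ∈ cone X → z ∈ cone Z' := fun z hz => ⟨hz.1, hsub hz.2⟩
  obtain ⟨c, h, hh, hch⟩ := exists_eq_of_mem_cone_Z ((mem_cone_smul_image A).1 (hcone y hv.mem))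
  have hyA : y = scaleFrm c (A * h) • refVec i0 := by
    rw [scaleFrm_smul, mul_smul, ← smul_inv_smul A y, hch]
    exact smul_comm A (c : ℂ) (h • refVec i0)
  have hT : HasTangentSpace (cone Z') y
      ((tangent m e).map (Matrix.mulVecLin (scaleFrm c (A * h) : Mat m e))) := by
    rw [hyA]
    refine 𝓗.hasTangentSpace_cone_Z_refVec.1.smul _ fun z => ?_
    rw [mem_cone_smul_image, ← 𝓗.smul_mem_cone_Z (inv_mem hh), ← mul_smul, ← mul_inv_rev,
      ← smul_mem_cone c.ne_zero (y := (scaleFrm c (A * h))⁻¹ • z)]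
    have : (A * h)⁻¹ • z = (c : ℂ) • (scaleFrm c (A * h))⁻¹ • z := by
      rw [inv_smul_eq_iff, smul_comm (A * h), ← scaleFrm_smul, smul_inv_smul]
    rw [this]
  -- Both cones are submanifolds near `y`, with tangent spaces of dimension m + 1, so the inclusion
  -- of X is an equality near this point.
  have hev := hv.eventually_mem_of_le hT (by rw [finrank_map_tangent, finrank_map_tangent])
    (Eventually.of_forall hcone)
  obtain ⟨S, -, hS⟩ := hX
  rintro _ ⟨_, ⟨k, hk, rfl⟩, rfl⟩
  -- An entire curve in G leads from the point of `h` to the point of `k`. The equations of X hold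
  -- along it for small t, hence for all t by the identity theorem.
  obtain ⟨γ, h0, h1, hγ, hd⟩ := 𝓗.exists_curve (mul_mem hk (inv_mem hh))
  let w : ℂ → Vec m e := fun t => (c : ℂ) • A • γ t • h • refVec i0
  have hw : ∀ i, Differentiable ℂ fun t => w t i := by
    intro i t
    obtain ⟨A', hA'⟩ := hd t
    have h2 := (hA'.const_mul (A : Mat m e)).linear
      ((LinearMap.proj i : Vec m e →ₗ[ℂ] ℂ) ∘ₗ (Matrix.mulVecBilin ℂ ℂ).flip (h • refVec i0))
    have h3 := (h2.const_mul (c : ℂ)).differentiableAt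
    have heq : (fun t => w t i) = fun t => (c : ℂ) *
        ((LinearMap.proj i : Vec m e →ₗ[ℂ] ℂ) ∘ₗ (Matrix.mulVecBilin ℂ ℂ).flip (h • refVec i0))
          ((A : Mat m e) * (γ t : Mat m e)) := by
      funext t
      change (c : ℂ) * (A • γ t • h • (refVec i0 : Vec m e)) i = _
      rw [← mul_smul A]
      rfl
    rw [heq]
    exact h3
  have hw0 : w 0 = y := by
    change (c : ℂ) • A • γ 0 • h • refVec i0 = y
    rw [h0, one_smul, hyA, scaleFrm_smul, mul_smul]
  have hwZ : ∀ t, w t ∈ cone Z' := by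
    intro t
    rw [smul_mem_cone c.ne_zero, mem_cone_smul_image, inv_smul_smul, 𝓗.smul_mem_cone_Z (hγ t)]
    exact 𝓗.smul_refVec_mem_cone_Z hh
  have hwX : ∀ᶠ t in 𝓝 0, w t ∈ cone X := by
    have hc : Tendsto w (𝓝 0) (𝓝 y) := by
      rw [← hw0]
      exact tendsto_pi_nhds.2 fun i => (hw i 0).continuousAt
    filter_upwards [hc.eventually hev] with t ht
    exact ht (hwZ t)
  have hw1 : w 1 = (c : ℂ) • (A * k) • refVec i0 := by
    change (c : ℂ) • A • γ 1 • h • refVec i0 = _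
    rw [h1, ← mul_smul, ← mul_smul, mul_assoc, inv_mul_cancel_right]
  have hmem : (c : ℂ) • (A * k) • (refVec i0 : Vec m e) ≠ 0 :=
    smul_ne_zero c.ne_zero ((smul_ne_zero_iff_ne _).2 (refVec_ne_zero _))
  have hfin : Projectivization.mk ℂ _ hmem ∈ X := by
    refine (hS _ hmem).2 fun f hf => ?_
    rw [← hw1]
    exact eval_eq_zero_of_eventually hw (hwX.mono fun t ht => (hS _ ht.1).1 ht.2 f hf) 1
  change A • k • refPt m e ∈ X
  convert hfin using 1
  rw [← mul_smul, refPt, Projectivization.smul_mk, Projectivization.mk_eq_mk_iff']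
  exact ⟨(c : ℂ)⁻¹, by rw [smul_smul, inv_mul_cancel₀ c.ne_zero, one_smul]⟩

/-- Rigidity only treats connected manifolds, so it may give a different translate of Z on each
component of the sub-bundle; irreducibility of X selects a single one. -/
theorem IsPointRigid.isGradedFGHRigid (hmax : 𝓗.IsMaximal) {gperp : Submodule ℂ (Mat m e)}
    (hperp : 𝓗.IsModuleComplement gperp) {p : ℤ} (hp : 0 < p + 2)
    (hrig : 𝓗.IsPointRigid gperp p (p + 2)) : 𝓗.IsGradedFGHRigid (𝓗.q + p + 1) := by
  rintro X hX ⟨N, M, _, _, _, _, _, g, hg⟩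
  have : LocallyConnectedSpace M := ChartedSpace.locallyConnectedSpace (EuclideanSpace ℂ (Fin N)) M
  let U : M → Opens M := fun x => ⟨connectedComponent x, isOpen_connectedComponent⟩
  have hA : ∀ x, ∃ A : Frm m e, ∀ y ∈ connectedComponent x, A • g y • refPt m e ∈ 𝓗.Z := by
    intro x
    have : ConnectedSpace (U x) := isConnected_iff_connectedSpace.1 isConnected_connectedComponent
    obtain ⟨A, hA⟩ := hrig N (U x) (fun y => g y) ((hg.isAgreeing.restrict (U x)).isIntegral hmax hperp hp)
    exact ⟨A, fun y hy => hA ⟨y, hy⟩⟩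
  choose A hA using hA
  -- Components are open, so by second countability countably many of them cover M.
  obtain ⟨s, hs, hcov⟩ := TopologicalSpace.countable_cover_nhds fun x : M => (U x).2.mem_nhds mem_connectedComponent
  obtain ⟨Y, hY, hne, hrange⟩ := hg.1.2.2.2.1
  have : Countable s := hs.to_subtype
  -- The index `none` stands for the closed set that the sub-bundle misses; X cannot lie in it,
  -- since the sub-bundle covers a nonempty part of X.
  obtain ⟨o, ho⟩ := hX.exists_subset (ι := Option s)
    (Y := fun o => o.elim Y fun x => (fun z => (A x)⁻¹ • z) '' 𝓗.Z)
    (by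
      rintro (_ | x)
      · exact hY
      · exact 𝓗.isZariskiClosed_smul_Z _)
    (by
      intro z hz
      by_cases hzY : z ∈ Y
      · exact Set.mem_iUnion.2 ⟨none, hzY⟩
      · have : z ∈ X \ Y := ⟨hz, hzY⟩
        rw [← hrange] at this
        obtain ⟨y, rfl⟩ := this
        have hy : y ∈ ⋃ x ∈ s, (U x).carrier := by rw [hcov]; trivial
        obtain ⟨x, hx, hyx⟩ := Set.mem_iUnion₂.1 hy
        exact Set.mem_iUnion.2 ⟨some ⟨x, hx⟩, _, hA x y hyx, inv_smul_smul _ _⟩)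
  obtain ⟨z, hzX, hzY⟩ := hne
  have hz : z ∈ X \ Y := ⟨hzX, hzY⟩
  rw [← hrange] at hz
  obtain ⟨y, -⟩ := hz
  rcases o with _ | x
  · exact absurd (ho hzX) hzY
  · exact ⟨_, eq_of_subset hX.1 (hg.1.2.2.1 y) ho⟩

end HomogeneousEmbedding
end FubiniRigidity

end

theorem propositionP {m e : ℕ} (𝓗 : FubiniRigidity.HomogeneousEmbedding m e) (hmax : 𝓗.IsMaximal)
    (gperp : Submodule ℂ (FubiniRigidity.Mat m e)) (hperp : 𝓗.IsModuleComplement gperp)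
    (p : ℤ) (hp : -𝓗.q ≤ p) (hr : 0 < p + 2) :
    (∀ X : Set (ℙ ℂ (FubiniRigidity.Vec m e)), FubiniRigidity.IsProjectiveVariety X →
      ∀ (N : ℕ) (M : Type) [TopologicalSpace M] [T2Space M] [SecondCountableTopology M]
        [ChartedSpace (EuclideanSpace ℂ (Fin N)) M]
        [IsManifold 𝓘(ℂ, EuclideanSpace ℂ (Fin N)) ω M] (g : M → FubiniRigidity.Frm m e),
        FubiniRigidity.IsAgreementBundle N 𝓗 X (𝓗.q + p + 1) g →
          𝓗.IsIntegral gperp p (p + 2) N g) ∧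
    (𝓗.IsRigid gperp p (p + 2) → 𝓗.IsGradedFGHRigid (𝓗.q + p + 1)) ∧
    (𝓗.IsPointRigid gperp p (p + 2) → 𝓗.IsGradedFGHRigid (𝓗.q + p + 1)) :=
  ⟨fun _ _ _ _ _ _ _ _ _ _ hg => hg.isAgreeing.isIntegral hmax hperp hr,
    fun h => h.isPointRigid.isGradedFGHRigid hmax hperp hr, fun h => h.isGradedFGHRigid hmax hperp hr⟩
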